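/- Let $n\ge 1$, $1<p<\infty$ and $1<q<\infty$. Let $T$ be a Calderón–Zygmund singular integral operator, i.e. a bounded $\mathbb C$-linear operator on $L^q(\mathbb R^n;\mathbb C)$ for which there is a kernel $K(x,y)\in\mathbb C$, $x\neq y$, and a constant $C$ with $$|K(x,y)|\le \frac{C}{|x-y|^{n}},\qquad |K(x,y)-K(x,y')|\le C\frac{|y-y'|}{|x-y|^{n+1}}\ \text{ if } |x-y|\ge 2|y-y'|,$$ $$|K(x,y)-K(x',y)|\le C\frac{|x-x'|}{|x-y|^{n+1}}\ \text{ if } |x-y|\ge 2|x-x'|,$$ such that, whenever $f\in L^q(\mathbb R^n)$ vanishes a.e. outside a compact set $F$, $Tf(x)=\int_{\mathbb R^n}K(x,y)f(y)\,dy$ for almost every $x\notin F$. Let $\omega\in A_p$, i.e. $\omega\in L^1_{loc}(\mathbb R^n)$, $\omega>0$ a.e., and $$[\omega]_{A_p}=\sup_Q\Big(\frac1{|Q|}\int_Q\omega\,dx\Big)\Big(\frac1{|Q|}\int_Q\omega^{-p'/p}\,dx\Big)^{p/p'}<\infty,$$ the supremum being over all cubes $Q$ with sides parallel to the axes and $\frac1p+\frac1{p'}=1$.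 Let $L^p(\omega)$ be the space of measurable $f:\mathbb R^n\to\mathbb C$ with $\int|f|^p\omega\,dx<\infty$. Let $b\in VMO(\mathbb R^n)$, i.e. $b\in L^1_{loc}(\mathbb R^n;\mathbb C)$ lies in the closure of $C_c^\infty(\mathbb R^n;\mathbb C)$ in the $BMO$ seminorm $\|b\|_*=\sup_Q\frac1{|Q|}\int_Q|b-b_Q|\,dx$, where $b_Q=\frac1{|Q|}\int_Q b\,dx$. Then the commutator $[b,T]$ is well defined and compact on $L^p(\omega)$: for every bounded compactly supported measurable $f$ one has $f\in L^p(\omega)$ and $f,bf\in L^q(\mathbb R^n)$; there is exactly one bounded linear operator $[b,T]:L^p(\omega)\to L^p(\omega)$ such that $[b,T]f=b\,Tf-T(bf)$ a.e. for all such $f$; and this operator is compact. -/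

import Mathlib

open MeasureTheory
open scoped ENNReal

namespace CZCommutator

noncomputable section

/-- The closed cube in `ℝⁿ` with centre `c`, side length `2 * r` and sides parallel to the axes. -/
def cube {n : ℕ} (c : EuclideanSpace ℝ (Fin n)) (r : ℝ) : Set (EuclideanSpace ℝ (Fin n)) :=
  {y | ∀ i, |y i - c i| ≤ r}

/-- A weight: a locally integrable function that is positive almost everywhere. -/
structure IsWeight {n : ℕ} (ω : EuclideanSpace ℝ (Fin n) → ℝ) : Prop where
  locallyIntegrable : LocallyIntegrable ω volume
  pos : ∀ᵐ x, 0 < ω x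

/-- The constant `[ω]_{A_p}`: the supremum over all cubes `Q` of
`(⨍_Q ω) * (⨍_Q ω ^ (-p'/p)) ^ (p/p')`, where `1/p + 1/p' = 1`. The averages are taken in `[0, ∞]`,
so that the value is `∞` when `ω ^ (-p'/p)` is not integrable on some cube. -/
def apConst {n : ℕ} (p : ℝ) (ω : EuclideanSpace ℝ (Fin n) → ℝ) : ℝ≥0∞ :=
  ⨆ (c : EuclideanSpace ℝ (Fin n)) (r : ℝ) (_ : 0 < r),
    (⨍⁻ x in cube c r, ENNReal.ofReal (ω x) ∂volume) *
      (⨍⁻ x in cube c r, ENNReal.ofReal (ω x) ^ (-(p.conjExponent / p)) ∂volume) ^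
        (p / p.conjExponent)

/-- The Muckenhoupt class `A_p`, for `1 < p < ∞`. -/
structure IsMuckenhoupt {n : ℕ} (p : ℝ) (ω : EuclideanSpace ℝ (Fin n) → ℝ) : Prop where
  isWeight : IsWeight ω
  apConst_lt_top : apConst p ω < ∞

/-- The measure `ω(x) dx`; the space `L^p(ω)` is `Lp ℂ p (weightMeasure ω)`. -/
def weightMeasure {n : ℕ} (ω : EuclideanSpace ℝ (Fin n) → ℝ) :
    Measure (EuclideanSpace ℝ (Fin n)) :=
  volume.withDensity fun x => ENNReal.ofReal (ω x)

/-- The `BMO` seminorm: the supremum over all cubes `Q` of `⨍_Q |b - b_Q|`, where `b_Q = ⨍_Q b`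
(meaningful for locally integrable `b`). -/
def bmoSeminorm {n : ℕ} (b : EuclideanSpace ℝ (Fin n) → ℂ) : ℝ≥0∞ :=
  ⨆ (c : EuclideanSpace ℝ (Fin n)) (r : ℝ) (_ : 0 < r),
    ⨍⁻ x in cube c r, ‖b x - ⨍ y in cube c r, b y ∂volume‖ₑ ∂volume

/-- `VMO(ℝⁿ)`: the closure of the smooth compactly supported functions in the `BMO` seminorm. -/
structure IsVMO {n : ℕ} (b : EuclideanSpace ℝ (Fin n) → ℂ) : Prop where
  locallyIntegrable : LocallyIntegrable b volume
  approx : ∀ ε : ℝ≥0∞, 0 < ε → ∃ φ : EuclideanSpace ℝ (Fin n) → ℂ,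
    ContDiff ℝ ((⊤ : ℕ∞) : WithTop ℕ∞) φ ∧ HasCompactSupport φ ∧ bmoSeminorm (fun x => b x - φ x) < ε

/-- A Calderón–Zygmund kernel; the values on the diagonal are irrelevant. -/
structure IsCZKernel {n : ℕ}
    (K : EuclideanSpace ℝ (Fin n) → EuclideanSpace ℝ (Fin n) → ℂ) (C : ℝ) : Prop where
  size : ∀ x y, x ≠ y → ‖K x y‖ ≤ C / ‖x - y‖ ^ n
  smooth_right : ∀ x y y', x ≠ y → 2 * ‖y - y'‖ ≤ ‖x - y‖ →
    ‖K x y - K x y'‖ ≤ C * (‖y - y'‖ / ‖x - y‖ ^ (n + 1))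
  smooth_left : ∀ x x' y, x ≠ y → 2 * ‖x - x'‖ ≤ ‖x - y‖ →
    ‖K x y - K x' y‖ ≤ C * (‖x - x'‖ / ‖x - y‖ ^ (n + 1))

/-- A Calderón–Zygmund singular integral operator: a bounded linear operator `T` on `L^q(ℝⁿ)` such
that, for some Calderón–Zygmund kernel `K`, every `f ∈ L^q` vanishing outside a compact set `F`
satisfies `T f (x) = ∫ K(x, y) f(y) dy` for almost every `x` outside `F`. -/
def IsCZOperator {n : ℕ} {q : ℝ≥0∞} [Fact (1 ≤ q)]
    (T : Lp ℂ q (volume : Measure (EuclideanSpace ℝ (Fin n))) →L[ℂ]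
      Lp ℂ q (volume : Measure (EuclideanSpace ℝ (Fin n)))) : Prop :=
  ∃ (K : EuclideanSpace ℝ (Fin n) → EuclideanSpace ℝ (Fin n) → ℂ) (C : ℝ), IsCZKernel K C ∧
    ∀ (f : Lp ℂ q (volume : Measure (EuclideanSpace ℝ (Fin n))))
      (F : Set (EuclideanSpace ℝ (Fin n))), IsCompact F → (∀ᵐ y, y ∉ F → f y = 0) →
        ∀ᵐ x, x ∉ F → T f x = ∫ y, K x y * f y

/-- `S` is the commutator `[b, T]` as a bounded operator on `L^p(ω)`: on bounded, compactly
supported functions `f` it is given by `b * T f - T (b * f)`, and all the terms make sense. -/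
def IsCommutator {n : ℕ} {p q : ℝ≥0∞} [Fact (1 ≤ p)] [Fact (1 ≤ q)]
    (ω : EuclideanSpace ℝ (Fin n) → ℝ) (b : EuclideanSpace ℝ (Fin n) → ℂ)
    (T : Lp ℂ q (volume : Measure (EuclideanSpace ℝ (Fin n))) →L[ℂ]
      Lp ℂ q (volume : Measure (EuclideanSpace ℝ (Fin n))))
    (S : Lp ℂ p (weightMeasure ω) →L[ℂ] Lp ℂ p (weightMeasure ω)) : Prop :=
  ∀ f : EuclideanSpace ℝ (Fin n) → ℂ, MemLp f ∞ volume → HasCompactSupport f →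
    ∃ (hω : MemLp f p (weightMeasure ω)) (hf : MemLp f q volume)
      (hbf : MemLp (fun x => b x * f x) q volume),
      ∀ᵐ x, S (hω.toLp f) x = b x * T (hf.toLp f) x - T (hbf.toLp (fun x => b x * f x)) x

end

end CZCommutator

namespace CZCommutator

open Set Filter Topology
open scoped NNReal

/-! ### Boxes and dyadic grids -/

/-! Everything rests on one estimate: for `b` of bounded mean oscillation, the `L^p(ω)` norm of `[b,
T] f` is at most `L * ‖b‖_*` times that of `f`, with `L` independent of `b` and `f`
(`IsCZPair.exists_eLpNorm_comm_le`). By density of bounded compactly supported functions it gives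
existence of the operator. It also makes `b ↦ [b, T]` continuous from the `BMO` seminorm to the
operator norm; since compact operators are norm closed, it remains to treat a continuous, compactly
supported symbol `φ`.

The estimate is proved by sparse domination. A Calderón–Zygmund decomposition shows that `T` is
locally of weak type `(1, 1)` (`IsCZPair.exists_local_weak`). Hence, off an open set of small
relative measure, `T` of a function is controlled by the average of that function, and so is the
contribution to a subbox of what lies far from that subbox: this is checked at one good point and
carried to the others by smoothness of the kernel (`IsCZPair.exists_stopping_set`). A commutator
does not change when a constant `a P` is subtracted from `b`, so applying this to `f` and to `(b - a
P) f` and iterating in maximal dyadic subboxes bounds `[b, T] f` by a sum over a tree of boxes of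
`|b - a P|` times the average of `|f|`, plus the average of `|b - a P| |f|`
(`IsCZPair.exists_sparse_domination`). The children of a box cover at most half of it, so the boxes
own disjoint portions of at least half their volume. In the pairing with a test function, Hölder and
John–Nirenberg with respect to the weights (`exists_lintegral_oscillation_le`) replace the
oscillations by `‖b‖_*` at the cost of turning `L^1` averages into `L^s` averages with `s` slightly
above `1`. The `A_p` condition transfers the weights to the disjoint portions, and a Carleson
embedding (`exists_sum_average_rpow_le`) sums up.

For `φ`, divide space into the cells of a fine grid and remove from the kernel the part where `y`
lies in the dilate of the cell of `x`. On each cell the removed part is a commutator whose symbol is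
`φ - φ z` restricted to the dilate, which is uniformly small; the same weighted estimate and the
bounded overlap of the dilates make this part small
(`IsCZPair.exists_lintegral_comm_sub_integral_le`). The remaining kernel is at most a multiple of
`(1 + |y|)^(-n)` for `x` in a bounded set, and of `(1 + |x|)^(-n)` with `y` in a fixed box for `x`
far away. These decay factors lie in `L^p(ω)` and in the dual space by the `A_p` condition
(`WeightPair.lintegral_decay_rpow_ne_top`). Freezing `x` at the centres of a still finer grid inside
a large box therefore gives an approximation of finite rank. -/

/-- The space `ℝⁿ`. -/
abbrev Euc (n : ℕ) := EuclideanSpace ℝ (Fin n)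

/-- The half-open box with centre `c` and side length `2 * r`. -/
def box {n : ℕ} (c : Euc n) (r : ℝ) : Set (Euc n) :=
  {x | ∀ i, c i - r ≤ x i ∧ x i < c i + r}

variable {n : ℕ}

theorem mem_box {c x : Euc n} {r : ℝ} : x ∈ box c r ↔ ∀ i, c i - r ≤ x i ∧ x i < c i + r :=
  Iff.rfl

theorem box_eq_preimage (c : Euc n) (r : ℝ) :
    box c r = WithLp.ofLp ⁻¹' (Set.univ.pi fun i => Set.Ico (c i - r) (c i + r)) := by
  ext x; simp [box]

theorem cube_eq_preimage (c : Euc n) (r : ℝ) :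
    cube c r = WithLp.ofLp ⁻¹' (Set.univ.pi fun i => Set.Icc (c i - r) (c i + r)) := by
  ext x
  simp only [cube, Set.mem_ofPred_eq, Set.mem_preimage, Set.mem_pi, Set.mem_univ, true_imp_iff,
    Set.mem_Icc, abs_le]
  refine forall_congr' fun i => ⟨fun h => ⟨by linarith [h.1], by linarith [h.2]⟩,
    fun h => ⟨by linarith [h.1], by linarith [h.2]⟩⟩

@[measurability]
theorem measurableSet_box (c : Euc n) (r : ℝ) : MeasurableSet (box c r) := by
  rw [box_eq_preimage]
  exact (PiLp.volume_preserving_ofLp (Fin n)).measurable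
    (MeasurableSet.univ_pi fun i => measurableSet_Ico)

theorem volume_box (c : Euc n) (r : ℝ) : volume (box c r) = ENNReal.ofReal (2 * r) ^ n := by
  rw [box_eq_preimage, (PiLp.volume_preserving_ofLp (Fin n)).measure_preimage
    (MeasurableSet.univ_pi fun i => measurableSet_Ico).nullMeasurableSet, Real.volume_pi_Ico]
  have : ∀ i : Fin n, c i + r - (c i - r) = 2 * r := fun i => by ring
  simp [this]

theorem volume_box_mul (c d : Euc n) {t : ℝ} (ht : 0 ≤ t) (r : ℝ) :
    volume (box c (t * r)) = ENNReal.ofReal t ^ n * volume (box d r) := by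
  rw [volume_box, volume_box, ← mul_pow, ← ENNReal.ofReal_mul ht]
  congr 2; ring

theorem volume_box_ne_top (c : Euc n) (r : ℝ) : volume (box c r) ≠ ∞ := by
  rw [volume_box]; exact ENNReal.pow_ne_top ENNReal.ofReal_ne_top

theorem volume_box_pos (c : Euc n) {r : ℝ} (hr : 0 < r) : 0 < volume (box c r) := by
  rw [volume_box]; exact ENNReal.pow_pos (by simpa using hr) n

theorem box_nonempty (c : Euc n) {r : ℝ} (hr : 0 < r) : (box c r).Nonempty :=
  ⟨c, fun i => ⟨by linarith, by linarith⟩⟩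

theorem self_mem_box (c : Euc n) {r : ℝ} (hr : 0 < r) : c ∈ box c r :=
  fun i => ⟨by linarith, by linarith⟩

theorem box_subset_cube (c : Euc n) (r : ℝ) : box c r ⊆ cube c r := by
  rw [box_eq_preimage, cube_eq_preimage]
  exact Set.preimage_mono (Set.pi_mono fun i _ => Set.Ico_subset_Icc_self)

theorem isCompact_cube (c : Euc n) (r : ℝ) : IsCompact (cube c r) := by
  rw [cube_eq_preimage]
  have := (EuclideanSpace.equiv (Fin n) ℝ).toHomeomorph.isCompact_preimage
    (s := Set.univ.pi fun i => Set.Icc (c i - r) (c i + r))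
  exact this.2 (isCompact_univ_pi fun i => isCompact_Icc)

/-- Half-open boxes are used because grids of them partition space exactly. The faces are null, so
averages over the closed cubes of the definitions are averages over boxes. -/
theorem box_ae_eq_cube (c : Euc n) (r : ℝ) : box c r =ᵐ[volume] cube c r := by
  rw [box_eq_preimage, cube_eq_preimage]
  rw [Set.pi_univ_Icc]
  exact (PiLp.volume_preserving_ofLp (Fin n)).quasiMeasurePreserving.preimage_ae_eq
    Measure.univ_pi_Ico_ae_eq_Icc

theorem box_mono (c : Euc n) {r s : ℝ} (h : r ≤ s) : box c r ⊆ box c s :=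
  fun _ hx i => ⟨by linarith [(hx i).1], by linarith [(hx i).2]⟩

theorem box_subset_box_of_mem {c x : Euc n} {r : ℝ} (hx : x ∈ box c r) :
    box c r ⊆ box x (2 * r) :=
  fun y hy i => ⟨by linarith [(hy i).1, (hx i).2], by linarith [(hy i).2, (hx i).1]⟩

theorem box_subset_box_of_mem' {c x : Euc n} {r s : ℝ} (hx : x ∈ box c r) :
    box x s ⊆ box c (r + s) :=
  fun y hy i => ⟨by linarith [(hy i).1, (hx i).1], by linarith [(hy i).2, (hx i).2]⟩

/-- In each coordinate the deviation is below `2 * r + s`, hence at most `5 * s`. This is the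
enlargement in the Vitali covering argument with ratio `2`. -/
theorem box_subset_box_of_inter {c d : Euc n} {r s : ℝ} (h : (box c r ∩ box d s).Nonempty)
    (hrs : r ≤ 2 * s) : box c r ⊆ box d (5 * s) := by
  obtain ⟨x, hx, hy⟩ := h
  exact fun y hz i => ⟨by linarith [(hz i).1, (hx i).2, (hy i).1],
    by linarith [(hz i).2, (hx i).1, (hy i).2]⟩

theorem abs_sub_le_norm (x y : Euc n) (i : Fin n) : |x i - y i| ≤ ‖x - y‖ := by
  have := PiLp.norm_apply_le (x - y) i
  simpa using this

theorem le_norm_sub_of_notMem_box {c y : Euc n} {r : ℝ} (hy : y ∉ box c r) : r ≤ ‖y - c‖ := by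
  simp only [mem_box, not_forall] at hy
  obtain ⟨i, hi⟩ := hy
  refine le_trans ?_ (abs_sub_le_norm y c i)
  by_contra! h
  have := abs_lt.1 h
  exact hi ⟨by linarith, by linarith⟩

/-- The crude factor `n` in place of `√n` explains the dilation `5 * n` used throughout: a point
outside the dilate is at distance at least `4 * n * r` from the points of the box, twice the bound
`2 * n * r` for its diameter, which is what the smoothness of the kernel asks for. -/
theorem norm_le_of_abs_le {x : Euc n} {r : ℝ} (hr : 0 ≤ r) (h : ∀ i, |x i| ≤ r) : ‖x‖ ≤ n * r := by
  rw [EuclideanSpace.norm_eq]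
  refine Real.sqrt_le_iff.2 ⟨by positivity, ?_⟩
  calc ∑ i, ‖x i‖ ^ 2 ≤ ∑ _i : Fin n, r ^ 2 := Finset.sum_le_sum fun i _ => by
        rw [Real.norm_eq_abs]; exact pow_le_pow_left₀ (abs_nonneg _) (h i) 2
    _ = n * r ^ 2 := by simp
    _ ≤ (n * r) ^ 2 := by
        rw [mul_pow]
        have : (n : ℝ) ≤ (n : ℝ) ^ 2 := by exact_mod_cast Nat.le_self_pow two_ne_zero n
        exact mul_le_mul_of_nonneg_right this (sq_nonneg r)

theorem norm_sub_center_le {c y : Euc n} {r : ℝ} (hr : 0 ≤ r) (hy : y ∈ box c r) :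
    ‖y - c‖ ≤ n * r :=
  norm_le_of_abs_le hr fun i => abs_le.2 ⟨by simp; linarith [(hy i).1], by simp; linarith [(hy i).2]⟩

theorem norm_sub_le_of_mem_box {c x y : Euc n} {r : ℝ} (hr : 0 ≤ r) (hx : x ∈ box c r)
    (hy : y ∈ box c r) : ‖x - y‖ ≤ n * (2 * r) :=
  norm_le_of_abs_le (by linarith) fun i => abs_le.2
    ⟨by simp; linarith [(hy i).2, (hx i).1], by simp; linarith [(hy i).1, (hx i).2]⟩

theorem mem_box_of_norm_lt {c x : Euc n} {r : ℝ} (h : ‖x - c‖ < r) : x ∈ box c r := by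
  by_contra hx
  exact absurd (le_norm_sub_of_notMem_box hx) (not_le.2 h)

theorem _root_.Bornology.IsBounded.exists_subset_box {s : Set (Euc n)}
    (hs : Bornology.IsBounded s) (c : Euc n) : ∃ r, 0 < r ∧ ∀ r', r ≤ r' → s ⊆ box c r' := by
  obtain ⟨r, hr⟩ := hs.subset_ball c
  refine ⟨max r 1, by positivity, fun r' h' x hx => mem_box_of_norm_lt ?_⟩
  have := hr hx
  rw [Metric.mem_ball, dist_eq_norm] at this
  exact this.trans_le ((le_max_left _ _).trans h')

theorem isBounded_box (c : Euc n) (r : ℝ) : Bornology.IsBounded (box c r) :=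
  (isCompact_cube c r).isBounded.subset (box_subset_cube c r)

/-- The open cube. -/
theorem isOpen_openCube (c : Euc n) (r : ℝ) : IsOpen {x : Euc n | ∀ i, |x i - c i| < r} := by
  simp only [Set.ofPred_forall]
  exact isOpen_iInter_of_finite fun i => isOpen_lt (by fun_prop) continuous_const

theorem exists_box_subset_of_isOpen {U : Set (Euc n)} (hU : IsOpen U) {x : Euc n} (hx : x ∈ U) :
    ∃ ε > 0, ∀ c r, r < ε → 0 ≤ r → x ∈ box c r → box c r ⊆ U := by
  obtain ⟨ε, hε, h⟩ := Metric.isOpen_iff.1 hU x hx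
  -- A box of half side `r` has diameter at most `2 * n * r`; the `1` keeps the denominator positive
  -- also for `n = 0`.
  refine ⟨ε / (2 * n + 1), by positivity, fun c r hr h0 hxc y hy => h ?_⟩
  rw [Metric.mem_ball, dist_eq_norm]
  refine (norm_sub_le_of_mem_box h0 hy hxc).trans_lt ?_
  rw [lt_div_iff₀ (by positivity)] at hr
  nlinarith

/-! ### Nested grids of half-open boxes. -/

/-- The centre of the box containing `x` in the grid of boxes of side length `2 * l` that has the
corner `a`. -/
noncomputable def gridCtr (a : Euc n) (l : ℝ) (x : Euc n) : Euc n :=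
  WithLp.toLp 2 fun i => a i + l * (2 * ⌊(x i - a i) / (2 * l)⌋ + 1)

theorem gridCtr_apply (a : Euc n) (l : ℝ) (x : Euc n) (i : Fin n) :
    gridCtr a l x i = a i + l * (2 * ⌊(x i - a i) / (2 * l)⌋ + 1) := rfl

theorem mem_box_gridCtr (a : Euc n) {l : ℝ} (hl : 0 < l) (x : Euc n) :
    x ∈ box (gridCtr a l x) l := by
  intro i
  rw [gridCtr_apply]
  have h1 := Int.floor_le ((x i - a i) / (2 * l))
  have h2 := Int.lt_floor_add_one ((x i - a i) / (2 * l))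
  rw [le_div_iff₀ (by positivity)] at h1
  rw [div_lt_iff₀ (by positivity)] at h2
  constructor <;> nlinarith

/-- Disjointness of the cells of a grid is always used in this form: a point determines the cell
that contains it. -/
theorem gridCtr_eq_of_mem {a x z : Euc n} {l : ℝ} (hl : 0 < l) (hz : z ∈ box (gridCtr a l x) l) :
    gridCtr a l z = gridCtr a l x := by
  ext i
  have h := hz i
  rw [gridCtr_apply] at h
  rw [gridCtr_apply, gridCtr_apply]
  have : ⌊(z i - a i) / (2 * l)⌋ = ⌊(x i - a i) / (2 * l)⌋ := by
    rw [Int.floor_eq_iff, le_div_iff₀ (by positivity), div_lt_iff₀ (by positivity)]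
    constructor <;> nlinarith [h.1, h.2]
  rw [this]

/-- Halving the side refines the grid, because `⌊2 * t⌋` determines `⌊t⌋`. -/
theorem gridCtr_half {a x z : Euc n} {l : ℝ} (hl : 0 < l)
    (h : gridCtr a (l / 2) x = gridCtr a (l / 2) z) : gridCtr a l x = gridCtr a l z := by
  ext i
  have hi := congrArg (fun y : Euc n => y i) h
  simp only [gridCtr_apply] at hi ⊢
  have hl' : l ≠ 0 := hl.ne'
  have e : ∀ y : ℝ, (y - a i) / (2 * (l / 2)) = 2 * ((y - a i) / (2 * l)) := fun y => by
    field_simp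
  rw [e, e] at hi
  set t := (x i - a i) / (2 * l)
  set s := (z i - a i) / (2 * l)
  have hm : ⌊2 * t⌋ = ⌊2 * s⌋ := by
    have : (⌊2 * t⌋ : ℝ) = ⌊2 * s⌋ := by
      have := mul_left_cancel₀ (by positivity) (add_left_cancel hi)
      linarith
    exact_mod_cast this
  have : ⌊t⌋ = ⌊s⌋ := by
    symm
    rw [Int.floor_eq_iff]
    have h1 : 2 * ⌊t⌋ ≤ ⌊2 * t⌋ := Int.le_floor.2 (by push_cast; linarith [Int.floor_le t])
    have h2 : ⌊2 * t⌋ < 2 * ⌊t⌋ + 2 := Int.floor_lt.2 (by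
      push_cast; linarith [Int.lt_floor_add_one t])
    rw [hm] at h1 h2
    have h3 : (2 * ⌊t⌋ : ℝ) ≤ ⌊2 * s⌋ := by exact_mod_cast h1
    have h4 : (⌊2 * s⌋ : ℝ) + 1 ≤ 2 * ⌊t⌋ + 2 := by exact_mod_cast h2
    constructor <;> linarith [Int.floor_le (2 * s), Int.lt_floor_add_one (2 * s)]
  rw [this]

theorem countable_range_gridCtr (a : Euc n) (l : ℝ) : (range (gridCtr a l)).Countable := by
  refine (countable_range (fun m : Fin n → ℤ =>
    (WithLp.toLp 2 fun i => a i + l * (2 * m i + 1) : Euc n))).mono ?_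
  rintro _ ⟨x, rfl⟩
  exact ⟨fun i => ⌊(x i - a i) / (2 * l)⌋, rfl⟩

theorem finite_image_gridCtr (a : Euc n) {l : ℝ} (hl : 0 < l) (c : Euc n) (r : ℝ) :
    (gridCtr a l '' box c r).Finite := by
  refine ((Set.Finite.pi' (ι := Fin n) (t := fun i => Set.Icc ⌊(c i - r - a i) / (2 * l)⌋
    ⌊(c i + r - a i) / (2 * l)⌋) fun i => Set.finite_Icc _ _).image
    (fun m : Fin n → ℤ => (WithLp.toLp 2 fun i => a i + l * (2 * m i + 1) : Euc n))).subset ?_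
  rintro _ ⟨x, hx, rfl⟩
  refine ⟨fun i => ⌊(x i - a i) / (2 * l)⌋, fun i => ⟨Int.floor_le_floor ?_, Int.floor_le_floor ?_⟩,
    rfl⟩
  · exact div_le_div_of_nonneg_right (by linarith [(hx i).1]) (by positivity)
  · exact div_le_div_of_nonneg_right (by linarith [(hx i).2]) (by positivity)

/-- The corner of a box. -/
noncomputable def corner (c : Euc n) (r : ℝ) : Euc n := WithLp.toLp 2 fun i => c i - r

/-- Anchoring the grid at the corner of a box makes that box one of the cells, so that dyadic
subdivision can start from any box. -/
theorem gridCtr_corner {c x : Euc n} {r : ℝ} (hr : 0 < r) (hx : x ∈ box c r) :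
    gridCtr (corner c r) r x = c := by
  ext i
  rw [gridCtr_apply]
  have : ⌊(x i - corner c r i) / (2 * r)⌋ = 0 := by
    rw [Int.floor_eq_iff, le_div_iff₀ (by positivity), div_lt_iff₀ (by positivity)]
    have := hx i
    simp only [corner]
    constructor <;> push_cast <;> linarith [this.1, this.2]
  rw [this]
  simp [corner]

theorem box_gridCtr_half_subset (a : Euc n) {l : ℝ} (hl : 0 < l) (x : Euc n) :
    box (gridCtr a (l / 2) x) (l / 2) ⊆ box (gridCtr a l x) l := by
  intro z hz
  rw [← gridCtr_half hl (gridCtr_eq_of_mem (half_pos hl) hz)]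
  exact mem_box_gridCtr a hl z

/-! ### Selection of maximal dyadic subboxes. -/

/-- A countable disjoint family of subboxes of the box `Q`. -/
structure IsSubfamily (Q : Euc n × ℝ) (F : Set (Euc n × ℝ)) : Prop where
  countable : F.Countable
  pos : ∀ P ∈ F, 0 < P.2
  subset : ∀ P ∈ F, box P.1 P.2 ⊆ box Q.1 Q.2
  disjoint : F.PairwiseDisjoint fun P => box P.1 P.2

/-- The maximal dyadic subboxes in which an open set has density more than `2 ^ (-(n + 1))`. -/
theorem exists_selection {c : Euc n} {r : ℝ} (hr : 0 < r) {U : Set (Euc n)} (hU : IsOpen U)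
    (h : 2 ^ (n + 1) * volume (U ∩ box c r) ≤ volume (box c r)) :
    ∃ F : Set (Euc n × ℝ), IsSubfamily (c, r) F ∧
      (∀ P ∈ F, 2 * volume (box P.1 P.2 ∩ U) ≤ volume (box P.1 P.2)) ∧
      U ∩ box c r ⊆ ⋃ P ∈ F, box P.1 P.2 ∧
      volume (⋃ P ∈ F, box P.1 P.2) ≤ 2 ^ (n + 1) * volume (U ∩ box c r) := by
  classical
  set a := corner c r
  set ρ : ℕ → ℝ := fun k => r / 2 ^ k
  have ρpos : ∀ k, 0 < ρ k := fun k => by positivity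
  have ρsucc : ∀ k, ρ (k + 1) = ρ k / 2 := fun k => by simp only [ρ, pow_succ]; field_simp
  set g : ℕ → Euc n → Euc n := fun k => gridCtr a (ρ k)
  set D : ℕ → Euc n → Set (Euc n) := fun k x => box (g k x) (ρ k)
  have memD : ∀ k x, x ∈ D k x := fun k x => mem_box_gridCtr a (ρpos k) x
  have geq : ∀ k x z, z ∈ D k x → g k z = g k x := fun k x z hz => gridCtr_eq_of_mem (ρpos k) hz
  have gsucc : ∀ k x z, g (k + 1) x = g (k + 1) z → g k x = g k z := fun k x z hxz =>
    gridCtr_half (ρpos k) (by simpa only [g, ρsucc] using hxz)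
  have gle : ∀ j k, j ≤ k → ∀ x z, g k x = g k z → g j x = g j z := fun j k hjk => by
    induction k, hjk using Nat.le_induction with
    | base => exact fun _ _ h => h
    | succ k _ ih => exact fun x z hxz => ih x z (gsucc k x z hxz)
  have Dsucc : ∀ k x, D (k + 1) x ⊆ D k x := fun k x => by
    have := box_gridCtr_half_subset a (ρpos k) x
    simpa only [D, g, ρsucc] using this
  have Dle : ∀ k x, D k x ⊆ D 0 x := fun k x => by
    induction k with
    | zero => exact Subset.rfl
    | succ k ih => exact (Dsucc k x).trans ih
  have D0 : ∀ x ∈ box c r, D 0 x = box c r := fun x hx => by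
    have : g 0 x = c := by
      simp only [g, ρ, pow_zero, div_one]; exact gridCtr_corner hr hx
    simp only [D, this, ρ, pow_zero, div_one]
  -- The threshold `2 ^ (-(n + 1))` is half of the volume ratio `2 ^ (-n)` between a cell and its
  -- parent. A selected cell whose parent is below it has density at most `1 / 2`.
  let good : ℕ → Euc n → Prop := fun k x => volume (D k x) < 2 ^ (n + 1) * volume (D k x ∩ U)
  have good_congr : ∀ k x z, g k x = g k z → good k x → good k z := fun k x z hxz hg => by
    simpa only [good, D, hxz] using hg
  have Dvol : ∀ k x, volume (D k x) = 2 ^ n * volume (D (k + 1) x) := fun k x => by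
    have := volume_box_mul (g k x) (g (k + 1) x) (zero_le_two) (ρ (k + 1))
    rw [ENNReal.ofReal_ofNat] at this
    rw [← this]
    simp only [D]
    congr 2
    rw [ρsucc]; ring
  have exgood : ∀ x ∈ U ∩ box c r, ∃ k, good k x := by
    rintro x ⟨hxU, hxc⟩
    obtain ⟨ε, hε, hb⟩ := exists_box_subset_of_isOpen hU hxU
    obtain ⟨k, hk⟩ : ∃ k : ℕ, ρ k < ε := by
      obtain ⟨k, hk⟩ := pow_unbounded_of_one_lt (r / ε) (one_lt_two)
      refine ⟨k, ?_⟩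
      simp only [ρ]
      rw [div_lt_iff₀ hε] at hk
      rw [div_lt_iff₀ (by positivity)]; linarith
    refine ⟨k, ?_⟩
    have hsub : D k x ⊆ U := hb _ _ hk (ρpos k).le (memD k x)
    simp only [good, inter_eq_left.2 hsub]
    have hv := volume_box_pos (g k x) (ρpos k)
    have hv' := volume_box_ne_top (g k x) (ρ k)
    calc volume (D k x) = 1 * volume (D k x) := (one_mul _).symm
      _ < 2 ^ (n + 1) * volume (D k x) := by
        refine ENNReal.mul_lt_mul_left hv.ne' hv' (one_lt_pow₀ (by norm_num) (by omega))
  -- The value `0` is a default; on `U ∩ box c r` a good level exists, since small cells around a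
  -- point of `U` lie inside `U`.
  let K : Euc n → ℕ := fun x => if hx : ∃ k, good k x then Nat.find hx else 0
  have Kgood : ∀ x ∈ U ∩ box c r, good (K x) x := fun x hx => by
    simp only [K, dif_pos (exgood x hx)]; exact Nat.find_spec (exgood x hx)
  have Kmin : ∀ x ∈ U ∩ box c r, ∀ j, good j x → K x ≤ j := fun x hx j hj => by
    simp only [K, dif_pos (exgood x hx)]; exact Nat.find_min' (exgood x hx) hj
  -- The hypothesis `h` excludes the top box, so every selected cell has a parent inside `box c r`
  -- that is not good.
  have notgood0 : ∀ x ∈ box c r, ¬ good 0 x := fun x hx => by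
    simp only [good, D0 x hx, not_lt, inter_comm (box c r) U]; exact h
  have sub : ∀ x ∈ U ∩ box c r, ∀ k, D k x ⊆ box c r := fun x hx k =>
    (Dle k x).trans (D0 x hx.2).subset
  set F : Set (Euc n × ℝ) := (fun x => (g (K x) x, ρ (K x))) '' (U ∩ box c r)
  have Fcount : F.Countable := by
    have : (⋃ k : ℕ, (fun y => (y, ρ k)) '' range (g k)).Countable :=
      countable_iUnion fun k => (countable_range_gridCtr a (ρ k)).image _
    refine this.mono ?_
    rintro _ ⟨x, _, rfl⟩
    exact mem_iUnion.2 ⟨K x, _, ⟨x, rfl⟩, rfl⟩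
  -- If the cell selected for `x` were strictly coarser, it would contain `y` and be good, against
  -- the minimality of `K y`.
  have key : ∀ x ∈ U ∩ box c r, ∀ y ∈ U ∩ box c r, (D (K x) x ∩ D (K y) y).Nonempty →
      K y ≤ K x := by
    rintro x hx y hy ⟨z, hzx, hzy⟩
    by_contra! hlt
    have e1 : g (K x) z = g (K x) x := geq _ _ _ hzx
    have e2 : g (K x) z = g (K x) y := gle _ _ hlt.le _ _ (geq _ _ _ hzy)
    exact absurd (Kmin y hy _ (good_congr _ _ _ (e1.symm.trans e2) (Kgood x hx))) (not_le.2 hlt)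
  have Fdisj : F.PairwiseDisjoint fun P => box P.1 P.2 := by
    rintro _ ⟨x, hx, rfl⟩ _ ⟨y, hy, rfl⟩ hne
    rw [Function.onFun, Set.disjoint_iff_inter_eq_empty, ← Set.not_nonempty_iff_eq_empty]
    intro hz
    have hK : K x = K y := le_antisymm (key y hy x hx (by rwa [inter_comm])) (key x hx y hy hz)
    obtain ⟨z, hzx, hzy⟩ := hz
    refine hne ?_
    have e1 : g (K x) z = g (K x) x := geq _ _ _ hzx
    have e2 : g (K y) z = g (K y) y := geq _ _ _ hzy
    rw [← hK] at e2
    simp only [← hK, ← e1, ← e2]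
  refine ⟨F, ⟨Fcount, ?_, ?_, Fdisj⟩, ?_, ?_, ?_⟩
  · rintro _ ⟨x, hx, rfl⟩; exact ρpos _
  · rintro _ ⟨x, hx, rfl⟩; exact sub x hx _
  · rintro _ ⟨x, hx, rfl⟩
    have hKpos : K x ≠ 0 := fun h0 => notgood0 x hx.2 (h0 ▸ Kgood x hx)
    obtain ⟨j, hj⟩ := Nat.exists_eq_succ_of_ne_zero hKpos
    have hng : ¬ good j x := fun hg => by have := Kmin x hx j hg; omega
    simp only [good, not_lt] at hng
    simp only [hj]
    change 2 * volume (D (j + 1) x ∩ U) ≤ volume (D (j + 1) x)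
    have h2 : (2 : ℝ≥0∞) ^ n * (2 * volume (D (j + 1) x ∩ U)) ≤ 2 ^ n * volume (D (j + 1) x) := by
      calc (2 : ℝ≥0∞) ^ n * (2 * volume (D (j + 1) x ∩ U))
          = 2 ^ (n + 1) * volume (D (j + 1) x ∩ U) := by ring
        _ ≤ 2 ^ (n + 1) * volume (D j x ∩ U) := by
            gcongr; exact Dsucc j x
        _ ≤ volume (D j x) := hng
        _ = _ := Dvol j x
    exact (ENNReal.mul_le_mul_iff_right (by positivity) (by finiteness)).1 h2
  · intro x hx
    exact mem_biUnion (mem_image_of_mem _ hx) (memD _ x)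
  · rw [measure_biUnion Fcount Fdisj fun P _ => measurableSet_box _ _]
    calc ∑' P : F, volume (box P.1.1 P.1.2)
        ≤ ∑' P : F, 2 ^ (n + 1) * volume (U ∩ box P.1.1 P.1.2) := by
          refine ENNReal.tsum_le_tsum ?_
          rintro ⟨_, x, hx, rfl⟩
          have := (Kgood x hx).le
          rw [inter_comm] at this
          exact this
      _ = 2 ^ (n + 1) * ∑' P : F, volume (U ∩ box P.1.1 P.1.2) := ENNReal.tsum_mul_left
      _ = 2 ^ (n + 1) * volume (⋃ P ∈ F, U ∩ box P.1 P.2) := by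
          rw [measure_biUnion Fcount (Fdisj.mono fun P => inter_subset_right)
            fun P _ => hU.measurableSet.inter (measurableSet_box _ _)]
      _ ≤ 2 ^ (n + 1) * volume (U ∩ box c r) := by
          gcongr
          refine iUnion₂_subset ?_
          rintro _ ⟨x, hx, rfl⟩
          exact inter_subset_inter_right _ (sub x hx _)

end CZCommutator

namespace CZCommutator

open Set Filter Topology
open scoped NNReal

variable {n : ℕ}

/-! ### Maximal inequalities -/

/-- The weak type inequality for the maximal function over boxes. -/
theorem mul_measure_biUnion_box_le {μ : Measure (Euc n)} {D : ℝ≥0∞}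
    (hD : ∀ c r, 0 < r → μ (box c (5 * r)) ≤ D * μ (box c r)) {h : Euc n → ℝ≥0∞} {s : ℝ≥0∞}
    {t : Set (Euc n × ℝ)} {R : ℝ}
    (ht : ∀ P ∈ t, 0 < P.2 ∧ P.2 ≤ R ∧ s * μ (box P.1 P.2) ≤ ∫⁻ x in box P.1 P.2, h x ∂μ) :
    s * μ (⋃ P ∈ t, box P.1 P.2) ≤ D * ∫⁻ x, h x ∂μ := by
  obtain ⟨u, hut, hu, hcov⟩ := Vitali.exists_disjoint_subfamily_covering_enlargement
    (fun P : Euc n × ℝ => box P.1 P.2) t (fun P => P.2) 2 one_lt_two (fun P hP => (ht P hP).1.le) R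
    (fun P hP => (ht P hP).2.1) (fun P hP => box_nonempty _ (ht P hP).1)
  have ucount : u.Countable := by
    refine hu.countable_of_nonempty_interior fun P hP => ?_
    refine ⟨P.1, mem_interior.2 ⟨_, ?_, isOpen_openCube P.1 P.2, ?_⟩⟩
    · intro y hy i
      have := abs_lt.1 (hy i)
      exact ⟨by linarith, by linarith⟩
    · intro i; simpa using (ht P (hut hP)).1
  calc s * μ (⋃ P ∈ t, box P.1 P.2) ≤ s * μ (⋃ P ∈ u, box P.1 (5 * P.2)) := by
        refine mul_le_mul_right (measure_mono (iUnion₂_subset fun P hP => ?_)) _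
        obtain ⟨P', hP', hne, hr⟩ := hcov P hP
        exact (box_subset_box_of_inter hne hr).trans
          (subset_biUnion_of_mem (u := fun P : Euc n × ℝ => box P.1 (5 * P.2)) hP')
    _ ≤ s * ∑' P : u, μ (box P.1.1 (5 * P.1.2)) := by
        gcongr; exact measure_biUnion_le μ ucount _
    _ ≤ s * ∑' P : u, D * μ (box P.1.1 P.1.2) := by
        gcongr with P; exact hD _ _ (ht P (hut P.2)).1
    _ = D * ∑' P : u, s * μ (box P.1.1 P.1.2) := by
        rw [ENNReal.tsum_mul_left, ENNReal.tsum_mul_left]; ring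
    _ ≤ D * ∑' P : u, ∫⁻ x in box P.1.1 P.1.2, h x ∂μ := by
        gcongr with P; exact (ht P (hut P.2)).2.2
    _ = D * ∫⁻ x in ⋃ P ∈ u, box P.1 P.2, h x ∂μ := by
        rw [lintegral_biUnion ucount (fun P _ => measurableSet_box _ _) hu]
    _ ≤ D * ∫⁻ x, h x ∂μ := mul_le_mul_right (setLIntegral_le_lintegral _ _) _

/-- This is the layer cake formula for the atomic measure `∑ i, m i • δ_i`, with all sets declared
measurable. -/
theorem ofReal_rpow_eq_lintegral {ι : Type*} (s : Finset ι) (m : ι → ℝ≥0∞) (a : ι → ℝ)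
    (ha : ∀ i, 0 ≤ a i) {t : ℝ} (ht : 0 < t) :
    ∑ i ∈ s, ENNReal.ofReal (a i ^ t) * m i = ENNReal.ofReal t * ∫⁻ x in Ioi (0 : ℝ),
      (∑ i ∈ s with x < a i, m i) * ENNReal.ofReal (x ^ (t - 1)) := by
  let _ : MeasurableSpace ι := ⊤
  have h := lintegral_rpow_eq_lintegral_meas_lt_mul
    (∑ i ∈ s, m i • Measure.dirac i) (f := a) (ae_of_all _ ha) (measurable_from_top).aemeasurable ht
  simp only [lintegral_finsetSum_measure, lintegral_smul_measure, lintegral_dirac] at h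
  calc _ = ∑ i ∈ s, m i • ENNReal.ofReal (a i ^ t) := by simp [mul_comm]
    _ = _ := h
    _ = _ := by
      congr 2
      ext x
      congr 1
      simp [Finset.sum_filter, Set.indicator_apply]

/-- The Carleson embedding for disjoint subsets of boxes, with respect to a doubling measure. -/
theorem exists_sum_average_rpow_le {μ : Measure (Euc n)} {D : ℝ≥0∞} (hD' : D ≠ ∞)
    (hD : ∀ c r, 0 < r → μ (box c (5 * r)) ≤ D * μ (box c r)) (hfin : ∀ c r, μ (box c r) ≠ ∞)
    {t : ℝ} (ht : 1 < t) :
    ∃ C : ℝ≥0∞, C ≠ ∞ ∧ ∀ F : Euc n → ℝ≥0, Measurable F → ∀ {ι : Type} (s : Finset ι)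
      (B : ι → Euc n × ℝ) (S : ι → Set (Euc n)), (∀ i ∈ s, 0 < (B i).2) →
      (∀ i ∈ s, MeasurableSet (S i)) → (∀ i ∈ s, S i ⊆ box (B i).1 (B i).2) →
      (s : Set ι).PairwiseDisjoint S →
      ∑ i ∈ s, ((∫⁻ x in box (B i).1 (B i).2, F x ∂μ) / μ (box (B i).1 (B i).2)) ^ t * μ (S i) ≤
        C * ∫⁻ x, (F x : ℝ≥0∞) ^ t ∂μ := by
  set C₀ : ℝ≥0∞ := ENNReal.ofReal t * (2 * D) * (ENNReal.ofReal (t - 1))⁻¹ *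
    ENNReal.ofReal (2 ^ (t - 1))
  have hC₀ : C₀ ≠ ∞ := by
    have : ENNReal.ofReal (t - 1) ≠ 0 := by simpa using ht
    have := ENNReal.inv_ne_top.2 this
    finiteness
  -- The added `1` makes the constant nonzero, so that the right side is `∞` when the integral
  -- diverges.
  refine ⟨C₀ + 1, by finiteness, fun F hF ι s B S hB hSm hSB hdisj => ?_⟩
  by_cases hI : ∫⁻ x, (F x : ℝ≥0∞) ^ t ∂μ = ∞
  · rw [hI, ENNReal.mul_top (by simp)]; exact le_top
  -- The bound `F ≤ 1 + F ^ t` makes the integral over a box finite, which allows real levels and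
  -- cancellation below.
  have havg : ∀ i, ∫⁻ x in box (B i).1 (B i).2, F x ∂μ ≠ ∞ := fun i => by
    refine ne_top_of_le_ne_top (b := μ (box (B i).1 (B i).2) + ∫⁻ x, (F x : ℝ≥0∞) ^ t ∂μ)
      (by have := hfin (B i).1 (B i).2; finiteness) ?_
    calc ∫⁻ x in box (B i).1 (B i).2, F x ∂μ
        ≤ ∫⁻ x in box (B i).1 (B i).2, 1 + (F x : ℝ≥0∞) ^ t ∂μ := by
          refine lintegral_mono fun x => ?_
          rcases le_total (F x : ℝ≥0∞) 1 with h | h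
          · exact h.trans le_self_add
          · refine le_trans ?_ le_add_self
            conv_lhs => rw [← ENNReal.rpow_one (F x : ℝ≥0∞)]
            exact ENNReal.rpow_le_rpow_of_exponent_le h ht.le
      _ = μ (box (B i).1 (B i).2) + ∫⁻ x in box (B i).1 (B i).2, (F x : ℝ≥0∞) ^ t ∂μ := by
          rw [lintegral_add_left measurable_const]; simp
      _ ≤ _ := by gcongr; exact Measure.restrict_le_self
  set b : ι → ℝ≥0∞ := fun i =>
    (∫⁻ x in box (B i).1 (B i).2, F x ∂μ) / μ (box (B i).1 (B i).2) with hb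
  have hbtop : ∀ i, b i ≠ ∞ := fun i => by
    simp only [hb]
    by_cases h0 : μ (box (B i).1 (B i).2) = 0
    · rw [Measure.restrict_eq_zero.2 h0]; simp
    · exact ENNReal.div_ne_top (havg i) h0
  set a : ι → ℝ := fun i => (b i).toReal
  have ha : ∀ i, 0 ≤ a i := fun i => ENNReal.toReal_nonneg
  have hba : ∀ i, b i = ENNReal.ofReal (a i) := fun i => (ENNReal.ofReal_toReal (hbtop i)).symm
  -- Values of `F` below `x / 2` contribute at most half of an average that exceeds `x`, so the weak
  -- type inequality is needed only for the restriction of `F` to `{2 * F > x}`.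
  have weak : ∀ x : ℝ, 0 < x → ENNReal.ofReal x * ∑ i ∈ s with x < a i, μ (S i) ≤
      2 * D * (μ.withDensity fun y => F y) {y | x < 2 * (F y : ℝ)} := by
    intro x hx
    set V : Set (Euc n) := {y | x < 2 * (F y : ℝ)}
    have hV : MeasurableSet V := measurableSet_lt measurable_const (by fun_prop)
    obtain ⟨R, hR⟩ := (s.image fun i => (B i).2).bddAbove
    have key := mul_measure_biUnion_box_le (s := ENNReal.ofReal (x / 2)) hD
      (t := B '' {i | i ∈ s ∧ x < a i}) (R := R) (h := V.indicator fun y => (F y : ℝ≥0∞)) (by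
        rintro _ ⟨i, ⟨his, hi⟩, rfl⟩
        refine ⟨hB i his, hR (Finset.mem_coe.2 (Finset.mem_image_of_mem _ his)), ?_⟩
        have h1 : ENNReal.ofReal x * μ (box (B i).1 (B i).2) ≤
            ∫⁻ y in box (B i).1 (B i).2, F y ∂μ := by
          have : ENNReal.ofReal x ≤ b i := by rw [hba]; exact ENNReal.ofReal_le_ofReal hi.le
          calc _ ≤ b i * μ (box (B i).1 (B i).2) := by gcongr
            _ ≤ _ := by rw [mul_comm]; exact ENNReal.mul_div_le
        have h2 : ∫⁻ y in box (B i).1 (B i).2, F y ∂μ ≤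
            ENNReal.ofReal (x / 2) * μ (box (B i).1 (B i).2) +
            ∫⁻ y in box (B i).1 (B i).2, V.indicator (fun y => (F y : ℝ≥0∞)) y ∂μ := by
          calc _ ≤ ∫⁻ y in box (B i).1 (B i).2,
                ENNReal.ofReal (x / 2) + V.indicator (fun y => (F y : ℝ≥0∞)) y ∂μ := by
                refine lintegral_mono fun y => ?_
                by_cases hy : y ∈ V
                · simp [hy]
                · simp only [hy, not_false_eq_true, indicator_of_notMem, add_zero]
                  rw [← ENNReal.ofReal_coe_nnreal]
                  refine ENNReal.ofReal_le_ofReal ?_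
                  have : ¬ x < 2 * (F y : ℝ) := hy
                  linarith
            _ = _ := by rw [lintegral_add_left measurable_const]; simp
        have h3 : ENNReal.ofReal x * μ (box (B i).1 (B i).2) =
            ENNReal.ofReal (x / 2) * μ (box (B i).1 (B i).2) +
            ENNReal.ofReal (x / 2) * μ (box (B i).1 (B i).2) := by
          rw [← add_mul, ← ENNReal.ofReal_add (by positivity) (by positivity)]; ring_nf
        rw [h3] at h1
        exact (ENNReal.add_le_add_iff_left
          (by have := hfin (B i).1 (B i).2; finiteness)).1 (h1.trans h2))
    have hsum : ∑ i ∈ s with x < a i, μ (S i) ≤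
        μ (⋃ P ∈ B '' {i | i ∈ s ∧ x < a i}, box P.1 P.2) := by
      rw [← measure_biUnion_finset]
      · refine measure_mono (iUnion₂_subset fun i hi => ?_)
        rw [Finset.mem_filter] at hi
        exact (hSB i hi.1).trans (subset_biUnion_of_mem
          (u := fun P : Euc n × ℝ => box P.1 P.2) (mem_image_of_mem B hi))
      · exact hdisj.subset fun i hi => (Finset.mem_filter.1 (Finset.mem_coe.1 hi)).1
      · exact fun i hi => hSm i (Finset.mem_filter.1 hi).1
    have hx2 : ENNReal.ofReal x = 2 * ENNReal.ofReal (x / 2) := by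
      rw [← ENNReal.ofReal_ofNat, ← ENNReal.ofReal_mul (by norm_num)]; ring_nf
    rw [withDensity_apply _ hV, hx2]
    rw [lintegral_indicator hV] at key
    calc 2 * ENNReal.ofReal (x / 2) * ∑ i ∈ s with x < a i, μ (S i)
        ≤ 2 * (ENNReal.ofReal (x / 2) *
          μ (⋃ P ∈ B '' {i | i ∈ s ∧ x < a i}, box P.1 P.2)) := by
          rw [mul_assoc]; gcongr
      _ ≤ 2 * (D * ∫⁻ y in V, F y ∂μ) := by gcongr
      _ = _ := by ring
  have ht1 : (0 : ℝ) < t - 1 := by linarith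
  -- A second layer cake, for the measure `F dμ` and the exponent `t - 1`: the weak estimate has
  -- used up one power of the level and put a factor `F` into the measure.
  have layer := lintegral_rpow_eq_lintegral_meas_lt_mul (μ.withDensity fun y => (F y : ℝ≥0∞))
    (f := fun y => 2 * (F y : ℝ)) (ae_of_all _ fun y => by positivity) (by fun_prop) ht1
  calc ∑ i ∈ s, b i ^ t * μ (S i) = ∑ i ∈ s, ENNReal.ofReal (a i ^ t) * μ (S i) := by
        refine Finset.sum_congr rfl fun i _ => ?_
        rw [hba, ENNReal.ofReal_rpow_of_nonneg (ha i) (by linarith)]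
    _ = ENNReal.ofReal t * ∫⁻ x in Ioi (0 : ℝ),
        (∑ i ∈ s with x < a i, μ (S i)) * ENNReal.ofReal (x ^ (t - 1)) :=
        ofReal_rpow_eq_lintegral s (fun i => μ (S i)) a ha (by linarith)
    _ ≤ ENNReal.ofReal t * ∫⁻ x in Ioi (0 : ℝ), (2 * D) *
        ((μ.withDensity fun y => F y) {y | x < 2 * (F y : ℝ)} *
          ENNReal.ofReal (x ^ (t - 1 - 1))) := by
        gcongr 1
        refine setLIntegral_mono_ae' measurableSet_Ioi (ae_of_all _ fun x hx => ?_)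
        have hx0 : (0 : ℝ) < x := hx
        have : ENNReal.ofReal (x ^ (t - 1)) =
            ENNReal.ofReal x * ENNReal.ofReal (x ^ (t - 1 - 1)) := by
          rw [← ENNReal.ofReal_mul hx0.le]
          congr 1
          rw [Real.rpow_sub_one hx0.ne' (t - 1)]; field_simp
        rw [this]
        calc (∑ i ∈ s with x < a i, μ (S i)) *
              (ENNReal.ofReal x * ENNReal.ofReal (x ^ (t - 1 - 1)))
            = (ENNReal.ofReal x * ∑ i ∈ s with x < a i, μ (S i)) *
              ENNReal.ofReal (x ^ (t - 1 - 1)) := by ring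
          _ ≤ _ := by
            rw [← mul_assoc]; exact mul_le_mul_left (weak x hx0) _
    _ = ENNReal.ofReal t * (2 * D) * ∫⁻ x in Ioi (0 : ℝ),
        (μ.withDensity fun y => F y) {y | x < 2 * (F y : ℝ)} *
          ENNReal.ofReal (x ^ (t - 1 - 1)) := by
        rw [lintegral_const_mul' _ _ (by finiteness)]; ring
    _ = ENNReal.ofReal t * (2 * D) * ((ENNReal.ofReal (t - 1))⁻¹ *
        ∫⁻ y, ENNReal.ofReal ((2 * (F y : ℝ)) ^ (t - 1)) ∂(μ.withDensity fun y => F y)) := by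
        rw [layer, ← mul_assoc (ENNReal.ofReal (t - 1))⁻¹,
          ENNReal.inv_mul_cancel (by simpa using ht) (by finiteness), one_mul]
    _ = C₀ * ∫⁻ x, (F x : ℝ≥0∞) ^ t ∂μ := by
        have : ∫⁻ y, ENNReal.ofReal ((2 * (F y : ℝ)) ^ (t - 1)) ∂(μ.withDensity fun y => F y) =
            ENNReal.ofReal (2 ^ (t - 1)) * ∫⁻ x, (F x : ℝ≥0∞) ^ t ∂μ := by
          rw [lintegral_withDensity_eq_lintegral_mul _ (by fun_prop) (by fun_prop),
            ← lintegral_const_mul _ (by fun_prop)]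
          refine lintegral_congr fun y => ?_
          simp only [Pi.mul_apply]
          rw [Real.mul_rpow (by norm_num) (by positivity), ENNReal.ofReal_mul (by positivity),
            ← ENNReal.ofReal_rpow_of_nonneg (p := t - 1) (F y).coe_nonneg ht1.le, ENNReal.ofReal_coe_nnreal]
          rcases eq_or_ne (F y) 0 with h0 | h0
          · simp [h0, (by linarith : (0 : ℝ) < t)]
          · have : (F y : ℝ≥0∞) ^ t = F y * (F y : ℝ≥0∞) ^ (t - 1) := by
              conv_lhs => rw [show t = 1 + (t - 1) by ring]
              rw [ENNReal.rpow_add _ _ (by simpa using h0) (by simp), ENNReal.rpow_one]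
            rw [this]; ring
        rw [this]; simp only [C₀]; ring
    _ ≤ (C₀ + 1) * ∫⁻ x, (F x : ℝ≥0∞) ^ t ∂μ := by gcongr; exact le_self_add

/-- An integral over the complement of a box is controlled by integrals over dilated boxes. -/
theorem lintegral_compl_box_le {μ : Measure (Euc n)} (c : Euc n) {R : ℝ} (hR : 0 < R)
    (φ : ℝ → ℝ≥0) (hφ : AntitoneOn φ (Ioi 0)) (h : Euc n → ℝ≥0∞) :
    ∫⁻ x in (box c R)ᶜ, φ ‖x - c‖ * h x ∂μ ≤
      ∑' j : ℕ, φ (2 ^ j * R) * ∫⁻ x in box c (2 ^ (j + 1) * R), h x ∂μ := by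
  have hcov : (box c R)ᶜ ⊆ ⋃ j : ℕ, box c (2 ^ (j + 1) * R) \ box c (2 ^ j * R) := by
    intro x hx
    have hex : ∃ j : ℕ, x ∈ box c (2 ^ j * R) := by
      obtain ⟨j, hj⟩ := pow_unbounded_of_one_lt (‖x - c‖ / R) (one_lt_two)
      rw [div_lt_iff₀ hR] at hj
      exact ⟨j, mem_box_of_norm_lt hj⟩
    classical
    have h0 : Nat.find hex ≠ 0 := fun h0 => by
      have := Nat.find_spec hex
      rw [h0] at this
      simp only [pow_zero, one_mul] at this
      exact hx this
    obtain ⟨j, hj⟩ := Nat.exists_eq_succ_of_ne_zero h0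
    refine mem_iUnion.2 ⟨j, ?_, Nat.find_min hex (by omega)⟩
    have := Nat.find_spec hex
    rwa [hj] at this
  calc ∫⁻ x in (box c R)ᶜ, φ ‖x - c‖ * h x ∂μ
      ≤ ∫⁻ x in ⋃ j : ℕ, box c (2 ^ (j + 1) * R) \ box c (2 ^ j * R), φ ‖x - c‖ * h x ∂μ :=
        lintegral_mono_set hcov
    _ ≤ ∑' j : ℕ, ∫⁻ x in box c (2 ^ (j + 1) * R) \ box c (2 ^ j * R), φ ‖x - c‖ * h x ∂μ :=
        lintegral_iUnion_le _ _
    _ ≤ ∑' j : ℕ, φ (2 ^ j * R) * ∫⁻ x in box c (2 ^ (j + 1) * R), h x ∂μ := by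
        refine ENNReal.tsum_le_tsum fun j => ?_
        rw [← lintegral_const_mul' _ _ (by simp)]
        refine le_trans ?_ (lintegral_mono_set (sdiff_subset (t := box c (2 ^ j * R))))
        refine setLIntegral_mono_ae' ((measurableSet_box _ _).diff (measurableSet_box _ _))
          (ae_of_all _ fun x hx => ?_)
        have h1 := le_norm_sub_of_notMem_box hx.2
        gcongr
        have h2 : (0 : ℝ) < 2 ^ j * R := by positivity
        exact hφ h2 (h2.trans_le h1) h1

/-- On the `j`-th annulus the factor is at most `(2 ^ j * R) ^ (-(n + 1))`, while the integral of
`h` is at most `s` times the volume of a box of half side `2 ^ (j + 1) * R`. The quotient is `4 ^ n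
/ R * 2 ^ (-j)`, a geometric series. -/
theorem lintegral_compl_box_div_le (c : Euc n) {R : ℝ} (hR : 0 < R) {h : Euc n → ℝ≥0∞}
    {s : ℝ≥0∞} (hs : ∀ ρ, R ≤ ρ → ∫⁻ x in box c ρ, h x ≤ s * volume (box c ρ)) :
    ∫⁻ x in (box c R)ᶜ, ENNReal.ofReal (1 / ‖x - c‖ ^ (n + 1)) * h x ≤
      ENNReal.ofReal (2 * 4 ^ n / R) * s := by
  refine (lintegral_compl_box_le c hR (fun s => (1 / s ^ (n + 1)).toNNReal) ?_ h).trans ?_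
  · intro x hx y hy hxy
    have hx' : (0 : ℝ) < x := hx
    refine Real.toNNReal_le_toNNReal ?_
    gcongr
  · calc ∑' j : ℕ, ENNReal.ofReal (1 / (2 ^ j * R) ^ (n + 1)) *
          ∫⁻ x in box c (2 ^ (j + 1) * R), h x
        ≤ ∑' j : ℕ, ENNReal.ofReal (4 ^ n / R * (1 / 2) ^ j) * s := by
          refine ENNReal.tsum_le_tsum fun j => ?_
          calc _ ≤ ENNReal.ofReal (1 / (2 ^ j * R) ^ (n + 1)) *
              (s * volume (box c (2 ^ (j + 1) * R))) := by
                gcongr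
                refine hs _ ?_
                have : (1 : ℝ) ≤ 2 ^ (j + 1) := one_le_pow₀ (by norm_num)
                nlinarith
            _ = ENNReal.ofReal (1 / (2 ^ j * R) ^ (n + 1)) *
              ENNReal.ofReal ((2 * (2 ^ (j + 1) * R)) ^ n) * s := by
                rw [volume_box, ENNReal.ofReal_pow (by positivity)]; ring
            _ = _ := by
                rw [← ENNReal.ofReal_mul (by positivity)]
                congr 2
                have : (2 * (2 ^ (j + 1) * R)) ^ n = 4 ^ n * (2 ^ j * R) ^ n := by
                  rw [← mul_pow]; ring
                rw [this, pow_succ (2 ^ j * R) n]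
                field_simp
                rw [← mul_pow]; norm_num
      _ = (∑' j : ℕ, ENNReal.ofReal (4 ^ n / R * (1 / 2) ^ j)) * s := ENNReal.tsum_mul_right
      _ = _ := by
          rw [← ENNReal.ofReal_tsum_of_nonneg (fun j => by positivity)
            (summable_geometric_two.mul_left _), tsum_mul_left, tsum_geometric_two]
          ring_nf

end CZCommutator

namespace CZCommutator

open Set Filter Topology
open scoped NNReal

variable {n : ℕ} {q : ℝ≥0∞} [Fact (1 ≤ q)]

/-! ### Singular integrals acting on functions -/

/-- Bounded operators on `L^q(ℝⁿ)`. -/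
abbrev LqOp (n : ℕ) (q : ℝ≥0∞) [Fact (1 ≤ q)] :=
  Lp ℂ q (volume : Measure (Euc n)) →L[ℂ] Lp ℂ q (volume : Measure (Euc n))

open Classical in
/-- The action of an operator on `L^q` on functions. -/
noncomputable def app (T : LqOp n q) (f : Euc n → ℂ) : Euc n → ℂ :=
  if h : MemLp f q volume then T (h.toLp f) else 0

theorem app_of_memLp (T : LqOp n q) {f : Euc n → ℂ} (hf : MemLp f q volume) :
    app T f = T (hf.toLp f) := dif_pos hf

theorem memLp_app (T : LqOp n q) (f : Euc n → ℂ) : MemLp (app T f) q volume := by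
  by_cases hf : MemLp f q volume
  · rw [app_of_memLp T hf]; exact Lp.memLp _
  · rw [app, dif_neg hf]; exact MemLp.zero

theorem aestronglyMeasurable_app (T : LqOp n q) (f : Euc n → ℂ) :
    AEStronglyMeasurable (app T f) volume := (memLp_app T f).1

theorem app_congr (T : LqOp n q) {f g : Euc n → ℂ} (h : f =ᵐ[volume] g) : app T f = app T g := by
  by_cases hf : MemLp f q volume
  · have hg := (memLp_congr_ae h).1 hf
    rw [app_of_memLp T hf, app_of_memLp T hg, MemLp.toLp_congr hf hg h]
  · have hg := fun hg => hf ((memLp_congr_ae h).2 hg)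
    rw [app, app, dif_neg hf, dif_neg hg]

theorem app_add (T : LqOp n q) {f g : Euc n → ℂ} (hf : MemLp f q volume)
    (hg : MemLp g q volume) :
    app T (fun x => f x + g x) =ᵐ[volume] fun x => app T f x + app T g x := by
  rw [app_of_memLp T hf, app_of_memLp T hg, app_of_memLp T (f := fun x => f x + g x) (hf.add hg)]
  change T ((hf.add hg).toLp (f + g)) =ᵐ[volume] _
  rw [MemLp.toLp_add hf hg, map_add]
  exact Lp.coeFn_add _ _

theorem app_const_mul (T : LqOp n q) {f : Euc n → ℂ} (hf : MemLp f q volume) (c : ℂ) :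
    app T (fun x => c * f x) =ᵐ[volume] fun x => c * app T f x := by
  rw [app_of_memLp T hf, app_of_memLp T (hf.const_mul c)]
  change T ((hf.const_smul c).toLp (c • f)) =ᵐ[volume] _
  rw [MemLp.toLp_const_smul, map_smul]
  exact Lp.coeFn_smul _ _

theorem app_sub (T : LqOp n q) {f g : Euc n → ℂ} (hf : MemLp f q volume)
    (hg : MemLp g q volume) :
    app T (fun x => f x - g x) =ᵐ[volume] fun x => app T f x - app T g x := by
  rw [app_of_memLp T hf, app_of_memLp T hg, app_of_memLp T (f := fun x => f x - g x) (hf.sub hg)]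
  change T ((hf.sub hg).toLp (f - g)) =ᵐ[volume] _
  rw [MemLp.toLp_sub hf hg, map_sub]
  exact Lp.coeFn_sub _ _

theorem app_zero (T : LqOp n q) : app T (fun _ => 0) =ᵐ[volume] fun _ => 0 := by
  have := app_const_mul T (MemLp.zero (p := q) (μ := (volume : Measure (Euc n))) (ε := ℂ)) 0
  simpa using this

theorem app_sum (T : LqOp n q) {ι : Type*} (s : Finset ι) {f : ι → Euc n → ℂ}
    (hf : ∀ i ∈ s, MemLp (f i) q volume) :
    app T (fun x => ∑ i ∈ s, f i x) =ᵐ[volume] fun x => ∑ i ∈ s, app T (f i) x := by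
  classical
  induction s using Finset.induction_on with
  | empty => simpa using app_zero T
  | insert i s hi ih =>
    simp only [Finset.sum_insert hi]
    have h1 := app_add T (hf i (Finset.mem_insert_self i s))
      (memLp_finsetSum s fun j hj => hf j (Finset.mem_insert_of_mem hj))
    filter_upwards [h1, ih fun j hj => hf j (Finset.mem_insert_of_mem hj)] with x hx hx'
    rw [hx, hx']

theorem eLpNorm_app_le (T : LqOp n q) {f : Euc n → ℂ} (hf : MemLp f q volume) :
    eLpNorm (app T f) q volume ≤ ‖T‖ₑ * eLpNorm f q volume := by
  rw [app_of_memLp T hf, ← Lp.enorm_def, ← Lp.enorm_toLp hf]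
  exact ContinuousLinearMap.le_opENorm _ _

/-- A Calderón–Zygmund operator together with its kernel. -/
structure IsCZPair (T : LqOp n q) (K : Euc n → Euc n → ℂ) (C : ℝ) : Prop where
  kernel : IsCZKernel K C
  rep : ∀ (f : Lp ℂ q (volume : Measure (Euc n))) (F : Set (Euc n)), IsCompact F →
    (∀ᵐ y, y ∉ F → f y = 0) → ∀ᵐ x, x ∉ F → T f x = ∫ y, K x y * f y
  nonneg : 0 ≤ C

/-- The size bound at a single pair of distinct points forces `0 ≤ C`; such a pair exists because `n
≥ 1`. -/
theorem IsCZOperator.exists_isCZPair [NeZero n] {T : LqOp n q} (hT : IsCZOperator T) :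
    ∃ K C, IsCZPair T K C := by
  obtain ⟨K, C, hK, hrep⟩ := hT
  refine ⟨K, C, hK, hrep, ?_⟩
  have e : (0 : Euc n) ≠ EuclideanSpace.single 0 1 := fun h => by
    have := congrArg (fun y : Euc n => y 0) h
    simp at this
  have h := (norm_nonneg _).trans (hK.size _ _ e)
  by_contra! hC
  have : C / ‖(0 : Euc n) - EuclideanSpace.single 0 1‖ ^ n < 0 :=
    div_neg_of_neg_of_pos hC (pow_pos (norm_pos_iff.2 (sub_ne_zero.2 e)) n)
  linarith

theorem IsCZPair.app_ae_eq {T : LqOp n q} {K : Euc n → Euc n → ℂ} {C : ℝ} (hT : IsCZPair T K C)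
    {f : Euc n → ℂ} (hf : MemLp f q volume) {F : Set (Euc n)} (hF : IsCompact F)
    (hfF : ∀ y, y ∉ F → f y = 0) : ∀ᵐ x, x ∉ F → app T f x = ∫ y, K x y * f y := by
  rw [app_of_memLp T hf]
  filter_upwards [hT.rep (hf.toLp f) F hF (by
    filter_upwards [hf.coeFn_toLp] with y hy hyF
    rw [hy, hfF y hyF])] with x hx hxF
  rw [hx hxF]
  refine integral_congr_ae ?_
  filter_upwards [hf.coeFn_toLp] with y hy
  rw [hy]

theorem IsCZKernel.continuousOn {K : Euc n → Euc n → ℂ} {C : ℝ} (hK : IsCZKernel K C) (x : Euc n) :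
    ContinuousOn (K x) {x}ᶜ := by
  intro y hy
  have hxy : x ≠ y := fun h => hy (by simp [h])
  have hd : 0 < ‖x - y‖ := norm_pos_iff.2 (sub_ne_zero.2 hxy)
  refine ContinuousAt.continuousWithinAt ?_
  rw [ContinuousAt, tendsto_iff_norm_sub_tendsto_zero]
  have hlim : Tendsto (fun y' => C * (‖y - y'‖ / ‖x - y‖ ^ (n + 1))) (𝓝 y) (𝓝 0) := by
    have : Tendsto (fun y' => C * (‖y - y'‖ / ‖x - y‖ ^ (n + 1))) (𝓝 y)
        (𝓝 (C * (‖y - y‖ / ‖x - y‖ ^ (n + 1)))) := by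
      refine Continuous.tendsto ?_ y
      fun_prop
    simpa using this
  refine squeeze_zero' (Eventually.of_forall fun _ => norm_nonneg _) ?_ hlim
  have : ∀ᶠ y' in 𝓝 y, 2 * ‖y - y'‖ < ‖x - y‖ := by
    have : Tendsto (fun y' => 2 * ‖y - y'‖) (𝓝 y) (𝓝 (2 * ‖y - y‖)) :=
      Continuous.tendsto (by fun_prop) y
    exact this.eventually_lt_const (by simpa using hd)
  filter_upwards [this] with y' hy'
  rw [norm_sub_rev]
  exact hK.smooth_right x y y' hxy hy'.le

/-- Measurability is not part of the definition of a kernel. Smoothness in the second variable gives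
continuity off the diagonal, and a point is null since `n ≥ 1`. -/
theorem IsCZKernel.aestronglyMeasurable [NeZero n] {K : Euc n → Euc n → ℂ} {C : ℝ}
    (hK : IsCZKernel K C) (x : Euc n) : AEStronglyMeasurable (K x) volume := by
  have h := (hK.continuousOn x).aestronglyMeasurable (μ := volume)
    (measurableSet_singleton x).compl
  rwa [Measure.restrict_eq_self_of_ae_mem] at h
  exact compl_mem_ae_iff.2 (measure_singleton x)

theorem IsCZPair.integrable_kernel_mul [NeZero n] {T : LqOp n q} {K : Euc n → Euc n → ℂ} {C : ℝ}
    (hT : IsCZPair T K C) {f : Euc n → ℂ} (hf : Integrable f volume) {x : Euc n} {d : ℝ}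
    (hd : 0 < d) (hfd : ∀ y, f y ≠ 0 → d ≤ ‖x - y‖) : Integrable (fun y => K x y * f y) volume := by
  refine Integrable.mono' (hf.norm.const_mul (C / d ^ n))
    ((hT.kernel.aestronglyMeasurable x).mul hf.1) (ae_of_all _ fun y => ?_)
  rw [norm_mul]
  by_cases hy : f y = 0
  · simp [hy]
  · have h := hfd y hy
    refine mul_le_mul_of_nonneg_right ((hT.kernel.size x y ?_).trans ?_) (norm_nonneg _)
    · intro hxy
      rw [hxy, sub_self, norm_zero] at h
      linarith
    · have := hT.nonneg
      gcongr

theorem integrable_of_memLp_of_box {f : Euc n → ℂ} (hf : MemLp f q volume) {c : Euc n} {r : ℝ}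
    (hfc : ∀ y, y ∉ box c r → f y = 0) : Integrable f volume := by
  have hi : (box c r).indicator f = f := indicator_eq_self.2 fun y hy => by
    by_contra h; exact hy (hfc y h)
  rw [← memLp_one_iff_integrable]
  rw [← hi, memLp_indicator_iff_restrict (measurableSet_box c r)] at hf ⊢
  have : IsFiniteMeasure (volume.restrict (box c r)) :=
    ⟨by simpa using (volume_box_ne_top c r).lt_top⟩
  exact hf.mono_exponent (Fact.out : 1 ≤ q)

/-- Smoothness of the kernel in the first variable controls the oscillation of the tails. -/
theorem IsCZPair.enorm_integral_sub_le [NeZero n] {T : LqOp n q} {K : Euc n → Euc n → ℂ} {C : ℝ}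
    (hT : IsCZPair T K C) {f : Euc n → ℂ} (hf : Integrable f volume) {c x x' : Euc n} {r : ℝ}
    (hr : 0 < r) (hx : x ∈ box c r) (hx' : x' ∈ box c r)
    (hfc : ∀ y ∈ box c (5 * n * r), f y = 0) {s : ℝ≥0∞}
    (hs : ∀ ρ, 0 < ρ → ∫⁻ y in box x' ρ, ‖f y‖ₑ ≤ s * volume (box x' ρ)) :
    ‖(∫ y, K x y * f y) - ∫ y, K x' y * f y‖ₑ ≤ ENNReal.ofReal (C * 4 ^ n) * s := by
  have hn : (1 : ℝ) ≤ n := by exact_mod_cast NeZero.one_le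
  have hC := hT.nonneg
  -- The box of half side `R` around any point of `box c r` still lies in the region where `f`
  -- vanishes, and `R ≥ 4 * n * r` is twice the largest possible `‖x' - x‖`.
  set R : ℝ := (5 * n - 1) * r
  have hR4 : 4 * n * r ≤ R := by simp only [R]; nlinarith
  have hR : 0 < R := lt_of_lt_of_le (by positivity) hR4
  have hout : ∀ z ∈ box c r, ∀ y, f y ≠ 0 → y ∉ box z R := fun z hz y hy hyz => hy (hfc y (by
    have := box_subset_box_of_mem' hz hyz
    convert this using 2
    simp only [R]; ring))
  have hdist : ∀ z ∈ box c r, ∀ y, f y ≠ 0 → R ≤ ‖z - y‖ := fun z hz y hy => by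
    rw [norm_sub_rev]; exact le_norm_sub_of_notMem_box (hout z hz y hy)
  have hxx : ‖x' - x‖ ≤ n * (2 * r) := norm_sub_le_of_mem_box hr.le hx' hx
  rw [← integral_sub (hT.integrable_kernel_mul hf hR (hdist x hx))
    (hT.integrable_kernel_mul hf hR (hdist x' hx'))]
  calc ‖∫ y, K x y * f y - K x' y * f y‖ₑ ≤ ∫⁻ y, ‖K x y * f y - K x' y * f y‖ₑ :=
        enorm_integral_le_lintegral_enorm _
    _ ≤ ∫⁻ y, (box x' R)ᶜ.indicator (fun y => ENNReal.ofReal (C * (n * (2 * r))) *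
          (ENNReal.ofReal (1 / ‖y - x'‖ ^ (n + 1)) * ‖f y‖ₑ)) y := by
        refine lintegral_mono fun y => ?_
        by_cases hy : f y = 0
        · simp [hy]
        · have hyo := hout x' hx' y hy
          have hd := hdist x' hx' y hy
          rw [indicator_of_mem (by exact hyo), ← sub_mul, enorm_mul, ← mul_assoc,
            ← ENNReal.ofReal_mul (by positivity)]
          gcongr
          rw [← ofReal_norm]
          refine ENNReal.ofReal_le_ofReal ?_
          rw [norm_sub_rev]
          refine (hT.kernel.smooth_left x' x y ?_ ?_).trans ?_
          · rintro rfl; simp at hd; linarith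
          · nlinarith
          · rw [norm_sub_rev y x', mul_assoc, mul_one_div]
            gcongr
    _ ≤ ENNReal.ofReal (C * (n * (2 * r))) * (ENNReal.ofReal (2 * 4 ^ n / R) * s) := by
        rw [lintegral_indicator (measurableSet_box _ _).compl, lintegral_const_mul' _ _ (by simp)]
        gcongr
        exact lintegral_compl_box_div_le x' hR fun ρ hρ => hs ρ (hR.trans_le hρ)
    _ ≤ ENNReal.ofReal (C * 4 ^ n) * s := by
        rw [← mul_assoc, ← ENNReal.ofReal_mul (by positivity)]
        refine mul_le_mul_left (ENNReal.ofReal_le_ofReal ?_) _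
        calc C * (n * (2 * r)) * (2 * 4 ^ n / R) = C * 4 ^ n * (4 * n * r / R) := by ring
          _ ≤ C * 4 ^ n * 1 := by
            gcongr; exact (div_le_one hR).2 hR4
          _ = _ := mul_one _

/-- Cancellation of a function supported in a box gives integrability away from the box. -/
theorem IsCZPair.lintegral_app_compl_le [NeZero n] {T : LqOp n q} {K : Euc n → Euc n → ℂ} {C : ℝ}
    (hT : IsCZPair T K C) {f : Euc n → ℂ} (hf : MemLp f q volume) {c : Euc n} {r : ℝ}
    (hr : 0 < r) (hfc : ∀ y, y ∉ box c r → f y = 0) (hf0 : ∫ y, f y = 0) :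
    ∫⁻ x in (box c (5 * n * r))ᶜ, ‖app T f x‖ₑ ≤ ENNReal.ofReal (C * 4 ^ n) * ∫⁻ y, ‖f y‖ₑ := by
  have hn : (1 : ℝ) ≤ n := by exact_mod_cast NeZero.one_le
  have hC := hT.nonneg
  have hfi := integrable_of_memLp_of_box hf hfc
  set R : ℝ := 5 * n * r
  have hR : 0 < R := by positivity
  have hcube : cube c r ⊆ box c R := fun y hy i => by
    have := abs_le.1 (hy i)
    have : r < R := by simp only [R]; nlinarith
    constructor <;> linarith
  have hnr : 0 ≤ C * (n * r) := by positivity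
  calc ∫⁻ x in (box c R)ᶜ, ‖app T f x‖ₑ
      ≤ ∫⁻ x in (box c R)ᶜ, (ENNReal.ofReal (C * (n * r)) * ∫⁻ y, ‖f y‖ₑ) *
        (ENNReal.ofReal (1 / ‖x - c‖ ^ (n + 1)) * 1) := by
        refine lintegral_mono_ae ?_
        refine (ae_restrict_iff' (measurableSet_box _ _).compl).2 ?_
        filter_upwards [hT.app_ae_eq hf (isCompact_cube c r) fun y hy => hfc y
          fun h => hy (box_subset_cube c r h)] with x hx hxR
        rw [hx fun h => hxR (hcube h)]
        have hxc : R ≤ ‖x - c‖ := le_norm_sub_of_notMem_box hxR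
        have hxy : ∀ y, f y ≠ 0 → r ≤ ‖x - y‖ := fun y hy => by
          have hyc : y ∈ box c r := by by_contra h; exact hy (hfc y h)
          have h1 := norm_sub_center_le hr.le hyc
          have h2 : ‖x - c‖ ≤ ‖x - y‖ + ‖y - c‖ := norm_sub_le_norm_sub_add_norm_sub x y c
          have : (n : ℝ) * r + r ≤ R := by simp only [R]; nlinarith
          linarith
        -- The vanishing integral of `f` permits subtracting the value of the kernel at the centre,
        -- which gains the power `n + 1` in the decay.
        have e : ∫ y, K x y * f y = ∫ y, (K x y - K x c) * f y := by
          simp only [sub_mul]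
          rw [integral_sub (hT.integrable_kernel_mul hfi hr hxy) (hfi.const_mul _),
            integral_const_mul, hf0, mul_zero, sub_zero]
        rw [e]
        calc _ ≤ ∫⁻ y, ‖(K x y - K x c) * f y‖ₑ := enorm_integral_le_lintegral_enorm _
          _ ≤ ∫⁻ y, ENNReal.ofReal (C * (n * r) * (1 / ‖x - c‖ ^ (n + 1))) * ‖f y‖ₑ := by
            refine lintegral_mono fun y => ?_
            by_cases hy : f y = 0
            · simp [hy]
            have hyc : y ∈ box c r := by by_contra h; exact hy (hfc y h)
            have h1 := norm_sub_center_le hr.le hyc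
            rw [enorm_mul]
            gcongr
            rw [← ofReal_norm]
            refine ENNReal.ofReal_le_ofReal ?_
            rw [norm_sub_rev]
            refine (hT.kernel.smooth_right x c y ?_ ?_).trans ?_
            · rintro rfl; simp at hxc; linarith
            · rw [norm_sub_rev]
              simp only [R] at hxc; nlinarith
            · rw [norm_sub_rev c y, mul_assoc, mul_one_div]
              gcongr
          _ = _ := by
            rw [lintegral_const_mul' _ _ (by simp), ENNReal.ofReal_mul hnr]; ring
    _ ≤ (ENNReal.ofReal (C * (n * r)) * ∫⁻ y, ‖f y‖ₑ) * (ENNReal.ofReal (2 * 4 ^ n / R) * 1) := by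
        rw [lintegral_const_mul' _ _ (by have := hfi.2; finiteness)]
        gcongr
        exact lintegral_compl_box_div_le c hR fun ρ hρ => by simp
    _ = ENNReal.ofReal (C * (n * r) * (2 * 4 ^ n / R)) * ∫⁻ y, ‖f y‖ₑ := by
        rw [ENNReal.ofReal_mul hnr]; ring
    _ ≤ _ := by
        refine mul_le_mul_left (ENNReal.ofReal_le_ofReal ?_) _
        have : 2 * (n * r) ≤ R := by simp only [R]; nlinarith
        calc C * (n * r) * (2 * 4 ^ n / R) = C * 4 ^ n * (2 * (n * r) / R) := by ring
          _ ≤ C * 4 ^ n * 1 := by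
            gcongr; exact (div_le_one hR).2 this
          _ = _ := mul_one _

end CZCommutator

namespace CZCommutator

open Set Filter Topology
open scoped NNReal

set_option linter.unusedSectionVars false

variable {n : ℕ} {q : ℝ≥0∞} [Fact (1 ≤ q)]

/-! ### The weak type estimate and its consequences -/

/-- The set where the centred maximal function of `h` exceeds `s`. -/
def maxSet (h : Euc n → ℂ) (s : ℝ≥0∞) : Set (Euc n) :=
  {x | ∃ ρ > 0, s * volume (box x ρ) < ∫⁻ y in box x ρ, ‖h y‖ₑ}

theorem lintegral_le_of_notMem_maxSet {h : Euc n → ℂ} {s : ℝ≥0∞} {x : Euc n}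
    (hx : x ∉ maxSet h s) {ρ : ℝ} (hρ : 0 < ρ) :
    ∫⁻ y in box x ρ, ‖h y‖ₑ ≤ s * volume (box x ρ) := by
  by_contra! hlt
  exact hx ⟨ρ, hρ, hlt⟩

theorem mul_volume_maxSet_le [NeZero n] {h : Euc n → ℂ} (hh : ∫⁻ y, ‖h y‖ₑ ≠ ∞) {s : ℝ≥0∞}
    (hs : s ≠ 0) (hs' : s ≠ ∞) : s * volume (maxSet h s) ≤ 5 ^ n * ∫⁻ y, ‖h y‖ₑ := by
  set t : Set (Euc n × ℝ) :=
    {P | 0 < P.2 ∧ s * volume (box P.1 P.2) < ∫⁻ y in box P.1 P.2, ‖h y‖ₑ}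
  have hsub : maxSet h s ⊆ ⋃ P ∈ t, box P.1 P.2 := by
    rintro x ⟨ρ, hρ, hx⟩
    exact mem_biUnion (show (x, ρ) ∈ t from ⟨hρ, hx⟩) (self_mem_box x hρ)
  refine (mul_le_mul_right (measure_mono hsub) s).trans ?_
  have hI : (∫⁻ y, ‖h y‖ₑ) / s ≠ ∞ := ENNReal.div_ne_top hh hs
  -- Vitali needs bounded radii. A box whose average exceeds `s` has volume at most `(∫⁻ ‖h‖ₑ) / s`,
  -- and a radius above `1` is smaller than the volume.
  refine mul_measure_biUnion_box_le (R := max 1 ((∫⁻ y, ‖h y‖ₑ) / s).toReal)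
    (fun c r _ => ?_) fun P hP => ⟨hP.1, ?_, hP.2.le⟩
  · rw [volume_box_mul c c (by norm_num) r, ENNReal.ofReal_ofNat]
  · by_contra! hlt
    have h1 := max_lt_iff.1 hlt
    have h2 : ENNReal.ofReal P.2 ≤ (∫⁻ y, ‖h y‖ₑ) / s := by
      rw [ENNReal.le_div_iff_mul_le (Or.inl hs) (Or.inl hs'), mul_comm]
      refine le_trans ?_ (hP.2.le.trans (setLIntegral_le_lintegral _ _))
      gcongr
      rw [volume_box, ← ENNReal.ofReal_pow (by linarith [hP.1])]
      refine ENNReal.ofReal_le_ofReal ?_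
      calc P.2 ≤ 2 * P.2 := by linarith [hP.1]
        _ ≤ (2 * P.2) ^ n := le_self_pow₀ (by linarith) (NeZero.ne n)
    have h3 := (ENNReal.ofReal_le_iff_le_toReal hI).1 h2
    linarith

theorem enorm_setAverage_le (h : Euc n → ℂ) (S : Set (Euc n)) :
    ‖⨍ y in S, h y‖ₑ ≤ (∫⁻ y in S, ‖h y‖ₑ) / volume S := by
  rw [← setLAverage_eq]
  exact enorm_integral_le_lintegral_enorm _

/-- The mean value zero part of a function on a box. -/
noncomputable def meanZero (h : Euc n → ℂ) (P : Euc n × ℝ) (x : Euc n) : ℂ :=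
  (box P.1 P.2).indicator h x - (box P.1 P.2).indicator (fun _ => ⨍ y in box P.1 P.2, h y) x

theorem memLp_meanZero {h : Euc n → ℂ} (hh : MemLp h q volume) (P : Euc n × ℝ) :
    MemLp (meanZero h P) q volume :=
  (hh.indicator (measurableSet_box _ _)).sub
    (memLp_indicator_const q (measurableSet_box _ _) _ (Or.inr (volume_box_ne_top _ _)))

theorem meanZero_of_notMem {h : Euc n → ℂ} {P : Euc n × ℝ} {x : Euc n}
    (hx : x ∉ box P.1 P.2) : meanZero h P x = 0 := by simp [meanZero, hx]

theorem meanZero_of_mem {h : Euc n → ℂ} {P : Euc n × ℝ} {x : Euc n}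
    (hx : x ∈ box P.1 P.2) : meanZero h P x = h x - ⨍ y in box P.1 P.2, h y := by
  simp [meanZero, hx]

theorem integral_meanZero {h : Euc n → ℂ} (hh : Integrable h volume) {P : Euc n × ℝ}
    (hP : 0 < P.2) : ∫ x, meanZero h P x = 0 := by
  have hv : volume.real (box P.1 P.2) ≠ 0 := by
    rw [Measure.real, ENNReal.toReal_ne_zero]
    exact ⟨(volume_box_pos _ hP).ne', volume_box_ne_top _ _⟩
  have hi : Integrable ((box P.1 P.2).indicator fun _ => ⨍ y in box P.1 P.2, h y) volume := by
    rw [integrable_indicator_iff (measurableSet_box _ _), integrableOn_const_iff]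
    exact Or.inr (volume_box_ne_top _ _).lt_top
  simp only [meanZero]
  rw [integral_sub (hh.indicator (measurableSet_box _ _)) hi,
    integral_indicator (measurableSet_box _ _), integral_indicator (measurableSet_box _ _),
    setIntegral_const, setAverage_eq, smul_smul, mul_inv_cancel₀ hv, one_smul, sub_self]

theorem lintegral_meanZero_le (h : Euc n → ℂ) (P : Euc n × ℝ) :
    ∫⁻ x, ‖meanZero h P x‖ₑ ≤ 2 * ∫⁻ x in box P.1 P.2, ‖h x‖ₑ := by
  calc ∫⁻ x, ‖meanZero h P x‖ₑ
      ≤ ∫⁻ x, (box P.1 P.2).indicator (fun x => ‖h x‖ₑ + ‖⨍ y in box P.1 P.2, h y‖ₑ) x := by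
        refine lintegral_mono fun x => ?_
        by_cases hx : x ∈ box P.1 P.2
        · rw [meanZero_of_mem hx, indicator_of_mem hx]; exact enorm_sub_le
        · simp [meanZero_of_notMem hx, hx]
    _ = ∫⁻ x in box P.1 P.2, ‖h x‖ₑ + ‖⨍ y in box P.1 P.2, h y‖ₑ :=
        lintegral_indicator (measurableSet_box _ _) _
    _ = (∫⁻ x in box P.1 P.2, ‖h x‖ₑ) + ‖⨍ y in box P.1 P.2, h y‖ₑ * volume (box P.1 P.2) := by
        rw [lintegral_add_right _ measurable_const]; simp
    _ ≤ (∫⁻ x in box P.1 P.2, ‖h x‖ₑ) +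
        (∫⁻ x in box P.1 P.2, ‖h x‖ₑ) / volume (box P.1 P.2) * volume (box P.1 P.2) := by
        gcongr; exact enorm_setAverage_le _ _
    _ ≤ (∫⁻ x in box P.1 P.2, ‖h x‖ₑ) + ∫⁻ x in box P.1 P.2, ‖h x‖ₑ := by
        gcongr; rw [mul_comm]; exact ENNReal.mul_div_le
    _ = _ := (two_mul _).symm

theorem volume_biUnion_dilate_le {Q : Euc n × ℝ} {F : Set (Euc n × ℝ)} (hF : IsSubfamily Q F) :
    volume (⋃ P ∈ F, box P.1 (5 * n * P.2)) ≤
      (5 * n : ℝ≥0∞) ^ n * volume (⋃ P ∈ F, box P.1 P.2) := by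
  refine (measure_biUnion_le _ hF.countable _).trans ?_
  rw [measure_biUnion hF.countable hF.disjoint fun P _ => measurableSet_box _ _,
    ← ENNReal.tsum_mul_left]
  refine ENNReal.tsum_le_tsum fun P => ?_
  rw [volume_box_mul P.1.1 P.1.1 (by positivity), ENNReal.ofReal_mul (by norm_num)]
  simp

/-- The Calderón–Zygmund decomposition: after removing finitely many mean zero pieces the function
is small in `L^q`. -/
theorem exists_finset_meanZero {Q : Euc n × ℝ} {h : Euc n → ℂ} (hh : MemLp h q volume)
    (hqtop : q ≠ ∞) (hhQ : ∀ y, y ∉ box Q.1 Q.2 → h y = 0) {F : Set (Euc n × ℝ)}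
    (hF : IsSubfamily Q F) {s : ℝ≥0∞} (hs0 : s ≠ 0)
    (hoff : ∀ x ∈ box Q.1 Q.2, x ∉ ⋃ P ∈ F, box P.1 P.2 → ‖h x‖ₑ ≤ s)
    (havg : ∀ P ∈ F, ‖⨍ y in box P.1 P.2, h y‖ₑ ≤ s) (hQ : 0 < Q.2) :
    ∃ J : Finset F, eLpNorm (fun x => h x - ∑ P ∈ J, meanZero h P x) q volume ^ q.toReal ≤
      2 * s ^ q.toReal * volume (box Q.1 Q.2) := by
  classical
  have hq1 : (1 : ℝ≥0∞) ≤ q := Fact.out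
  have hq0 : q ≠ 0 := fun h0 => by simp [h0] at hq1
  have hqpos : 0 < q.toReal := ENNReal.toReal_pos hq0 hqtop
  set f : F → ℝ≥0∞ := fun P => ∫⁻ x in box P.1.1 P.1.2, ‖h x‖ₑ ^ q.toReal
  have hcount : Countable F := hF.countable.to_subtype
  have hpd : Pairwise (Function.onFun Disjoint fun P : F => box P.1.1 P.1.2) := fun P P' hne =>
    hF.disjoint P.2 P'.2 fun e => hne (Subtype.ext e)
  have hsum : ∑' P, f P ≠ ∞ := by
    rw [← lintegral_iUnion (fun P => measurableSet_box _ _) hpd]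
    refine ne_top_of_le_ne_top ?_ (setLIntegral_le_lintegral _ _)
    exact (lintegral_rpow_enorm_lt_top_of_eLpNorm_lt_top hq0 hqtop hh.2).ne
  have hpos : 0 < s ^ q.toReal * volume (box Q.1 Q.2) :=
    ENNReal.mul_pos ((ENNReal.rpow_pos_of_nonneg (pos_iff_ne_zero.2 hs0) hqpos.le).ne')
      (volume_box_pos _ hQ).ne'
  -- Only finitely many pieces are removed, so that linearity of `T` suffices later. The pieces left
  -- in place have total `L^q` mass below that of the constant `s` on the box.
  obtain ⟨J, hJ⟩ := (((ENNReal.tendsto_tsum_compl_atTop_zero hsum).eventually_lt_const hpos)).exists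
  refine ⟨J, ?_⟩
  have hval : ∀ x, ‖h x - ∑ P ∈ J, meanZero h P x‖ₑ ^ q.toReal ≤
      (box Q.1 Q.2).indicator (fun _ => s ^ q.toReal) x +
      (⋃ P : {P : F // P ∉ J}, box P.1.1.1 P.1.1.2).indicator (fun x => ‖h x‖ₑ ^ q.toReal) x := by
    intro x
    by_cases hx : ∃ P : F, x ∈ box P.1.1 P.1.2
    · obtain ⟨P, hP⟩ := hx
      have hxQ : x ∈ box Q.1 Q.2 := hF.subset P.1 P.2 hP
      have hother : ∀ P' : F, P' ≠ P → meanZero h P' x = 0 := fun P' hne =>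
        meanZero_of_notMem fun hx' => Set.disjoint_left.1 (hpd hne) hx' hP
      by_cases hPJ : P ∈ J
      · rw [Finset.sum_eq_single_of_mem P hPJ fun P' _ hne => hother P' hne, meanZero_of_mem hP,
          sub_sub_cancel, indicator_of_mem hxQ]
        exact le_add_right (ENNReal.rpow_le_rpow (havg P.1 P.2) hqpos.le)
      · rw [Finset.sum_eq_zero fun P' hP' => hother P' fun e => hPJ (e ▸ hP'), sub_zero]
        have : x ∈ ⋃ P : {P : F // P ∉ J}, box P.1.1.1 P.1.1.2 := mem_iUnion.2 ⟨⟨P, hPJ⟩, hP⟩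
        rw [indicator_of_mem this]
        exact le_add_self
    · push Not at hx
      rw [Finset.sum_eq_zero fun P' _ => meanZero_of_notMem (hx P'), sub_zero]
      by_cases hxQ : x ∈ box Q.1 Q.2
      · rw [indicator_of_mem hxQ]
        refine le_add_right (ENNReal.rpow_le_rpow (hoff x hxQ ?_) hqpos.le)
        simp only [mem_iUnion, not_exists]
        exact fun P hP => hx ⟨P, hP⟩
      · simp [hhQ x hxQ, hqpos]
  rw [eLpNorm_eq_lintegral_rpow_enorm_toReal hq0 hqtop, ← ENNReal.rpow_mul,
    one_div_mul_cancel hqpos.ne', ENNReal.rpow_one]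
  calc _ ≤ ∫⁻ x, (box Q.1 Q.2).indicator (fun _ => s ^ q.toReal) x +
        (⋃ P : {P : F // P ∉ J}, box P.1.1.1 P.1.1.2).indicator (fun x => ‖h x‖ₑ ^ q.toReal) x :=
        lintegral_mono hval
    _ = s ^ q.toReal * volume (box Q.1 Q.2) +
        ∫⁻ x in ⋃ P : {P : F // P ∉ J}, box P.1.1.1 P.1.1.2, ‖h x‖ₑ ^ q.toReal := by
        rw [lintegral_add_left (measurable_const.indicator (measurableSet_box _ _)),
          lintegral_indicator_const (measurableSet_box _ _),
          lintegral_indicator (MeasurableSet.iUnion fun P => measurableSet_box _ _)]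
    _ ≤ s ^ q.toReal * volume (box Q.1 Q.2) + s ^ q.toReal * volume (box Q.1 Q.2) := by
        gcongr
        exact (lintegral_iUnion_le _ _).trans hJ.le
    _ = _ := by ring

/-- A local weak type `(1, 1)` estimate. -/
theorem IsCZPair.exists_local_weak [NeZero n] {T : LqOp n q} {K : Euc n → Euc n → ℂ} {C : ℝ}
    (hT : IsCZPair T K C) (hqtop : q ≠ ∞) {ε : ℝ≥0∞} (hε : ε ≠ 0) :
    ∃ M : ℝ≥0∞, M ≠ ∞ ∧ ∀ (c : Euc n) (r : ℝ), 0 < r → ∀ h : Euc n → ℂ, MemLp h q volume →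
      (∀ y, y ∉ box c r → h y = 0) →
      volume {x ∈ box c r | M * ((∫⁻ y, ‖h y‖ₑ) / volume (box c r)) < ‖app T h x‖ₑ} ≤
        ε * volume (box c r) := by
  have hq1 : (1 : ℝ≥0∞) ≤ q := Fact.out
  have hq0 : q ≠ 0 := fun h0 => by simp [h0] at hq1
  have hqpos : 0 < q.toReal := ENNReal.toReal_pos hq0 hqtop
  have hq1' : 1 ≤ q.toReal := by simpa using ENNReal.toReal_mono hqtop hq1
  have hε3 : ε / 3 ≠ 0 := by simpa using hε
  set B₀ : ℝ≥0∞ := ((5 * n : ℝ≥0∞) ^ n * 2 ^ (n + 1) + 2 ^ (n + 1)) * (5 ^ n + 2)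
  set B₁ : ℝ≥0∞ := 2 * ENNReal.ofReal (C * 4 ^ n)
  set B₂ : ℝ≥0∞ := ‖T‖ₑ ^ q.toReal * (2 * (2 ^ n) ^ q.toReal)
  have hB₂ : B₂ ≠ ∞ := by
    have : ‖T‖ₑ ^ q.toReal ≠ ∞ := ENNReal.rpow_ne_top_of_nonneg hqpos.le (by simp)
    have : ((2 : ℝ≥0∞) ^ n) ^ q.toReal ≠ ∞ := ENNReal.rpow_ne_top_of_nonneg hqpos.le (by finiteness)
    finiteness
  -- `κ` fixes the height `s = κ * m` of the decomposition. It is large enough both for the density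
  -- hypothesis of `exists_selection` and for the dilated selected boxes to occupy at most `ε / 3`
  -- of the volume.
  obtain ⟨κ, hκ⟩ := ENNReal.exists_nat_mul_gt (a := min (ε / 3) 1) (b := B₀)
    (by simp [hε]) (by simp only [B₀]; finiteness)
  -- `τ` raises the level above `s`: `B₁` pays for the mean zero part off the dilates and `B₂` for
  -- the part small in `L^q`. The `1` forces `τ ≥ 1`, hence `τ ≤ τ ^ q`.
  obtain ⟨τ, hτ⟩ := ENNReal.exists_nat_mul_gt (a := min (ε / 3) 1) (b := B₁ + B₂ + 1)
    (by simp [hε]) (by simp only [B₁]; finiteness)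
  have hκ0 : (κ : ℝ≥0∞) ≠ 0 := fun h0 => by simp [h0] at hκ
  have hτ1 : (1 : ℝ≥0∞) ≤ τ := by
    have h1 : (1 : ℝ≥0∞) < τ * min (ε / 3) 1 := lt_of_le_of_lt le_add_self hτ
    calc (1 : ℝ≥0∞) ≤ τ * min (ε / 3) 1 := h1.le
      _ ≤ τ * 1 := by gcongr; exact min_le_right _ _
      _ = τ := mul_one _
  have hκ1 : (1 : ℝ≥0∞) ≤ κ := by
    rw [← Nat.cast_one, Nat.cast_le, Nat.one_le_iff_ne_zero]; exact_mod_cast hκ0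
  have hτ0 : (τ : ℝ≥0∞) ≠ 0 := fun h0 => by simp [h0] at hτ1
  refine ⟨2 * τ * κ, by finiteness, fun c r hr h hh hhc => ?_⟩
  set V := volume (box c r)
  have hV0 : V ≠ 0 := (volume_box_pos c hr).ne'
  have hVt : V ≠ ∞ := volume_box_ne_top c r
  have hhi : Integrable h volume := integrable_of_memLp_of_box hh hhc
  set I := ∫⁻ y, ‖h y‖ₑ
  have hIt : I ≠ ∞ := hhi.2.ne
  set m := I / V with hm
  have hImV : I = m * V := (ENNReal.div_mul_cancel hV0 hVt).symm
  have hmt : m ≠ ∞ := ENNReal.div_ne_top hIt hV0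
  rcases eq_or_ne m 0 with hm0 | hm0
  · have hI0 : I = 0 := by rw [hImV, hm0, zero_mul]
    have hae : h =ᵐ[volume] fun _ => 0 := by
      have := (lintegral_eq_zero_iff' hh.1.enorm).1 hI0
      filter_upwards [this] with x hx
      simpa using hx
    have h0 : volume {x ∈ box c r | 2 * τ * κ * m < ‖app T h x‖ₑ} = 0 := by
      refine measure_mono_null (fun x hx => ?_)
        (ae_iff.1 ((app_zero T)))
      have := hx.2
      rw [app_congr T hae] at this
      intro h0
      rw [h0] at this
      simp at this
    rw [h0]; exact zero_le
  set s : ℝ≥0∞ := κ * m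
  have hs0 : s ≠ 0 := mul_ne_zero hκ0 hm0
  have hst : s ≠ ∞ := by finiteness
  have hκI : κ * I = s * V := by rw [hImV]; simp only [s]; ring
  -- the exceptional set
  set S : Set (Euc n) := maxSet h s ∪ {x | s ≤ ‖h x‖ₑ}
  have hS : κ * volume S ≤ (5 ^ n + 1) * V := by
    have h1 : s * volume S ≤ (5 ^ n + 1) * I := by
      calc s * volume S ≤ s * (volume (maxSet h s) + volume {x | s ≤ ‖h x‖ₑ}) := by
            gcongr; exact measure_union_le _ _
        _ = s * volume (maxSet h s) + s * volume {x | s ≤ ‖h x‖ₑ} := mul_add _ _ _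
        _ ≤ 5 ^ n * I + I := by
            exact add_le_add (mul_volume_maxSet_le hIt hs0 hst)
              (mul_meas_ge_le_lintegral₀ hh.1.enorm s)
        _ = _ := by ring
    have h2 : m * (κ * volume S) ≤ m * ((5 ^ n + 1) * V) := by
      calc m * (κ * volume S) = s * volume S := by simp only [s]; ring
        _ ≤ (5 ^ n + 1) * I := h1
        _ = _ := by rw [hImV]; ring
    exact (ENNReal.mul_le_mul_iff_right hm0 hmt).1 h2
  obtain ⟨U, hSU, hU, hUv⟩ : ∃ U ⊇ S, IsOpen U ∧ κ * volume U ≤ (5 ^ n + 2) * V := by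
    have : volume S < (5 ^ n + 2) * V / κ := by
      rw [ENNReal.lt_div_iff_mul_lt (Or.inl hκ0) (Or.inl (by finiteness)), mul_comm]
      refine hS.trans_lt (ENNReal.mul_lt_mul_left hV0 hVt ?_)
      exact ENNReal.add_lt_add_left (by finiteness) (by norm_num)
    obtain ⟨U, hSU, hU, hlt⟩ := Set.exists_isOpen_lt_of_lt S _ this
    refine ⟨U, hSU, hU, ?_⟩
    rw [ENNReal.lt_div_iff_mul_lt (Or.inl hκ0) (Or.inl (by finiteness)), mul_comm] at hlt
    exact hlt.le
  have hUQ : 2 ^ (n + 1) * volume (U ∩ box c r) ≤ V := by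
    have h1 : (κ : ℝ≥0∞) * (2 ^ (n + 1) * volume (U ∩ box c r)) ≤ κ * V := by
      calc (κ : ℝ≥0∞) * (2 ^ (n + 1) * volume (U ∩ box c r))
          = 2 ^ (n + 1) * (κ * volume (U ∩ box c r)) := by ring
        _ ≤ 2 ^ (n + 1) * (κ * volume U) := by gcongr; exact inter_subset_left
        _ ≤ 2 ^ (n + 1) * ((5 ^ n + 2) * V) := by gcongr
        _ = 2 ^ (n + 1) * (5 ^ n + 2) * V := by ring
        _ ≤ B₀ * V := by
            refine mul_le_mul_left (mul_le_mul_left ?_ _) _; exact le_add_self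
        _ ≤ κ * min (ε / 3) 1 * V := by gcongr
        _ ≤ κ * 1 * V := by gcongr; exact min_le_right _ _
        _ = _ := by ring
    exact (ENNReal.mul_le_mul_iff_right hκ0 (by finiteness)).1 h1
  obtain ⟨F, hF, hhalf, hcov, hFv⟩ := exists_selection hr hU hUQ
  have havg : ∀ P ∈ F, ‖⨍ y in box P.1 P.2, h y‖ₑ ≤ 2 ^ n * s := by
    intro P hP
    have hPpos := hF.pos P hP
    have hv0 := (volume_box_pos P.1 hPpos).ne'
    have hvt := volume_box_ne_top P.1 P.2
    -- A selected box is at most half filled by `U`. The doubled box around a point off `U` contains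
    -- `P` and has average at most `s`.
    obtain ⟨x, hxP, hxU⟩ : ∃ x ∈ box P.1 P.2, x ∉ U := by
      by_contra! hall
      have := hhalf P hP
      rw [inter_eq_left.2 hall] at this
      have h2 := ENNReal.mul_lt_mul_left hv0 hvt (show (1 : ℝ≥0∞) < 2 by norm_num)
      rw [one_mul] at h2
      exact absurd this (not_le.2 h2)
    refine (enorm_setAverage_le _ _).trans ?_
    rw [ENNReal.div_le_iff hv0 hvt]
    calc ∫⁻ y in box P.1 P.2, ‖h y‖ₑ ≤ ∫⁻ y in box x (2 * P.2), ‖h y‖ₑ :=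
          lintegral_mono_set (box_subset_box_of_mem hxP)
      _ ≤ s * volume (box x (2 * P.2)) :=
          lintegral_le_of_notMem_maxSet (fun hx => hxU (hSU (Or.inl hx))) (by positivity)
      _ = _ := by
          rw [volume_box_mul x P.1 (by norm_num) P.2, ENNReal.ofReal_ofNat]; ring
  have hs2 : (2 : ℝ≥0∞) ^ n * s ≠ 0 := mul_ne_zero (by positivity) hs0
  obtain ⟨J, hJ⟩ := exists_finset_meanZero (Q := (c, r)) hh hqtop hhc hF (s := 2 ^ n * s) hs2
    (by
      intro x hx hxF
      -- Since `{s ≤ ‖h‖ₑ}` was put into the exceptional set, the pointwise bound is immediate and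
      -- Lebesgue differentiation is not needed.
      have hxU : x ∉ U := fun hxU => hxF (hcov ⟨hxU, hx⟩)
      have h1 : ¬ s ≤ ‖h x‖ₑ := fun h1 => hxU (hSU (Or.inr h1))
      refine (not_le.1 h1).le.trans ?_
      exact le_mul_of_one_le_left zero_le (one_le_pow₀ (by norm_num))) havg hr
  set g : Euc n → ℂ := fun x => h x - ∑ P ∈ J, meanZero h P x
  have hbm : MemLp (fun x => ∑ P ∈ J, meanZero h P x) q volume :=
    memLp_finsetSum J fun P _ => memLp_meanZero hh P.1
  have hgm : MemLp g q volume := hh.sub hbm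
  set W : Set (Euc n) := ⋃ P ∈ F, box P.1 (5 * n * P.2)
  have hWm : MeasurableSet W := MeasurableSet.biUnion hF.countable fun P _ => measurableSet_box _ _
  have hlin : app T h =ᵐ[volume] fun x => app T g x + ∑ P ∈ J, app T (meanZero h P) x := by
    have e : h = fun x => g x + ∑ P ∈ J, meanZero h P x := by ext x; simp [g]
    filter_upwards [app_add T hgm hbm, app_sum T J fun P _ => memLp_meanZero hh P.1] with x hx hx'
    rw [← hx', ← hx, ← e]
  have hts0 : (τ : ℝ≥0∞) * s ≠ 0 := mul_ne_zero hτ0 hs0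
  have htst : (τ : ℝ≥0∞) * s ≠ ∞ := by finiteness
  have hεV : ε * V = ε / 3 * V + ε / 3 * V + ε / 3 * V := by
    rw [← add_mul, ← add_mul, ENNReal.add_thirds]
  -- the three pieces
  have hW : volume W ≤ ε / 3 * V := by
    have h1 : (κ : ℝ≥0∞) * volume W ≤ κ * (ε / 3 * V) := by
      calc (κ : ℝ≥0∞) * volume W
          ≤ κ * ((5 * n : ℝ≥0∞) ^ n * (2 ^ (n + 1) * volume U)) := by
            gcongr
            refine (volume_biUnion_dilate_le hF).trans ?_
            gcongr
            refine hFv.trans ?_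
            gcongr
            exact inter_subset_left
        _ = (5 * n : ℝ≥0∞) ^ n * 2 ^ (n + 1) * (κ * volume U) := by ring
        _ ≤ (5 * n : ℝ≥0∞) ^ n * 2 ^ (n + 1) * ((5 ^ n + 2) * V) := by gcongr
        _ = (5 * n : ℝ≥0∞) ^ n * 2 ^ (n + 1) * (5 ^ n + 2) * V := by ring
        _ ≤ B₀ * V := by
            refine mul_le_mul_left (mul_le_mul_left ?_ _) _; exact le_self_add
        _ ≤ κ * min (ε / 3) 1 * V := by gcongr
        _ ≤ κ * (ε / 3) * V := by gcongr; exact min_le_left _ _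
        _ = _ := by ring
    exact (ENNReal.mul_le_mul_iff_right hκ0 (by finiteness)).1 h1
  have hg : volume {x | τ * s ≤ ‖app T g x‖ₑ} ≤ ε / 3 * V := by
    refine (meas_ge_le_mul_pow_eLpNorm_enorm volume hq0 hqtop (aestronglyMeasurable_app T g) hts0
      (fun h => absurd h htst)).trans ?_
    have h1 : eLpNorm (app T g) q volume ^ q.toReal ≤ B₂ * s ^ q.toReal * V := by
      calc eLpNorm (app T g) q volume ^ q.toReal
          ≤ (‖T‖ₑ * eLpNorm g q volume) ^ q.toReal := by
            gcongr; exact eLpNorm_app_le T hgm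
        _ = ‖T‖ₑ ^ q.toReal * eLpNorm g q volume ^ q.toReal :=
            ENNReal.mul_rpow_of_nonneg _ _ hqpos.le
        _ ≤ ‖T‖ₑ ^ q.toReal * (2 * (2 ^ n * s) ^ q.toReal * V) := by gcongr
        _ = _ := by
            rw [ENNReal.mul_rpow_of_nonneg _ _ hqpos.le]; simp only [B₂]; ring
    have h2 : B₂ ≤ (τ : ℝ≥0∞) ^ q.toReal * (ε / 3) := by
      calc B₂ ≤ B₁ + B₂ + 1 := by
            rw [add_right_comm]; exact le_add_self
        _ ≤ τ * min (ε / 3) 1 := hτ.le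
        _ ≤ (τ : ℝ≥0∞) ^ (1 : ℝ) * (ε / 3) := by
            rw [ENNReal.rpow_one]; gcongr; exact min_le_left _ _
        _ ≤ _ := by gcongr
    calc (τ * s)⁻¹ ^ q.toReal * eLpNorm (app T g) q volume ^ q.toReal
        ≤ (τ * s)⁻¹ ^ q.toReal * (((τ : ℝ≥0∞) ^ q.toReal * (ε / 3)) * s ^ q.toReal * V) := by
          gcongr; exact h1.trans (mul_le_mul_left (mul_le_mul_left h2 _) _)
      _ = ((τ * s)⁻¹ ^ q.toReal * ((τ * s) ^ q.toReal)) * (ε / 3 * V) := by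
          rw [ENNReal.mul_rpow_of_nonneg (τ : ℝ≥0∞) s hqpos.le]; ring
      _ = _ := by
          rw [← ENNReal.mul_rpow_of_nonneg _ _ hqpos.le, ENNReal.inv_mul_cancel hts0 htst,
            ENNReal.one_rpow, one_mul]
  have hb : volume {x | x ∉ W ∧ τ * s ≤ ‖∑ P ∈ J, app T (meanZero h P) x‖ₑ} ≤ ε / 3 * V := by
    set bb : Euc n → ℝ≥0∞ := fun x => ∑ P ∈ J, ‖app T (meanZero h P) x‖ₑ
    have hbb : ∫⁻ x in Wᶜ, bb x ≤ B₁ * I := by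
      calc ∫⁻ x in Wᶜ, bb x = ∑ P ∈ J, ∫⁻ x in Wᶜ, ‖app T (meanZero h P) x‖ₑ :=
            lintegral_finsetSum' J fun P _ => (aestronglyMeasurable_app T _).enorm.restrict
        _ ≤ ∑ P ∈ J, B₁ * ∫⁻ x in box P.1.1 P.1.2, ‖h x‖ₑ := by
            refine Finset.sum_le_sum fun P _ => ?_
            have hP := hF.pos P.1 P.2
            calc ∫⁻ x in Wᶜ, ‖app T (meanZero h P) x‖ₑ
                ≤ ∫⁻ x in (box P.1.1 (5 * n * P.1.2))ᶜ, ‖app T (meanZero h P) x‖ₑ :=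
                  lintegral_mono_set (compl_subset_compl.2 (subset_biUnion_of_mem
                    (u := fun P : Euc n × ℝ => box P.1 (5 * n * P.2)) P.2))
              _ ≤ ENNReal.ofReal (C * 4 ^ n) * ∫⁻ y, ‖meanZero h P y‖ₑ :=
                  hT.lintegral_app_compl_le (memLp_meanZero hh P.1) hP
                    (fun y hy => meanZero_of_notMem hy) (integral_meanZero hhi hP)
              _ ≤ ENNReal.ofReal (C * 4 ^ n) * (2 * ∫⁻ x in box P.1.1 P.1.2, ‖h x‖ₑ) := by
                  gcongr; exact lintegral_meanZero_le h P.1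
              _ = _ := by simp only [B₁]; ring
        _ = B₁ * ∑ P ∈ J, ∫⁻ x in box P.1.1 P.1.2, ‖h x‖ₑ := (Finset.mul_sum _ _ _).symm
        _ = B₁ * ∫⁻ x in ⋃ P ∈ J, box P.1.1 P.1.2, ‖h x‖ₑ := by
            rw [lintegral_biUnion_finset]
            · exact fun P _ P' _ hne => hF.disjoint P.2 P'.2 fun e => hne (Subtype.ext e)
            · exact fun P _ => measurableSet_box _ _
        _ ≤ B₁ * I := mul_le_mul_right (setLIntegral_le_lintegral _ _) _
    have h1 : τ * s * volume {x | x ∉ W ∧ τ * s ≤ ‖∑ P ∈ J, app T (meanZero h P) x‖ₑ} ≤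
        B₁ * I := by
      have hm : AEMeasurable bb (volume.restrict Wᶜ) := by
        refine Finset.aemeasurable_fun_sum J fun P _ => ?_
        exact (aestronglyMeasurable_app T _).enorm.restrict
      refine le_trans ?_ ((mul_meas_ge_le_lintegral₀ hm (τ * s)).trans hbb)
      refine mul_le_mul_right ?_ _
      rw [Measure.restrict_apply' hWm.compl]
      refine measure_mono fun x hx => ⟨?_, hx.1⟩
      exact hx.2.trans (enorm_sum_le _ _)
    have h2 : τ * s * volume {x | x ∉ W ∧ τ * s ≤ ‖∑ P ∈ J, app T (meanZero h P) x‖ₑ} ≤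
        τ * s * (ε / 3 * V) := by
      calc _ ≤ B₁ * I := h1
        _ ≤ B₁ * (κ * I) := by
            gcongr; exact le_mul_of_one_le_left zero_le hκ1
        _ = B₁ * (s * V) := by rw [hκI]
        _ ≤ τ * min (ε / 3) 1 * (s * V) := by
            gcongr
            refine le_trans ?_ hτ.le
            rw [add_assoc]; exact le_self_add
        _ ≤ τ * (ε / 3) * (s * V) := by gcongr; exact min_le_left _ _
        _ = _ := by ring
    exact (ENNReal.mul_le_mul_iff_right hts0 htst).1 h2
  rw [hεV]
  refine le_trans ?_ ((measure_union_le _ _).trans (add_le_add ((measure_union_le _ _).trans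
    (add_le_add hW hg)) hb))
  refine measure_mono_ae ?_
  filter_upwards [hlin] with x hx hxS
  have hxS' : 2 * τ * κ * m < ‖app T h x‖ₑ := hxS.2
  rw [hx] at hxS'
  by_cases hxW : x ∈ W
  · exact Or.inl (Or.inl hxW)
  by_cases hxg : τ * s ≤ ‖app T g x‖ₑ
  · exact Or.inl (Or.inr hxg)
  refine Or.inr ⟨hxW, ?_⟩
  by_contra! hlt
  rw [not_le] at hxg
  -- The level is twice `τ * s`, one half for each of the two summands of `app T h x`.
  have h1 : 2 * τ * κ * m = τ * s + τ * s := by simp only [s]; ring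
  rw [h1] at hxS'
  exact absurd (hxS'.trans_le (enorm_add_le _ _)) (not_lt.2 (add_le_add hxg.le hlt.le))

end CZCommutator

namespace CZCommutator

open Set Filter Topology
open scoped NNReal

set_option linter.unusedSectionVars false

variable {n : ℕ} {q : ℝ≥0∞} [Fact (1 ≤ q)]

/-! ### Stopping sets: one step of the sparse construction. -/

theorem box_subset_dilate [NeZero n] (c : Euc n) {r : ℝ} (hr : 0 < r) :
    box c r ⊆ box c (5 * n * r) := by
  have hn : (1 : ℝ) ≤ n := by exact_mod_cast NeZero.one_le
  exact box_mono c (by nlinarith)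

theorem volume_box_dilate (c : Euc n) (r : ℝ) :
    volume (box c (5 * n * r)) = (5 * n : ℝ≥0∞) ^ n * volume (box c r) := by
  rw [volume_box_mul c c (by positivity), ENNReal.ofReal_mul (by norm_num)]
  simp

theorem exists_mem_of_ae {S : Set (Euc n)} (hS : volume S ≠ 0) {p : Euc n → Prop}
    (hp : ∀ᵐ x, p x) : ∃ x ∈ S, p x := by
  by_contra! h
  exact hS (measure_mono_null (fun x hx => h x hx) (ae_iff.1 hp))

/-- The basic stopping time construction: away from a small open set, the operator and its
localisations to subboxes are controlled by the average. -/
theorem IsCZPair.exists_stopping_set [NeZero n] {T : LqOp n q} {K : Euc n → Euc n → ℂ} {C : ℝ}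
    (hT : IsCZPair T K C) (hqtop : q ≠ ∞) :
    ∃ M : ℝ≥0∞, M ≠ ∞ ∧ ∀ (c : Euc n) (r : ℝ), 0 < r → ∀ h : Euc n → ℂ, MemLp h q volume →
      (∀ y, y ∉ box c (5 * n * r) → h y = 0) → ∃ U : Set (Euc n), IsOpen U ∧
      2 ^ (n + 3) * volume (U ∩ box c r) ≤ volume (box c r) ∧
      (∀ᵐ x, x ∈ box c r → x ∉ U →
        ‖app T h x‖ₑ ≤ M * ((∫⁻ y, ‖h y‖ₑ) / volume (box c (5 * n * r)))) ∧
      ∀ (c' : Euc n) (r' : ℝ), 0 < r' → box c' r' ⊆ box c r →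
        2 * volume (box c' r' ∩ U) ≤ volume (box c' r') →
        ∀ᵐ x, x ∈ box c' r' → ‖app T ((box c' (5 * n * r'))ᶜ.indicator h) x‖ₑ ≤
          M * ((∫⁻ y, ‖h y‖ₑ) / volume (box c (5 * n * r))) := by
  have hn0 : (n : ℝ≥0∞) ≠ 0 := by exact_mod_cast NeZero.ne n
  have hn : (1 : ℝ) ≤ n := by exact_mod_cast NeZero.one_le
  set D : ℝ≥0∞ := (5 * n : ℝ≥0∞) ^ n
  have hD0 : D ≠ 0 := pow_ne_zero _ (mul_ne_zero (by norm_num) hn0)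
  have hDt : D ≠ ∞ := by simp only [D]; finiteness
  -- The weak estimate is used on the dilate, of volume `D * V`; this `ε` leaves a bad set of volume
  -- at most `V / 2 ^ (n + 5)`.
  obtain ⟨M₁, hM₁, hw₁⟩ := hT.exists_local_weak hqtop (ε := (2 ^ (n + 5) * D)⁻¹)
    (ENNReal.inv_ne_zero.2 (by finiteness))
  -- This one is used on the dilate of a subbox, where the bad set may fill at most a quarter of the
  -- subbox.
  obtain ⟨M₂, hM₂, hw₂⟩ := hT.exists_local_weak hqtop (ε := (4 * D)⁻¹)
    (ENNReal.inv_ne_zero.2 (by finiteness))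
  obtain ⟨κ, hκ⟩ := ENNReal.exists_nat_mul_gt (a := 1) (b := 2 ^ (n + 5) * (5 ^ n * D))
    one_ne_zero (by finiteness)
  rw [mul_one] at hκ
  have hκ0 : (κ : ℝ≥0∞) ≠ 0 := fun h0 => by simp [h0] at hκ
  refine ⟨M₁ + (ENNReal.ofReal (C * 4 ^ n) * κ + (M₁ + M₂ * (2 ^ n * κ))), by finiteness,
    fun c r hr h hh hhc => ?_⟩
  set V := volume (box c r)
  have hV0 : V ≠ 0 := (volume_box_pos c hr).ne'
  have hVt : V ≠ ∞ := volume_box_ne_top c r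
  have hnr : 0 < 5 * n * r := by positivity
  have hVs : volume (box c (5 * n * r)) = D * V := volume_box_dilate c r
  have hhi : Integrable h volume := integrable_of_memLp_of_box hh hhc
  set I := ∫⁻ y, ‖h y‖ₑ
  have hIt : I ≠ ∞ := hhi.2.ne
  set m := I / volume (box c (5 * n * r)) with hm
  have hImV : I = m * (D * V) := by
    rw [← hVs]
    exact (ENNReal.div_mul_cancel (volume_box_pos c hnr).ne' (volume_box_ne_top _ _)).symm
  have hmt : m ≠ ∞ := ENNReal.div_ne_top hIt (volume_box_pos c hnr).ne'
  rcases eq_or_ne m 0 with hm0 | hm0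
  · have hI0 : I = 0 := by rw [hImV, hm0, zero_mul]
    have hae : h =ᵐ[volume] fun _ => 0 := by
      have := (lintegral_eq_zero_iff' hh.1.enorm).1 hI0
      filter_upwards [this] with x hx
      simpa using hx
    refine ⟨∅, isOpen_empty, by simp, ?_, fun c' r' _ _ _ => ?_⟩
    · rw [app_congr T hae]
      filter_upwards [app_zero T] with x hx _ _
      simp [hx]
    · have : (box c' (5 * n * r'))ᶜ.indicator h =ᵐ[volume] fun _ => 0 := by
        filter_upwards [hae] with x hx
        by_cases hx' : x ∈ (box c' (5 * n * r'))ᶜ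
        · rw [indicator_of_mem hx', hx]
        · rw [indicator_of_notMem hx']
      rw [app_congr T this]
      filter_upwards [app_zero T] with x hx _
      simp [hx]
  set s : ℝ≥0∞ := κ * m
  have hs0 : s ≠ 0 := mul_ne_zero hκ0 hm0
  have hst : s ≠ ∞ := by finiteness
  set S₂ : Set (Euc n) := {x ∈ box c (5 * n * r) | M₁ * m < ‖app T h x‖ₑ}
  set S : Set (Euc n) := maxSet h s ∪ S₂
  have hS₁ : 2 ^ (n + 5) * volume (maxSet h s) ≤ V := by
    have h1 : (κ * m) * (2 ^ (n + 5) * volume (maxSet h s)) ≤ (κ * m) * V := by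
      calc (κ * m) * (2 ^ (n + 5) * volume (maxSet h s))
          = 2 ^ (n + 5) * (s * volume (maxSet h s)) := by simp only [s]; ring
        _ ≤ 2 ^ (n + 5) * (5 ^ n * I) := by
            exact mul_le_mul_right (mul_volume_maxSet_le hIt hs0 hst) _
        _ = 2 ^ (n + 5) * (5 ^ n * D) * (m * V) := by rw [hImV]; ring
        _ ≤ κ * (m * V) := by gcongr
        _ = _ := by ring
    exact (ENNReal.mul_le_mul_iff_right hs0 hst).1 h1
  have hS₂ : 2 ^ (n + 5) * volume S₂ ≤ V := by
    have h1 := hw₁ c (5 * n * r) hnr h hh hhc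
    calc 2 ^ (n + 5) * volume S₂
        ≤ 2 ^ (n + 5) * ((2 ^ (n + 5) * D)⁻¹ * volume (box c (5 * n * r))) := by
          exact mul_le_mul_right h1 _
      _ = (2 ^ (n + 5) * D) * (2 ^ (n + 5) * D)⁻¹ * V := by rw [hVs]; ring
      _ = V := by
          rw [ENNReal.mul_inv_cancel (mul_ne_zero (by positivity) hD0) (by finiteness), one_mul]
  have hS : 2 ^ (n + 3) * volume S < V := by
    have h1 : 2 ^ (n + 5) * volume S ≤ V + V := by
      calc 2 ^ (n + 5) * volume S
          ≤ 2 ^ (n + 5) * (volume (maxSet h s) + volume S₂) := by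
            gcongr; exact measure_union_le _ _
        _ ≤ _ := by rw [mul_add]; exact add_le_add hS₁ hS₂
    have h2 : 4 * (2 ^ (n + 3) * volume S) < 4 * V := by
      calc 4 * (2 ^ (n + 3) * volume S) = 2 ^ (n + 5) * volume S := by ring
        _ ≤ V + V := h1
        _ = V * 2 := by ring
        _ < V * 4 := ENNReal.mul_lt_mul_right hV0 hVt (by norm_num)
        _ = 4 * V := mul_comm _ _
    exact lt_of_mul_lt_mul_left' h2
  obtain ⟨U, hSU, hU, hUv⟩ := Set.exists_isOpen_lt_of_lt (μ := volume) S (V / 2 ^ (n + 3)) (by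
    rw [ENNReal.lt_div_iff_mul_lt (Or.inl (by positivity)) (Or.inl (by finiteness)), mul_comm]
    exact hS)
  rw [ENNReal.lt_div_iff_mul_lt (Or.inl (by positivity)) (Or.inl (by finiteness)), mul_comm] at hUv
  have hpt : ∀ x ∈ box c r, x ∉ U → ‖app T h x‖ₑ ≤ M₁ * m := fun x hx hxU => by
    by_contra! hlt
    exact hxU (hSU (Or.inr ⟨box_subset_dilate c hr hx, hlt⟩))
  refine ⟨U, hU, le_trans (by gcongr; exact inter_subset_left) hUv.le,
    ae_of_all _ fun x hx hxU => (hpt x hx hxU).trans (by gcongr; exact le_self_add), ?_⟩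
  intro c' r' hr' hsub hhalf
  set P := box c' r'
  set Ps := box c' (5 * n * r')
  have hPv0 : volume P ≠ 0 := (volume_box_pos c' hr').ne'
  have hPvt : volume P ≠ ∞ := volume_box_ne_top c' r'
  have hnr' : 0 < 5 * n * r' := by positivity
  set h₁ := Ps.indicator h
  set h₂ := Psᶜ.indicator h
  have hPsm : MeasurableSet Ps := measurableSet_box _ _
  have hh₁ : MemLp h₁ q volume := hh.indicator hPsm
  have hh₂ : MemLp h₂ q volume := hh.indicator hPsm.compl
  have hsplit : app T h =ᵐ[volume] fun x => app T h₁ x + app T h₂ x := by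
    have e : h = fun x => h₁ x + h₂ x := by
      ext x
      by_cases hx : x ∈ Ps <;> simp [h₁, h₂, hx]
    conv_lhs => rw [e]
    exact app_add T hh₁ hh₂
  -- `h₂` lives in the closed cube minus the open dilated cube, a compact set that misses `P`, so
  -- the kernel represents `app T h₂` on `P`.
  have hrep : ∀ᵐ x, x ∈ P → app T h₂ x = ∫ y, K x y * h₂ y := by
    filter_upwards [hT.app_ae_eq hh₂ ((isCompact_cube c (5 * n * r)).inter_right
      (isOpen_openCube c' (5 * n * r')).isClosed_compl) (by
        intro y hy
        rw [mem_inter_iff, not_and_or, notMem_compl_iff] at hy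
        rcases hy with hy | hy
        · have := hhc y fun h => hy (box_subset_cube _ _ h)
          exact indicator_apply_eq_zero.2 fun _ => this
        · refine indicator_of_notMem (notMem_compl_iff.2 fun i => ?_) h
          have := abs_lt.1 (hy i)
          constructor <;> linarith)] with x hx hxP
    refine hx fun hx' => hx'.2 fun i => ?_
    have : r' < 5 * n * r' := by nlinarith
    exact abs_lt.2 ⟨by linarith [(hxP i).1], by linarith [(hxP i).2]⟩
  have hw := hw₂ c' (5 * n * r') hnr' h₁ hh₁ fun y hy => indicator_of_notMem hy h
  set Bad := {x ∈ box c' (5 * n * r') |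
    M₂ * ((∫⁻ y, ‖h₁ y‖ₑ) / volume (box c' (5 * n * r'))) < ‖app T h₁ x‖ₑ}
  have hBad : 4 * volume Bad ≤ volume P := by
    calc 4 * volume Bad ≤ 4 * ((4 * D)⁻¹ * volume (box c' (5 * n * r'))) :=
          mul_le_mul_right hw _
      _ = 4 * D * (4 * D)⁻¹ * volume P := by rw [volume_box_dilate]; ring
      _ = _ := by rw [ENNReal.mul_inv_cancel (mul_ne_zero (by norm_num) hD0) (by finiteness),
            one_mul]
  -- `U` takes at most half of `P` and `Bad` has at most a quarter of its volume. At a point of what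
  -- remains, both `T h` and the local part `T h₁` are controlled, hence also their difference `T
  -- h₂`.
  have hgood : volume ((P \ U) \ Bad) ≠ 0 := by
    intro h0
    have h1 : volume P ≤ volume (P ∩ U) + volume Bad := by
      calc volume P ≤ volume ((P ∩ U) ∪ (Bad ∪ ((P \ U) \ Bad))) := by
            refine measure_mono fun x hx => ?_
            by_cases hxU : x ∈ U
            · exact Or.inl ⟨hx, hxU⟩
            by_cases hxB : x ∈ Bad
            · exact Or.inr (Or.inl hxB)
            · exact Or.inr (Or.inr ⟨⟨hx, hxU⟩, hxB⟩)
        _ ≤ volume (P ∩ U) + (volume Bad + volume ((P \ U) \ Bad)) :=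
            (measure_union_le _ _).trans (by gcongr; exact measure_union_le _ _)
        _ = _ := by rw [h0, add_zero]
    have h2 : volume P * 4 ≤ volume P * 3 := by
      calc volume P * 4 ≤ (volume (P ∩ U) + volume Bad) * 4 := by gcongr
        _ = 2 * (2 * volume (P ∩ U)) + 4 * volume Bad := by ring
        _ ≤ 2 * volume P + volume P := by gcongr
        _ = _ := by ring
    exact absurd h2 (not_le.2 (ENNReal.mul_lt_mul_right hPv0 hPvt (by norm_num)))
  obtain ⟨x', ⟨⟨hx'P, hx'U⟩, hx'B⟩, hx's, hx'rep⟩ := exists_mem_of_ae hgood (hsplit.and hrep)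
  have hx'Ps : x' ∈ Ps := box_subset_dilate c' hr' hx'P
  have hx'm : ∀ ρ, 0 < ρ → ∫⁻ y in box x' ρ, ‖h y‖ₑ ≤ s * volume (box x' ρ) := fun ρ hρ =>
    lintegral_le_of_notMem_maxSet (fun hx => hx'U (hSU (Or.inl hx))) hρ
  have hb₁ : ‖app T h₁ x'‖ₑ ≤ M₂ * (2 ^ n * κ) * m := by
    have h1 : ‖app T h₁ x'‖ₑ ≤ M₂ * ((∫⁻ y, ‖h₁ y‖ₑ) / volume (box c' (5 * n * r'))) := by
      by_contra! hlt
      exact hx'B ⟨hx'Ps, hlt⟩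
    refine h1.trans ?_
    rw [mul_assoc M₂]
    refine mul_le_mul_right ?_ _
    rw [ENNReal.div_le_iff (volume_box_pos c' hnr').ne' (volume_box_ne_top _ _)]
    calc ∫⁻ y, ‖h₁ y‖ₑ = ∫⁻ y in Ps, ‖h y‖ₑ := by
          rw [← lintegral_indicator hPsm]
          refine lintegral_congr fun y => ?_
          simp only [h₁]
          exact enorm_indicator_eq_indicator_enorm _ _
      _ ≤ ∫⁻ y in box x' (2 * (5 * n * r')), ‖h y‖ₑ :=
          lintegral_mono_set (box_subset_box_of_mem hx'Ps)
      _ ≤ s * volume (box x' (2 * (5 * n * r'))) := hx'm _ (by positivity)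
      _ = _ := by
          rw [volume_box_mul x' c' (by norm_num), ENNReal.ofReal_ofNat]
          simp only [s]; ring
  have hb₂ : ‖app T h₂ x'‖ₑ ≤ (M₁ + M₂ * (2 ^ n * κ)) * m := by
    have : app T h₂ x' = app T h x' - app T h₁ x' := by rw [hx's]; ring
    rw [this, add_mul]
    exact (enorm_sub_le).trans (add_le_add (hpt x' (hsub hx'P) hx'U) hb₁)
  filter_upwards [hrep] with x hx hxP
  -- The bound at the good point `x'` spreads to all of `P`: `x'` lies off `maxSet h s`, which
  -- controls the averages of `h` over all boxes centred there.
  have hdiff := hT.enorm_integral_sub_le (f := h₂) (s := s)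
    (hhi.indicator hPsm.compl) hr' hxP hx'P
    (fun y hy => indicator_of_notMem (notMem_compl_iff.2 hy) h) (fun ρ hρ => by
      refine le_trans (lintegral_mono fun y => ?_) (hx'm ρ hρ)
      simp only [h₂]
      rw [enorm_indicator_eq_indicator_enorm]
      exact indicator_le_self _ _ _)
  rw [← hx hxP, ← hx'rep hx'P] at hdiff
  calc ‖app T h₂ x‖ₑ = ‖(app T h₂ x - app T h₂ x') + app T h₂ x'‖ₑ := by rw [sub_add_cancel]
    _ ≤ ENNReal.ofReal (C * 4 ^ n) * s + (M₁ + M₂ * (2 ^ n * κ)) * m :=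
        (enorm_add_le _ _).trans (add_le_add hdiff hb₂)
    _ = (ENNReal.ofReal (C * 4 ^ n) * κ + (M₁ + M₂ * (2 ^ n * κ))) * m := by
        simp only [s]; ring
    _ ≤ _ := mul_le_mul_left le_add_self _

end CZCommutator

namespace CZCommutator

open Set Filter Topology
open scoped NNReal

set_option linter.unusedSectionVars false

variable {n : ℕ} {q : ℝ≥0∞} [Fact (1 ≤ q)]

/-! ### Stopping trees -/

/-- The `k`-th generation of a tree of boxes. -/
def gen (ch : Euc n × ℝ → Set (Euc n × ℝ)) (Q : Euc n × ℝ) : ℕ → Set (Euc n × ℝ)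
  | 0 => {Q}
  | k + 1 => ⋃ P ∈ gen ch Q k, ch P

/-- The union of the `k`-th generation of a tree of boxes. -/
def layer (ch : Euc n × ℝ → Set (Euc n × ℝ)) (Q : Euc n × ℝ) (k : ℕ) : Set (Euc n) :=
  ⋃ P ∈ gen ch Q k, box P.1 P.2

section tree

variable {ch : Euc n × ℝ → Set (Euc n × ℝ)} {Q : Euc n × ℝ}

theorem isSubfamily_gen (hch : ∀ P, 0 < P.2 → IsSubfamily P (ch P)) (hQ : 0 < Q.2) (k : ℕ) :
    IsSubfamily Q (gen ch Q k) := by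
  induction k with
  | zero => exact ⟨countable_singleton Q, by simp [gen, hQ], by simp [gen], by simp [gen]⟩
  | succ k ih =>
    refine ⟨ih.countable.biUnion fun P hP => (hch P (ih.pos P hP)).countable, ?_, ?_, ?_⟩
    · intro R hR
      obtain ⟨P, hP, hRP⟩ := mem_iUnion₂.1 hR
      exact (hch P (ih.pos P hP)).pos R hRP
    · intro R hR
      obtain ⟨P, hP, hRP⟩ := mem_iUnion₂.1 hR
      exact ((hch P (ih.pos P hP)).subset R hRP).trans (ih.subset P hP)
    · intro R hR R' hR' hne
      obtain ⟨P, hP, hRP⟩ := mem_iUnion₂.1 hR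
      obtain ⟨P', hP', hRP'⟩ := mem_iUnion₂.1 hR'
      by_cases h : P = P'
      · subst h
        exact (hch P (ih.pos P hP)).disjoint hRP hRP' hne
      · exact (ih.disjoint hP hP' h).mono ((hch P (ih.pos P hP)).subset R hRP)
          ((hch P' (ih.pos P' hP')).subset R' hRP')

theorem layer_zero : layer ch Q 0 = box Q.1 Q.2 := by simp [layer, gen]

theorem layer_succ (k : ℕ) :
    layer ch Q (k + 1) = ⋃ P ∈ gen ch Q k, ⋃ R ∈ ch P, box R.1 R.2 := by
  simp only [layer, gen, biUnion_iUnion]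

theorem measurableSet_layer (hch : ∀ P, 0 < P.2 → IsSubfamily P (ch P)) (hQ : 0 < Q.2) (k : ℕ) :
    MeasurableSet (layer ch Q k) :=
  MeasurableSet.biUnion (isSubfamily_gen hch hQ k).countable fun _ _ => measurableSet_box _ _

theorem layer_antitone (hch : ∀ P, 0 < P.2 → IsSubfamily P (ch P)) (hQ : 0 < Q.2) :
    Antitone (layer ch Q) := by
  refine antitone_nat_of_succ_le fun k => ?_
  rw [layer_succ]
  refine iUnion₂_mono fun P hP => iUnion₂_subset fun R hR => ?_
  exact (hch P ((isSubfamily_gen hch hQ k).pos P hP)).subset R hR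

/-- Boxes of one generation are disjoint, so the next layer inside `P` can only come from the
children of `P`. -/
theorem box_inter_layer_succ (hch : ∀ P, 0 < P.2 → IsSubfamily P (ch P)) (hQ : 0 < Q.2) {k : ℕ}
    {P : Euc n × ℝ} (hP : P ∈ gen ch Q k) :
    box P.1 P.2 ∩ layer ch Q (k + 1) = ⋃ R ∈ ch P, box R.1 R.2 := by
  have hg := isSubfamily_gen hch hQ k
  refine Subset.antisymm ?_ (subset_inter ?_ ?_)
  · rintro x ⟨hx, hx'⟩
    rw [layer_succ] at hx'
    obtain ⟨P', hP', hx'⟩ := mem_iUnion₂.1 hx'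
    obtain ⟨R, hR, hxR⟩ := mem_iUnion₂.1 hx'
    have hxP' := (hch P' (hg.pos P' hP')).subset R hR hxR
    have : P' = P := by
      by_contra hne
      exact Set.disjoint_left.1 (hg.disjoint hP' hP hne) hxP' hx
    subst this
    exact mem_biUnion hR hxR
  · exact iUnion₂_subset (hch P (hg.pos P hP)).subset
  · rw [layer_succ]
    exact subset_biUnion_of_mem (u := fun P => ⋃ R ∈ ch P, box R.1 R.2) hP

theorem measure_layer_le {μ : Measure (Euc n)} {θ : ℝ≥0∞}
    (hch : ∀ P, 0 < P.2 → IsSubfamily P (ch P)) (hQ : 0 < Q.2)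
    (hμ : ∀ P, 0 < P.2 → μ (⋃ R ∈ ch P, box R.1 R.2) ≤ θ * μ (box P.1 P.2)) (k : ℕ) :
    μ (layer ch Q k) ≤ θ ^ k * μ (box Q.1 Q.2) := by
  induction k with
  | zero => simp [layer_zero]
  | succ k ih =>
    have hg := isSubfamily_gen hch hQ k
    calc μ (layer ch Q (k + 1)) ≤ ∑' P : gen ch Q k, μ (⋃ R ∈ ch P, box R.1 R.2) := by
          rw [layer_succ]
          exact measure_biUnion_le μ hg.countable _
      _ ≤ ∑' P : gen ch Q k, θ * μ (box P.1.1 P.1.2) :=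
          ENNReal.tsum_le_tsum fun P => hμ P.1 (hg.pos P.1 P.2)
      _ = θ * μ (layer ch Q k) := by
          rw [ENNReal.tsum_mul_left, layer, measure_biUnion hg.countable hg.disjoint
            fun P _ => measurableSet_box _ _]
      _ ≤ θ * (θ ^ k * μ (box Q.1 Q.2)) := by gcongr
      _ = _ := by rw [pow_succ]; ring

/-- The layers shrink geometrically. Thus almost every point has a last generation, and it is there
that pointwise bounds are read off. -/
theorem measure_iInter_layer {μ : Measure (Euc n)} {θ : ℝ≥0∞} (hθ : θ < 1)
    (hch : ∀ P, 0 < P.2 → IsSubfamily P (ch P)) (hQ : 0 < Q.2)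
    (hfin : μ (box Q.1 Q.2) ≠ ∞)
    (hμ : ∀ P, 0 < P.2 → μ (⋃ R ∈ ch P, box R.1 R.2) ≤ θ * μ (box P.1 P.2)) :
    μ (⋂ k, layer ch Q k) = 0 := by
  have h1 : Tendsto (fun k => θ ^ k * μ (box Q.1 Q.2)) atTop (𝓝 (0 * μ (box Q.1 Q.2))) :=
    ENNReal.Tendsto.mul_const (ENNReal.tendsto_pow_atTop_nhds_zero_of_lt_one hθ) (Or.inr hfin)
  rw [zero_mul] at h1
  refine le_antisymm (ge_of_tendsto' h1 fun k => ?_) zero_le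
  exact (measure_mono (iInter_subset _ k)).trans (measure_layer_le hch hQ hμ k)

theorem exists_mem_layer_diff {x : Euc n} (hx : x ∈ box Q.1 Q.2) (hx' : x ∉ ⋂ k, layer ch Q k) :
    ∃ k, x ∈ layer ch Q k ∧ x ∉ layer ch Q (k + 1) := by
  by_contra! h
  refine hx' (mem_iInter.2 fun k => ?_)
  induction k with
  | zero => rwa [layer_zero]
  | succ k ih => exact h k ih

end tree

/-! ### Functions of bounded mean oscillation -/

theorem lintegral_sub_average_le (b : Euc n → ℂ) (c : Euc n) {r : ℝ} (hr : 0 < r) :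
    ∫⁻ x in box c r, ‖b x - ⨍ y in box c r, b y‖ₑ ≤ bmoSeminorm b * volume (box c r) := by
  have h : ⨍⁻ x in cube c r, ‖b x - ⨍ y in cube c r, b y ∂volume‖ₑ ∂volume ≤ bmoSeminorm b :=
    le_iSup_of_le c (le_iSup_of_le r (le_iSup_of_le hr le_rfl))
  rw [← Measure.restrict_congr_set (box_ae_eq_cube c r), setLAverage_eq,
    ENNReal.div_le_iff (volume_box_pos c hr).ne' (volume_box_ne_top c r)] at h
  exact h

theorem _root_.MeasureTheory.LocallyIntegrable.integrableOn_box {b : Euc n → ℂ}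
    (hb : LocallyIntegrable b volume) (c : Euc n) (r : ℝ) : IntegrableOn b (box c r) volume :=
  (hb.integrableOn_isCompact (isCompact_cube c r)).mono_set (box_subset_cube c r)

/-- One step of the John–Nirenberg stopping time. -/
theorem exists_oscillation_family {b : Euc n → ℂ} (hb : LocallyIntegrable b volume)
    (hβ : bmoSeminorm b ≠ ∞) (Q : Euc n × ℝ) (hQ : 0 < Q.2) :
    ∃ F : Set (Euc n × ℝ), IsSubfamily Q F ∧
      2 * volume (⋃ P ∈ F, box P.1 P.2) ≤ volume (box Q.1 Q.2) ∧
      (∀ x ∈ box Q.1 Q.2, x ∉ ⋃ P ∈ F, box P.1 P.2 →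
        ‖b x - ⨍ y in box Q.1 Q.2, b y‖ₑ ≤ 2 ^ (n + 4) * bmoSeminorm b) ∧
      ∀ P ∈ F, ‖(⨍ y in box P.1 P.2, b y) - ⨍ y in box Q.1 Q.2, b y‖ₑ ≤
        2 ^ (n + 4) * bmoSeminorm b := by
  set β := bmoSeminorm b
  -- Chebyshev leaves `S` with at most `2 ^ (-(n + 3))` of the volume. One factor `2` is spent on an
  -- open neighbourhood and `2 ^ (n + 1)` by the selection, so the children cover at most half.
  set κ : ℝ≥0∞ := 2 ^ (n + 3)
  have hκ0 : κ ≠ 0 := by positivity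
  have hκt : κ ≠ ∞ := by finiteness
  have hκ2 : κ + 2 ≤ 2 ^ (n + 4) := by
    have : (2 : ℝ≥0∞) ≤ κ := le_self_pow₀ (by norm_num) (by omega)
    calc κ + 2 ≤ κ + κ := by gcongr
      _ = _ := by simp only [κ]; ring
  set V := volume (box Q.1 Q.2)
  have hV0 : V ≠ 0 := (volume_box_pos Q.1 hQ).ne'
  have hVt : V ≠ ∞ := volume_box_ne_top Q.1 Q.2
  set a := ⨍ y in box Q.1 Q.2, b y
  set S : Set (Euc n) := {x ∈ box Q.1 Q.2 | κ * β < ‖b x - a‖ₑ}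
  have hosc := lintegral_sub_average_le b Q.1 hQ
  have hm : AEMeasurable (fun x => ‖b x - a‖ₑ) (volume.restrict (box Q.1 Q.2)) :=
    (hb.aestronglyMeasurable.sub aestronglyMeasurable_const).enorm.restrict
  have hS : κ * volume S ≤ V := by
    rcases eq_or_ne β 0 with h0 | h0
    · have : ∫⁻ x in box Q.1 Q.2, ‖b x - a‖ₑ = 0 := by
        refine le_antisymm (hosc.trans ?_) zero_le
        change β * V ≤ 0
        rw [h0, zero_mul]
      rw [lintegral_eq_zero_iff' hm] at this
      have h2 := (ae_restrict_iff' (measurableSet_box Q.1 Q.2)).1 this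
      have : volume S = 0 := by
        refine measure_mono_null (fun x hx => ?_) (ae_iff.1 h2)
        intro hx'
        have h3 := hx' hx.1
        have h4 := hx.2
        simp only [Pi.zero_apply] at h3
        rw [h3] at h4
        simp at h4
      rw [this, mul_zero]; exact zero_le
    · have h1 := (mul_meas_ge_le_lintegral₀ hm (κ * β)).trans hosc
      have h2 : β * (κ * volume S) ≤ β * V := by
        calc β * (κ * volume S) = κ * β * volume S := by ring
          _ ≤ κ * β * (volume.restrict (box Q.1 Q.2)) {x | κ * β ≤ ‖b x - a‖ₑ} := by
            refine mul_le_mul_right ?_ _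
            rw [Measure.restrict_apply' (measurableSet_box _ _)]
            exact measure_mono fun x hx => ⟨hx.2.le, hx.1⟩
          _ ≤ _ := h1
      exact (ENNReal.mul_le_mul_iff_right h0 hβ).1 h2
  obtain ⟨U, hSU, hU, hUv⟩ := Set.exists_isOpen_lt_of_lt (μ := volume) S (V / 2 ^ (n + 2)) (by
    rw [ENNReal.lt_div_iff_mul_lt (Or.inl (by positivity)) (Or.inl (by finiteness))]
    have h1 : volume S * 2 ^ (n + 2) * 2 < V * 2 := by
      calc volume S * 2 ^ (n + 2) * 2 = κ * volume S := by simp only [κ]; ring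
        _ ≤ V := hS
        _ = V * 1 := (mul_one _).symm
        _ < V * 2 := ENNReal.mul_lt_mul_right hV0 hVt (by norm_num)
    exact lt_of_mul_lt_mul_right' h1)
  rw [ENNReal.lt_div_iff_mul_lt (Or.inl (by positivity)) (Or.inl (by finiteness))] at hUv
  have hUQ : 2 ^ (n + 2) * volume (U ∩ box Q.1 Q.2) ≤ V := by
    calc 2 ^ (n + 2) * volume (U ∩ box Q.1 Q.2) ≤ 2 ^ (n + 2) * volume U := by
          gcongr; exact inter_subset_left
      _ = volume U * 2 ^ (n + 2) := mul_comm _ _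
      _ ≤ V := hUv.le
  have hUQ' : 2 ^ (n + 1) * volume (U ∩ box Q.1 Q.2) ≤ V :=
    le_trans (by gcongr <;> norm_num) hUQ
  obtain ⟨F, hF, hhalf, hcov, hFv⟩ := exists_selection hQ hU hUQ'
  have hoff : ∀ x ∈ box Q.1 Q.2, x ∉ U → ‖b x - a‖ₑ ≤ κ * β := fun x hx hxU => by
    by_contra! h
    exact hxU (hSU ⟨hx, h⟩)
  refine ⟨F, hF, ?_, fun x hx hxF => ?_, fun P hP => ?_⟩
  · calc 2 * volume (⋃ P ∈ F, box P.1 P.2)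
        ≤ 2 * (2 ^ (n + 1) * volume (U ∩ box Q.1 Q.2)) := by gcongr
      _ = 2 ^ (n + 2) * volume (U ∩ box Q.1 Q.2) := by ring
      _ ≤ V := hUQ
  · refine (hoff x hx fun hxU => hxF (hcov ⟨hxU, hx⟩)).trans ?_
    gcongr
    exact le_self_add.trans hκ2
  · have hPpos := hF.pos P hP
    set p := ⨍ y in box P.1 P.2, b y
    have hv0 : volume (box P.1 P.2) ≠ 0 := (volume_box_pos P.1 hPpos).ne'
    have hvt : volume (box P.1 P.2) ≠ ∞ := volume_box_ne_top P.1 P.2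
    -- On `G`, at least half of `P`, the deviation from the parent average is at most `κ * β`.
    -- Averaging over `G` compares the two averages with the constant `κ + 2`.
    set G := box P.1 P.2 \ U
    have hGm : MeasurableSet G := (measurableSet_box _ _).diff hU.measurableSet
    have hGv : volume (box P.1 P.2) ≤ 2 * volume G := by
      have h1 : volume (box P.1 P.2) = volume (box P.1 P.2 ∩ U) + volume G :=
        (measure_inter_add_sdiff _ hU.measurableSet).symm
      have h2 : volume (box P.1 P.2) + volume (box P.1 P.2) ≤
          volume (box P.1 P.2) + 2 * volume G := by
        calc _ = 2 * volume (box P.1 P.2 ∩ U) + 2 * volume G := by rw [← two_mul, h1]; ring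
          _ ≤ _ := by gcongr; exact hhalf P hP
      exact (ENNReal.add_le_add_iff_left hvt).1 h2
    have hG0 : volume G ≠ 0 := fun h0 => hv0 (le_antisymm (by simpa [h0] using hGv) zero_le)
    have hGt : volume G ≠ ∞ := ne_top_of_le_ne_top hvt (measure_mono sdiff_subset)
    have key : volume G * ‖p - a‖ₑ ≤ volume G * ((κ + 2) * β) := by
      calc volume G * ‖p - a‖ₑ = ∫⁻ _ in G, ‖p - a‖ₑ := by simp [mul_comm]
        _ ≤ ∫⁻ x in G, ‖b x - p‖ₑ + κ * β := by
            refine setLIntegral_mono_ae' hGm (ae_of_all _ fun x hx => ?_)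
            have : p - a = -(b x - p) + (b x - a) := by ring
            rw [this]
            refine (enorm_add_le _ _).trans ?_
            rw [enorm_neg]
            gcongr
            exact hoff x (hF.subset P hP hx.1) hx.2
        _ = (∫⁻ x in G, ‖b x - p‖ₑ) + κ * β * volume G := by
            rw [lintegral_add_right _ measurable_const]; simp
        _ ≤ β * volume (box P.1 P.2) + κ * β * volume G := by
            gcongr
            exact (lintegral_mono_set sdiff_subset).trans (lintegral_sub_average_le b P.1 hPpos)
        _ ≤ β * (2 * volume G) + κ * β * volume G := by gcongr
        _ = _ := by ring
    refine ((ENNReal.mul_le_mul_iff_right hG0 hGt).1 key).trans ?_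
    gcongr

theorem tsum_rpow_mul_geometric_ne_top (s : ℝ) {θ : ℝ≥0} (hθ0 : 0 < θ)
    (hθ : θ < 1) : ∑' k : ℕ, ((k : ℝ≥0∞) + 1) ^ s * (θ : ℝ≥0∞) ^ k ≠ ∞ := by
  obtain ⟨N, hN⟩ := exists_nat_ge s
  have h1 : Summable fun k : ℕ => ((k : ℝ≥0) + 1) ^ N * θ ^ k := by
    rw [← NNReal.summable_coe]
    have h2 := summable_pow_mul_geometric_of_norm_lt_one (r := (θ : ℝ)) N (by simpa using hθ)
    have h3 := ((summable_nat_add_iff 1).2 h2).mul_right (θ : ℝ)⁻¹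
    refine h3.congr fun k => ?_
    have : (θ : ℝ) ≠ 0 := by exact_mod_cast hθ0.ne'
    push_cast
    rw [pow_succ]
    field_simp
  refine ne_top_of_le_ne_top (ENNReal.tsum_coe_ne_top_iff_summable.2 h1) ?_
  refine ENNReal.tsum_le_tsum fun k => ?_
  push_cast
  gcongr
  rw [← ENNReal.rpow_natCast]
  exact ENNReal.rpow_le_rpow_of_exponent_le le_add_self hN

/-- The John–Nirenberg inequality, in `L^s` form, with respect to a measure of class `A_∞`. -/
theorem exists_lintegral_oscillation_le {μ : Measure (Euc n)} {θ : ℝ≥0} (hθ0 : 0 < θ)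
    (hθ : θ < 1) (hfin : ∀ c r, μ (box c r) ≠ ∞)
    (hμ : ∀ c r, 0 < r → ∀ E ⊆ box c r, MeasurableSet E → 2 * volume E ≤ volume (box c r) →
      μ E ≤ θ * μ (box c r)) {s : ℝ} (hs : 0 < s) :
    ∃ C : ℝ≥0∞, C ≠ ∞ ∧ ∀ b : Euc n → ℂ, LocallyIntegrable b volume → bmoSeminorm b ≠ ∞ →
      ∀ c r, 0 < r → ∫⁻ x in box c r, ‖b x - ⨍ y in box c r, b y‖ₑ ^ s ∂μ ≤
        C * bmoSeminorm b ^ s * μ (box c r) := by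
  set L : ℝ≥0∞ := 2 ^ (n + 4)
  have hLs : L ^ s ≠ ∞ := ENNReal.rpow_ne_top_of_nonneg hs.le (by finiteness)
  refine ⟨L ^ s * ∑' k : ℕ, ((k : ℝ≥0∞) + 1) ^ s * (θ : ℝ≥0∞) ^ k,
    ENNReal.mul_ne_top hLs (tsum_rpow_mul_geometric_ne_top s hθ0 hθ),
    fun b hb hβ c r hr => ?_⟩
  set β := bmoSeminorm b
  choose! ch hch hch2 hchoff hchavg using exists_oscillation_family hb hβ
  set Q : Euc n × ℝ := (c, r)
  have hQ : 0 < Q.2 := hr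
  -- The `A_∞` hypothesis is needed only for sets filling at most half of a box, since that is all
  -- the children do.
  have hμch : ∀ P, 0 < P.2 → μ (⋃ R ∈ ch P, box R.1 R.2) ≤ θ * μ (box P.1 P.2) := fun P hP =>
    hμ P.1 P.2 hP _ (iUnion₂_subset (hch P hP).subset)
      (MeasurableSet.biUnion (hch P hP).countable fun _ _ => measurableSet_box _ _) (hch2 P hP)
  have hθ' : (θ : ℝ≥0∞) < 1 := by exact_mod_cast hθ
  have h0 := measure_iInter_layer hθ' hch hQ (hfin _ _) hμch
  set a := ⨍ y in box c r, b y
  have havg : ∀ k, ∀ P ∈ gen ch Q k, ‖(⨍ y in box P.1 P.2, b y) - a‖ₑ ≤ k * (L * β) := by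
    intro k
    induction k with
    | zero =>
      intro P hP
      have : P = Q := hP
      subst this
      simp [a, Q]
    | succ k ih =>
      intro R hR
      obtain ⟨P, hP, hRP⟩ := mem_iUnion₂.1 hR
      have e : (⨍ y in box R.1 R.2, b y) - a = ((⨍ y in box R.1 R.2, b y) -
        ⨍ y in box P.1 P.2, b y) + ((⨍ y in box P.1 P.2, b y) - a) := by ring
      rw [e]
      refine (enorm_add_le _ _).trans ?_
      refine (add_le_add (hchavg P ((isSubfamily_gen hch hQ k).pos P hP) R hRP) (ih P hP)).trans ?_
      push_cast
      exact le_of_eq (by simp only [L, β]; ring)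
  -- A point that stops at generation `k` sees `k` jumps between consecutive averages and one final
  -- deviation, each at most `L * β`.
  have hpt : ∀ k, ∀ x ∈ layer ch Q k \ layer ch Q (k + 1),
      ‖b x - a‖ₑ ^ s ≤ ((k : ℝ≥0∞) + 1) ^ s * (L ^ s * β ^ s) := by
    rintro k x ⟨hx, hx'⟩
    obtain ⟨P, hP, hxP⟩ := mem_iUnion₂.1 hx
    have hPpos := (isSubfamily_gen hch hQ k).pos P hP
    have hxc : x ∉ ⋃ R ∈ ch P, box R.1 R.2 := by
      rw [← box_inter_layer_succ hch hQ hP]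
      exact fun h => hx' h.2
    rw [← ENNReal.mul_rpow_of_nonneg _ _ hs.le, ← ENNReal.mul_rpow_of_nonneg _ _ hs.le]
    refine ENNReal.rpow_le_rpow ?_ hs.le
    have e : b x - a = (b x - ⨍ y in box P.1 P.2, b y) + ((⨍ y in box P.1 P.2, b y) - a) := by ring
    rw [e]
    refine (enorm_add_le _ _).trans ?_
    refine (add_le_add (hchoff P hPpos x hxP hxc) (havg k P hP)).trans ?_
    exact le_of_eq (by simp only [L, β]; ring)
  have hcov : box c r ⊆ (⋃ k, layer ch Q k \ layer ch Q (k + 1)) ∪ ⋂ k, layer ch Q k := by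
    intro x hx
    by_cases hx' : x ∈ ⋂ k, layer ch Q k
    · exact Or.inr hx'
    · obtain ⟨k, hk⟩ := exists_mem_layer_diff hx hx'
      exact Or.inl (mem_iUnion.2 ⟨k, hk⟩)
  calc ∫⁻ x in box c r, ‖b x - a‖ₑ ^ s ∂μ
      ≤ ∫⁻ x in (⋃ k, layer ch Q k \ layer ch Q (k + 1)) ∪ ⋂ k, layer ch Q k,
        ‖b x - a‖ₑ ^ s ∂μ := lintegral_mono_set hcov
    _ ≤ ∫⁻ x in ⋃ k, layer ch Q k \ layer ch Q (k + 1), ‖b x - a‖ₑ ^ s ∂μ := by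
        refine (lintegral_union_le _ _ _).trans ?_
        rw [Measure.restrict_eq_zero.2 h0]; simp
    _ ≤ ∑' k, ∫⁻ x in layer ch Q k \ layer ch Q (k + 1), ‖b x - a‖ₑ ^ s ∂μ :=
        lintegral_iUnion_le _ _
    _ ≤ ∑' k : ℕ, L ^ s * β ^ s * μ (box c r) * (((k : ℝ≥0∞) + 1) ^ s * (θ : ℝ≥0∞) ^ k) := by
        refine ENNReal.tsum_le_tsum fun k => ?_
        calc ∫⁻ x in layer ch Q k \ layer ch Q (k + 1), ‖b x - a‖ₑ ^ s ∂μ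
            ≤ ∫⁻ _ in layer ch Q k \ layer ch Q (k + 1),
              ((k : ℝ≥0∞) + 1) ^ s * (L ^ s * β ^ s) ∂μ :=
              setLIntegral_mono_ae' ((measurableSet_layer hch hQ k).diff
                (measurableSet_layer hch hQ (k + 1))) (ae_of_all _ fun x hx => hpt k x hx)
          _ = ((k : ℝ≥0∞) + 1) ^ s * (L ^ s * β ^ s) *
              μ (layer ch Q k \ layer ch Q (k + 1)) := by simp
          _ ≤ ((k : ℝ≥0∞) + 1) ^ s * (L ^ s * β ^ s) * ((θ : ℝ≥0∞) ^ k * μ (box c r)) := by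
              gcongr
              exact (measure_mono sdiff_subset).trans (measure_layer_le hch hQ hμch k)
          _ = _ := by ring
    _ = _ := by rw [ENNReal.tsum_mul_left]; ring

end CZCommutator

namespace CZCommutator

open Set Filter Topology
open scoped NNReal

set_option linter.unusedSectionVars false

variable {n : ℕ} {q : ℝ≥0∞} [Fact (1 ≤ q)]

/-! ### Sparse domination of commutators -/

/-- The commutator of multiplication by `b` and `T`, acting on functions. -/
noncomputable def comm (T : LqOp n q) (b f : Euc n → ℂ) (x : Euc n) : ℂ :=
  b x * app T f x - app T (fun y => b y * f y) x

/-- A constant symbol commutes with `T`. Each box can thus subtract its own constant, and this is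
where the oscillation of `b` enters. -/
theorem comm_sub_const (T : LqOp n q) {b f : Euc n → ℂ} (hf : MemLp f q volume)
    (hbf : MemLp (fun x => b x * f x) q volume) (a : ℂ) :
    comm T b f =ᵐ[volume] fun x => (b x - a) * app T f x -
      app T (fun y => (b y - a) * f y) x := by
  have e : (fun y => (b y - a) * f y) = fun y => b y * f y - a * f y := by ext y; ring
  filter_upwards [app_sub T hbf (hf.const_mul a), app_const_mul T hf a] with x h1 h2
  rw [e, h1, h2, comm]
  ring

theorem comm_add (T : LqOp n q) {b f g : Euc n → ℂ} (hf : MemLp f q volume)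
    (hbf : MemLp (fun x => b x * f x) q volume) (hg : MemLp g q volume)
    (hbg : MemLp (fun x => b x * g x) q volume) :
    comm T b (fun x => f x + g x) =ᵐ[volume] fun x => comm T b f x + comm T b g x := by
  have e : (fun y => b y * (f y + g y)) = fun y => b y * f y + b y * g y := by ext y; ring
  filter_upwards [app_add T hf hg, app_add T hbf hbg] with x h1 h2
  simp only [comm]
  rw [e, h1, h2]
  ring

theorem comm_congr (T : LqOp n q) {b f g : Euc n → ℂ} (h : f =ᵐ[volume] g) :
    comm T b f = comm T b g := by
  ext x
  have : (fun y => b y * f y) =ᵐ[volume] fun y => b y * g y := by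
    filter_upwards [h] with y hy
    rw [hy]
  rw [comm, comm, app_congr T h, app_congr T this]

theorem aestronglyMeasurable_comm (T : LqOp n q) {b : Euc n → ℂ}
    (hb : AEStronglyMeasurable b volume) (f : Euc n → ℂ) :
    AEStronglyMeasurable (comm T b f) volume :=
  (hb.mul (aestronglyMeasurable_app T f)).sub (aestronglyMeasurable_app T _)

theorem le_of_box_subset_box {c c' : Euc n} {r r' : ℝ} (hr' : 0 < r')
    (h : box c' r' ⊆ box c r) (i : Fin n) : c i - r ≤ c' i - r' ∧ c' i + r' ≤ c i + r := by
  constructor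
  · have h1 : corner c' r' ∈ box c' r' := fun j => ⟨le_rfl, by simp only [corner]; linarith⟩
    exact (h h1 i).1
  · by_contra! hlt
    -- The `i`-th coordinate is at or beyond the right end of the outer box but still inside the
    -- inner one. The maximum with `c' i - r'` covers an inner box lying entirely to the right.
    set z : Euc n := WithLp.toLp 2 fun j => if j = i then max (c' j - r') (c j + r) else c' j
    have hz : z ∈ box c' r' := by
      intro j
      by_cases hj : j = i
      · subst hj
        simp only [z, if_true]
        exact ⟨le_max_left _ _, max_lt (by linarith) hlt⟩
      · simp only [z, if_neg hj]
        constructor <;> linarith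
    have h1 := (h hz i).2
    simp only [z, if_true] at h1
    exact absurd (le_max_right (c' i - r') (c i + r)) (not_le.2 h1)

theorem box_dilate_subset {c c' : Euc n} {r r' t : ℝ} (hr' : 0 < r') (ht : 1 ≤ t)
    (h : box c' r' ⊆ box c r) : box c' (t * r') ⊆ box c (t * r) := by
  intro x hx i
  have h1 := le_of_box_subset_box hr' h i
  have h2 := hx i
  have : 0 ≤ r - r' := by linarith
  constructor <;> nlinarith [mul_nonneg (sub_nonneg.2 ht) this]

/-- The average of `‖g‖` over the dilated box. -/
noncomputable def dilAvg (g : Euc n → ℂ) (P : Euc n × ℝ) : ℝ≥0∞ :=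
  (∫⁻ y in box P.1 (5 * n * P.2), ‖g y‖ₑ) / volume (box P.1 (5 * n * P.2))

/-- The local terms in the sparse bound. -/
noncomputable def sparseTerm (b f : Euc n → ℂ) (a : Euc n × ℝ → ℂ) (P : Euc n × ℝ) (x : Euc n) :
    ℝ≥0∞ :=
  ‖b x - a P‖ₑ * dilAvg f P + dilAvg (fun y => (b y - a P) * f y) P

theorem lintegral_enorm_indicator_box (g : Euc n → ℂ) (c : Euc n) (r : ℝ) :
    ∫⁻ y, ‖(box c r).indicator g y‖ₑ = ∫⁻ y in box c r, ‖g y‖ₑ := by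
  rw [← lintegral_indicator (measurableSet_box c r)]
  exact lintegral_congr fun y => enorm_indicator_eq_indicator_enorm _ _

/-- The selected subboxes of one box in the sparse domination of the commutator. -/
theorem IsCZPair.exists_sparse_family [NeZero n] {T : LqOp n q} {K : Euc n → Euc n → ℂ} {C : ℝ}
    (hT : IsCZPair T K C) (hqtop : q ≠ ∞) :
    ∃ M : ℝ≥0∞, M ≠ ∞ ∧ ∀ b f : Euc n → ℂ, MemLp f q volume →
      MemLp (fun x => b x * f x) q volume → ∀ (a : Euc n × ℝ → ℂ) (P : Euc n × ℝ), 0 < P.2 →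
      ∃ F : Set (Euc n × ℝ), IsSubfamily P F ∧
        2 * volume (⋃ R ∈ F, box R.1 R.2) ≤ volume (box P.1 P.2) ∧
        (∀ᵐ x, x ∈ box P.1 P.2 → x ∉ ⋃ R ∈ F, box R.1 R.2 →
          ‖comm T b ((box P.1 (5 * n * P.2)).indicator f) x‖ₑ ≤ M * sparseTerm b f a P x) ∧
        ∀ R ∈ F, ∀ᵐ x, x ∈ box R.1 R.2 →
          ‖comm T b ((box P.1 (5 * n * P.2)).indicator f) x -
            comm T b ((box R.1 (5 * n * R.2)).indicator f) x‖ₑ ≤ M * sparseTerm b f a P x := by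
  obtain ⟨M, hM, hset⟩ := hT.exists_stopping_set hqtop
  refine ⟨M, hM, fun b f hf hbf a P hP => ?_⟩
  set c := P.1
  set r := P.2
  have hn : (1 : ℝ) ≤ n := by exact_mod_cast NeZero.one_le
  have hm : ∀ r, MeasurableSet (box c r) := fun r => measurableSet_box c r
  set f₂ : Euc n → ℂ := fun y => (b y - a P) * f y
  have hf₂ : MemLp f₂ q volume := by
    have : f₂ = fun y => b y * f y - a P * f y := by ext y; simp only [f₂]; ring
    rw [this]
    exact hbf.sub (hf.const_mul _)
  set B := box c (5 * n * r)
  set h₁ := B.indicator f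
  set h₂ := B.indicator f₂
  have hbind : ∀ (S : Set (Euc n)) (g : Euc n → ℂ), (fun x => b x * S.indicator g x) =
      S.indicator fun x => b x * g x := fun S g => by
    ext x; by_cases hx : x ∈ S <;> simp [hx]
  have hbind₂ : ∀ (S : Set (Euc n)) (g : Euc n → ℂ), (fun x => (b x - a P) * S.indicator g x) =
      S.indicator fun x => (b x - a P) * g x := fun S g => by
    ext x; by_cases hx : x ∈ S <;> simp [hx]
  have hh₁ : MemLp h₁ q volume := hf.indicator (hm _)
  have hbh₁ : MemLp (fun x => b x * h₁ x) q volume := by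
    simp only [h₁, hbind]; exact hbf.indicator (hm _)
  have hh₂ : MemLp h₂ q volume := hf₂.indicator (hm _)
  -- Two stopping sets, for `f` and for `(b - a P) * f`, both cut to the dilate of `P`; the exponent
  -- `n + 3` leaves room for their union.
  obtain ⟨U₁, hU₁, hv₁, hA₁, hB₁⟩ := hset c r hP h₁ hh₁ fun y hy => indicator_of_notMem hy f
  obtain ⟨U₂, hU₂, hv₂, hA₂, hB₂⟩ := hset c r hP h₂ hh₂ fun y hy => indicator_of_notMem hy f₂
  have hav₁ : (∫⁻ y, ‖h₁ y‖ₑ) / volume (box c (5 * n * r)) = dilAvg f P := by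
    rw [dilAvg, ← lintegral_enorm_indicator_box]
  have hav₂ : (∫⁻ y, ‖h₂ y‖ₑ) / volume (box c (5 * n * r)) = dilAvg f₂ P := by
    rw [dilAvg, ← lintegral_enorm_indicator_box]
  rw [hav₁] at hA₁ hB₁
  rw [hav₂] at hA₂ hB₂
  set V := volume (box c r)
  have hV : 2 ^ (n + 2) * volume ((U₁ ∪ U₂) ∩ box c r) ≤ V := by
    have h1 : 2 * (2 ^ (n + 2) * volume ((U₁ ∪ U₂) ∩ box c r)) ≤ 2 * V := by
      calc 2 * (2 ^ (n + 2) * volume ((U₁ ∪ U₂) ∩ box c r))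
          = 2 ^ (n + 3) * volume ((U₁ ∪ U₂) ∩ box c r) := by ring
        _ ≤ 2 ^ (n + 3) * (volume (U₁ ∩ box c r) + volume (U₂ ∩ box c r)) := by
            gcongr; rw [union_inter_distrib_right]; exact measure_union_le _ _
        _ ≤ V + V := by rw [mul_add]; exact add_le_add hv₁ hv₂
        _ = _ := (two_mul V).symm
    exact (ENNReal.mul_le_mul_iff_right (by norm_num) (by norm_num)).1 h1
  obtain ⟨F, hF, hhalf, hcov, hFv⟩ := exists_selection hP (hU₁.union hU₂)
    (le_trans (by gcongr <;> norm_num) hV)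
  have hbound : ∀ x, ‖b x - a P‖ₑ * (M * dilAvg f P) + M * dilAvg f₂ P =
      M * sparseTerm b f a P x := fun x => by simp only [sparseTerm, f₂]; ring
  refine ⟨F, hF, ?_, ?_, ?_⟩
  · calc 2 * volume (⋃ R ∈ F, box R.1 R.2)
        ≤ 2 * (2 ^ (n + 1) * volume ((U₁ ∪ U₂) ∩ box c r)) := by gcongr
      _ = 2 ^ (n + 2) * volume ((U₁ ∪ U₂) ∩ box c r) := by ring
      _ ≤ V := hV
  · filter_upwards [comm_sub_const T hh₁ hbh₁ (a P), hA₁, hA₂] with x hx h1 h2 hxP hxF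
    have hxU : x ∉ U₁ ∪ U₂ := fun h => hxF (hcov ⟨h, hxP⟩)
    rw [mem_union, not_or] at hxU
    rw [hx, hbind₂, ← hbound]
    refine enorm_sub_le.trans ?_
    rw [enorm_mul]
    exact add_le_add (mul_le_mul_right (h1 hxP hxU.1) _) (h2 hxP hxU.2)
  · intro R hR
    have hRpos := hF.pos R hR
    have hRsub := hF.subset R hR
    have hhalf' := hhalf R hR
    set S := box R.1 (5 * n * R.2)
    have hSm : MeasurableSet S := measurableSet_box _ _
    have hSB : S ⊆ B := box_dilate_subset hRpos (by linarith) hRsub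
    have hh₁' : MemLp (Sᶜ.indicator h₁) q volume := hh₁.indicator hSm.compl
    have hbh₁' : MemLp (fun x => b x * Sᶜ.indicator h₁ x) q volume := by
      rw [hbind]; exact hbh₁.indicator hSm.compl
    have hg : MemLp (S.indicator f) q volume := hf.indicator hSm
    have hbg : MemLp (fun x => b x * S.indicator f x) q volume := by
      rw [hbind]; exact hbf.indicator hSm
    -- The dilate of `R` lies in that of `P`, so the difference of the two localised commutators is
    -- the commutator of the tail `Sᶜ.indicator h₁`, which the stopping sets control on `R`.
    have e : h₁ = fun x => S.indicator f x + Sᶜ.indicator h₁ x := by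
      ext x
      by_cases hx : x ∈ S
      · simp [h₁, hx, hSB hx]
      · simp [hx]
    have hadd := comm_add T hg hbg hh₁' hbh₁'
    rw [← e] at hadd
    have e₂ : (Sᶜ.indicator fun x => (b x - a P) * h₁ x) = Sᶜ.indicator h₂ := by
      congr 1
      simp only [h₁, hbind₂, h₂, f₂]
    filter_upwards [hadd, comm_sub_const T hh₁' hbh₁' (a P),
      hB₁ R.1 R.2 hRpos hRsub (le_trans (by gcongr; exact subset_union_left) hhalf'),
      hB₂ R.1 R.2 hRpos hRsub (le_trans (by gcongr; exact subset_union_right) hhalf')]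
      with x hx hx' h1 h2 hxR
    rw [hx, add_sub_cancel_left, hx', hbind₂, e₂, ← hbound]
    refine enorm_sub_le.trans ?_
    rw [enorm_mul]
    exact add_le_add (mul_le_mul_right (h1 hxR) _) (h2 hxR)

/-- Sparse domination of the commutator. -/
theorem IsCZPair.exists_sparse_domination [NeZero n] {T : LqOp n q} {K : Euc n → Euc n → ℂ}
    {C : ℝ} (hT : IsCZPair T K C) (hqtop : q ≠ ∞) :
    ∃ M : ℝ≥0∞, M ≠ ∞ ∧ ∀ b f : Euc n → ℂ, MemLp f q volume →
      MemLp (fun x => b x * f x) q volume → ∀ (a : Euc n × ℝ → ℂ) (Q : Euc n × ℝ), 0 < Q.2 →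
      (∀ y, y ∉ box Q.1 Q.2 → f y = 0) →
      ∃ ch : Euc n × ℝ → Set (Euc n × ℝ), (∀ P, 0 < P.2 → IsSubfamily P (ch P) ∧
        2 * volume (⋃ R ∈ ch P, box R.1 R.2) ≤ volume (box P.1 P.2)) ∧
        ∀ᵐ x, x ∈ box Q.1 Q.2 → ‖comm T b f x‖ₑ ≤ M * ∑' k, ∑' P : gen ch Q k,
          (box P.1.1 P.1.2).indicator (sparseTerm b f a P) x := by
  obtain ⟨M, hM, hfam⟩ := hT.exists_sparse_family hqtop
  refine ⟨M, hM, fun b f hf hbf a Q hQ hfQ => ?_⟩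
  choose! ch hch hch2 hA hB using hfam b f hf hbf a
  refine ⟨ch, fun P hP => ⟨hch P hP, hch2 P hP⟩, ?_⟩
  set A : ℕ → Euc n → ℝ≥0∞ := fun k x => ∑' P : gen ch Q k,
    (box P.1.1 P.1.2).indicator (sparseTerm b f a P) x
  have hgen := isSubfamily_gen hch hQ
  have hle : ∀ k, ∀ P ∈ gen ch Q k, ∀ x ∈ box P.1 P.2, sparseTerm b f a P x ≤ A k x := by
    intro k P hP x hx
    have := ENNReal.le_tsum (f := fun P : gen ch Q k =>
      (box P.1.1 P.1.2).indicator (sparseTerm b f a P) x) ⟨P, hP⟩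
    simpa only [indicator_of_mem hx] using this
  have hQind : (box Q.1 (5 * n * Q.2)).indicator f = f := by
    refine indicator_eq_self.2 fun y hy => ?_
    by_contra hy'
    exact hy (hfQ y fun h => hy' (box_subset_dilate Q.1 hQ h))
  -- Telescoping along the ancestors of `P`: each generation contributes the error of passing from
  -- the dilate of a box to that of a child.
  have hind : ∀ k, ∀ P ∈ gen ch Q k, ∀ᵐ x, x ∈ box P.1 P.2 →
      ‖comm T b f x - comm T b ((box P.1 (5 * n * P.2)).indicator f) x‖ₑ ≤
        M * ∑ j ∈ Finset.range k, A j x := by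
    intro k
    induction k with
    | zero =>
      intro P hP
      have : P = Q := hP
      subst this
      rw [hQind]
      exact ae_of_all _ fun x _ => by simp
    | succ k ih =>
      intro R hR
      obtain ⟨P, hP, hRP⟩ := mem_iUnion₂.1 hR
      have hPpos := (hgen k).pos P hP
      filter_upwards [ih P hP, hB P hPpos R hRP] with x h1 h2 hx
      have hxP := (hch P hPpos).subset R hRP hx
      rw [Finset.sum_range_succ, mul_add, ← sub_add_sub_cancel (comm T b f x)
        (comm T b ((box P.1 (5 * n * P.2)).indicator f) x)]
      refine (enorm_add_le _ _).trans (add_le_add (h1 hxP) ((h2 hx).trans ?_))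
      exact mul_le_mul_right (hle k P hP x hxP) _
  have h0 : volume (⋂ k, layer ch Q k) = 0 := by
    refine measure_iInter_layer (θ := 2⁻¹) (by norm_num) hch hQ (volume_box_ne_top _ _)
      fun P hP => ?_
    have := mul_le_mul_right (hch2 P hP) (2⁻¹ : ℝ≥0∞)
    rwa [← mul_assoc, ENNReal.inv_mul_cancel (by norm_num) (by norm_num), one_mul] at this
  have hall : ∀ᵐ x, ∀ k, ∀ P ∈ gen ch Q k, (x ∈ box P.1 P.2 →
      ‖comm T b f x - comm T b ((box P.1 (5 * n * P.2)).indicator f) x‖ₑ ≤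
        M * ∑ j ∈ Finset.range k, A j x) ∧ (x ∈ box P.1 P.2 → x ∉ ⋃ R ∈ ch P, box R.1 R.2 →
          ‖comm T b ((box P.1 (5 * n * P.2)).indicator f) x‖ₑ ≤ M * sparseTerm b f a P x) := by
    rw [ae_all_iff]
    intro k
    rw [ae_ball_iff (hgen k).countable]
    exact fun P hP => (hind k P hP).and (hA P ((hgen k).pos P hP))
  filter_upwards [hall, measure_eq_zero_iff_ae_notMem.1 h0] with x hx hx0 hxQ
  -- At the last generation containing `x` the localised commutator itself obeys the sparse bound,
  -- which ends the telescoping.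
  obtain ⟨k, hk, hk'⟩ := exists_mem_layer_diff hxQ hx0
  obtain ⟨P, hP, hxP⟩ := mem_iUnion₂.1 hk
  have hxc : x ∉ ⋃ R ∈ ch P, box R.1 R.2 := by
    rw [← box_inter_layer_succ hch hQ hP]
    exact fun h => hk' h.2
  obtain ⟨h1, h2⟩ := hx k P hP
  calc ‖comm T b f x‖ₑ = ‖(comm T b f x - comm T b ((box P.1 (5 * n * P.2)).indicator f) x) +
        comm T b ((box P.1 (5 * n * P.2)).indicator f) x‖ₑ := by rw [sub_add_cancel]
    _ ≤ M * ∑ j ∈ Finset.range k, A j x + M * A k x :=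
        (enorm_add_le _ _).trans (add_le_add (h1 hxP)
          ((h2 hxP hxc).trans (mul_le_mul_right (hle k P hP x hxP) _)))
    _ = M * ∑ j ∈ Finset.range (k + 1), A j x := by rw [Finset.sum_range_succ, mul_add]
    _ ≤ M * ∑' k, A k x := by gcongr; exact ENNReal.sum_le_tsum _

end CZCommutator

namespace CZCommutator

open Set Filter Topology
open scoped NNReal

set_option linter.unusedSectionVars false

variable {n : ℕ}

/-! ### Pairs of dual weights -/

/-- The measure with a given finite density. -/
noncomputable def wm (w : Euc n → ℝ≥0) : Measure (Euc n) := volume.withDensity fun x => w x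

/-- A pair of dual `A_p` weights: `w` and `v = w ^ (-p' / p)`. -/
structure WeightPair (p p' : ℝ) (w v : Euc n → ℝ≥0) (A : ℝ≥0∞) : Prop where
  conj : p.HolderConjugate p'
  measurable_left : Measurable w
  measurable_right : Measurable v
  mul_eq_one : ∀ x, w x ^ (1 / p) * v x ^ (1 / p') = 1
  ne_top : A ≠ ∞
  fin_left : ∀ c r, wm w (box c r) ≠ ∞
  fin_right : ∀ c r, wm v (box c r) ≠ ∞
  upper : ∀ c r, 0 < r →
    wm w (box c r) ^ (1 / p) * wm v (box c r) ^ (1 / p') ≤ A * volume (box c r)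

theorem wm_absolutelyContinuous (w : Euc n → ℝ≥0) : wm w ≪ volume :=
  withDensity_absolutelyContinuous _ _

theorem lintegral_wm {w : Euc n → ℝ≥0} (hw : Measurable w) {f : Euc n → ℝ≥0∞}
    (hf : AEMeasurable f volume) : ∫⁻ x, f x ∂(wm w) = ∫⁻ x, w x * f x := by
  rw [wm, lintegral_withDensity_eq_lintegral_mul₀ (by fun_prop) hf]
  rfl

namespace WeightPair

variable {p p' : ℝ} {w v : Euc n → ℝ≥0} {A : ℝ≥0∞}

theorem symm (h : WeightPair p p' w v A) : WeightPair p' p v w A where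
  conj := h.conj.symm
  measurable_left := h.measurable_right
  measurable_right := h.measurable_left
  mul_eq_one x := by rw [mul_comm]; exact h.mul_eq_one x
  ne_top := h.ne_top
  fin_left := h.fin_right
  fin_right := h.fin_left
  upper c r hr := by rw [mul_comm]; exact h.upper c r hr

theorem left_ne_zero (h : WeightPair p p' w v A) (x : Euc n) : w x ≠ 0 := fun h0 => by
  have := h.mul_eq_one x
  rw [h0, NNReal.zero_rpow (by have := h.conj.pos; positivity), zero_mul] at this
  exact zero_ne_one this

theorem right_ne_zero (h : WeightPair p p' w v A) (x : Euc n) : v x ≠ 0 := h.symm.left_ne_zero x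

theorem volume_absolutelyContinuous (h : WeightPair p p' w v A) : volume ≪ wm w :=
  withDensity_absolutelyContinuous' (by have := h.measurable_left; fun_prop)
    (ae_of_all _ fun x => by simpa using h.left_ne_zero x)

/-- Raise `w ^ (1 / p) = v ^ (-1 / p')` to the power `p` and use `p / p' = p - 1`. -/
theorem left_eq (h : WeightPair p p' w v A) (x : Euc n) : w x = v x ^ (1 - p) := by
  have hp := h.conj.pos
  have h1 : w x ^ (1 / p) = (v x ^ (1 / p'))⁻¹ := eq_inv_of_mul_eq_one_left (h.mul_eq_one x)
  have h2 := congrArg (fun y : ℝ≥0 => y ^ p) h1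
  beta_reduce at h2
  rw [← NNReal.rpow_mul, one_div_mul_cancel hp.ne', NNReal.rpow_one, NNReal.inv_rpow,
    ← NNReal.rpow_mul, ← NNReal.rpow_neg] at h2
  rw [h2]
  congr 1
  have := h.conj.inv_add_inv_eq_one
  have h3 : 1 / p' = 1 - 1 / p := by rw [one_div, one_div]; linarith
  rw [h3]
  field_simp
  ring

/-- Hölder's inequality for dual weights. -/
theorem lintegral_mul_le (h : WeightPair p p' w v A) {f g : Euc n → ℝ≥0∞}
    (hf : AEMeasurable f volume) (hg : AEMeasurable g volume) :
    ∫⁻ x, f x * g x ≤ (∫⁻ x, f x ^ p ∂(wm w)) ^ (1 / p) *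
      (∫⁻ x, g x ^ p' ∂(wm v)) ^ (1 / p') := by
  have hp := h.conj.pos
  have hp' := h.conj.symm.pos
  have hw := h.measurable_left
  have hv := h.measurable_right
  have key := ENNReal.lintegral_mul_le_Lp_mul_Lq volume h.conj
    (f := fun x => ((w x ^ (1 / p) : ℝ≥0) : ℝ≥0∞) * f x)
    (g := fun x => ((v x ^ (1 / p') : ℝ≥0) : ℝ≥0∞) * g x) (by fun_prop) (by fun_prop)
  have e1 : ∀ x, (((w x ^ (1 / p) : ℝ≥0) : ℝ≥0∞) * f x) ^ p = w x * f x ^ p := fun x => by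
    rw [ENNReal.mul_rpow_of_nonneg _ _ hp.le, ← ENNReal.coe_rpow_of_nonneg _ hp.le,
      ← NNReal.rpow_mul, one_div_mul_cancel hp.ne', NNReal.rpow_one]
  have e2 : ∀ x, (((v x ^ (1 / p') : ℝ≥0) : ℝ≥0∞) * g x) ^ p' = v x * g x ^ p' := fun x => by
    rw [ENNReal.mul_rpow_of_nonneg _ _ hp'.le, ← ENNReal.coe_rpow_of_nonneg _ hp'.le,
      ← NNReal.rpow_mul, one_div_mul_cancel hp'.ne', NNReal.rpow_one]
  rw [lintegral_wm hw (by fun_prop), lintegral_wm hv (by fun_prop)]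
  simp only [e1, e2] at key
  refine le_trans (le_of_eq (lintegral_congr fun x => ?_)) key
  simp only [Pi.mul_apply]
  have := h.mul_eq_one x
  calc f x * g x = ((w x ^ (1 / p) * v x ^ (1 / p') : ℝ≥0) : ℝ≥0∞) * (f x * g x) := by
        rw [this]; simp
    _ = _ := by rw [ENNReal.coe_mul]; ring

theorem volume_le (h : WeightPair p p' w v A) {S : Set (Euc n)} (hS : MeasurableSet S) :
    volume S ≤ wm w S ^ (1 / p) * wm v S ^ (1 / p') := by
  have hp := h.conj.pos
  have hp' := h.conj.symm.pos
  have key := h.lintegral_mul_le (f := S.indicator 1) (g := S.indicator 1)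
    (measurable_one.indicator hS).aemeasurable (measurable_one.indicator hS).aemeasurable
  have e1 : ∀ {t : ℝ}, 0 < t → ∀ x, (S.indicator (1 : Euc n → ℝ≥0∞) x) ^ t = S.indicator 1 x :=
    fun ht x => by
    by_cases hx : x ∈ S <;> simp [hx, ht]
  have e2 : ∀ x, S.indicator (1 : Euc n → ℝ≥0∞) x * S.indicator 1 x = S.indicator 1 x := fun x => by
    by_cases hx : x ∈ S <;> simp [hx]
  simp only [e1 hp, e1 hp', e2, lintegral_indicator_one hS] at key
  exact key

/-! ### Doubling and the `A_∞` property. -/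

/-- Subsets of a box with large Lebesgue measure have large weight. -/
theorem measure_box_le (h : WeightPair p p' w v A) {c : Euc n} {r : ℝ} (hr : 0 < r)
    {S : Set (Euc n)} (hS : MeasurableSet S) (hSb : S ⊆ box c r) {t : ℝ≥0∞}
    (ht : volume (box c r) ≤ t * volume S) : wm w (box c r) ≤ (A * t) ^ p * wm w S := by
  have hp := h.conj.pos
  have hp' := h.conj.symm.pos
  have hV0 : volume S ≠ 0 := fun h0 => by
    rw [h0, mul_zero] at ht
    exact absurd (volume_box_pos c hr) (not_lt.2 ht)
  have hVt : volume S ≠ ∞ := ne_top_of_le_ne_top (volume_box_ne_top c r) (measure_mono hSb)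
  have h1 : volume S * wm w (box c r) ^ (1 / p) ≤ volume S * (A * t * wm w S ^ (1 / p)) := by
    calc volume S * wm w (box c r) ^ (1 / p)
        ≤ (wm w S ^ (1 / p) * wm v (box c r) ^ (1 / p')) * wm w (box c r) ^ (1 / p) := by
          gcongr
          refine (h.volume_le hS).trans ?_
          gcongr
      _ = wm w S ^ (1 / p) * (wm w (box c r) ^ (1 / p) * wm v (box c r) ^ (1 / p')) := by ring
      _ ≤ wm w S ^ (1 / p) * (A * (t * volume S)) :=
          mul_le_mul_right ((h.upper c r hr).trans (mul_le_mul_right ht A)) _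
      _ = _ := by ring
  have h2 := ENNReal.rpow_le_rpow ((ENNReal.mul_le_mul_iff_right hV0 hVt).1 h1) hp.le
  rwa [ENNReal.mul_rpow_of_nonneg _ _ hp.le, ← ENNReal.rpow_mul, ← ENNReal.rpow_mul,
    one_div_mul_cancel hp.ne', ENNReal.rpow_one, ENNReal.rpow_one] at h2

theorem measure_box_ne_zero (h : WeightPair p p' w v A) (c : Euc n) {r : ℝ} (hr : 0 < r) :
    wm w (box c r) ≠ 0 := fun h0 =>
  (volume_box_pos c hr).ne' (h.volume_absolutelyContinuous h0)

theorem exists_doubling (h : WeightPair p p' w v A) :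
    ∃ D : ℝ≥0∞, D ≠ ∞ ∧ ∀ c r, 0 < r → wm w (box c (5 * r)) ≤ D * wm w (box c r) := by
  have hA := h.ne_top
  refine ⟨(A * 5 ^ n) ^ p, ENNReal.rpow_ne_top_of_nonneg h.conj.nonneg (by finiteness),
    fun c r hr => ?_⟩
  refine h.measure_box_le (by positivity) (measurableSet_box c r) (box_mono c (by linarith)) ?_
  rw [volume_box_mul c c (by norm_num), ENNReal.ofReal_ofNat]

/-- `measure_box_le` is applied to the complement of `E`, which has at least half of the volume and
therefore a definite share of the weight. -/
theorem exists_aInfty (h : WeightPair p p' w v A) :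
    ∃ θ : ℝ≥0, 0 < θ ∧ θ < 1 ∧ ∀ c r, 0 < r → ∀ E ⊆ box c r, MeasurableSet E →
      2 * volume E ≤ volume (box c r) → wm w E ≤ θ * wm w (box c r) := by
  have hA := h.ne_top
  have hBt : (A * 2) ^ p ≠ ∞ := ENNReal.rpow_ne_top_of_nonneg h.conj.nonneg (by finiteness)
  -- The `2` gives `B⁻¹ ≤ 1 / 2`, so that the truncated difference `1 - B⁻¹` is a true one and lies
  -- strictly between `0` and `1`.
  set B : ℝ≥0 := ((A * 2) ^ p).toNNReal + 2
  have hB : (A * 2) ^ p ≤ B := by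
    simp only [B, ENNReal.coe_add, ENNReal.coe_toNNReal hBt]
    exact le_self_add
  have hB2 : 2 ≤ B := le_add_self
  have hB0 : B ≠ 0 := fun h0 => by simp [h0] at hB2
  have hBinv : B⁻¹ ≤ 2⁻¹ := inv_anti₀ (by norm_num) hB2
  have hBinv0 : 0 < B⁻¹ := by positivity
  have h21 : (2⁻¹ : ℝ≥0) < 1 := by
    rw [← NNReal.coe_lt_coe]; push_cast; norm_num
  refine ⟨1 - B⁻¹, tsub_pos_of_lt (hBinv.trans_lt h21), tsub_lt_self one_pos hBinv0,
    fun c r hr E hE hEm hv => ?_⟩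
  set W := wm w (box c r)
  have hWt : W ≠ ∞ := h.fin_left c r
  have hG : volume (box c r) ≤ 2 * volume (box c r \ E) := by
    have hvt := volume_box_ne_top c r
    have h1 : volume (box c r) = volume E + volume (box c r \ E) := by
      rw [← measure_inter_add_sdiff (box c r) hEm, inter_eq_right.2 hE]
    have h2 : volume (box c r) + volume (box c r) ≤
        volume (box c r) + 2 * volume (box c r \ E) := by
      calc _ = 2 * volume E + 2 * volume (box c r \ E) := by rw [← two_mul, h1]; ring
        _ ≤ _ := by gcongr
    exact (ENNReal.add_le_add_iff_left hvt).1 h2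
  have h1 : W ≤ B * wm w (box c r \ E) :=
    (h.measure_box_le hr ((measurableSet_box c r).diff hEm) sdiff_subset hG).trans
      (mul_le_mul_left hB _)
  have h2 : ((B⁻¹ : ℝ≥0) : ℝ≥0∞) * W ≤ wm w (box c r \ E) := by
    calc _ ≤ ((B⁻¹ : ℝ≥0) : ℝ≥0∞) * (B * wm w (box c r \ E)) := by gcongr
      _ = _ := by
        rw [← mul_assoc, ← ENNReal.coe_mul, inv_mul_cancel₀ hB0, ENNReal.coe_one, one_mul]
  have h3 : W = wm w E + wm w (box c r \ E) := by
    simp only [W]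
    rw [← measure_inter_add_sdiff (box c r) hEm, inter_eq_right.2 hE]
  have h4 : ((1 - B⁻¹ : ℝ≥0) : ℝ≥0∞) * W + ((B⁻¹ : ℝ≥0) : ℝ≥0∞) * W = W := by
    rw [← add_mul, ← ENNReal.coe_add, tsub_add_cancel_of_le (hBinv.trans h21.le),
      ENNReal.coe_one, one_mul]
  have hfin : ((B⁻¹ : ℝ≥0) : ℝ≥0∞) * W ≠ ∞ := by finiteness
  refine (ENNReal.add_le_add_iff_right hfin).1 ?_
  rw [h4]
  calc wm w E + ((B⁻¹ : ℝ≥0) : ℝ≥0∞) * W ≤ wm w E + wm w (box c r \ E) := by gcongr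
    _ = W := h3.symm

/-- Split both weights with the exponents `1 / p` and `1 / p'`. One pairing is bounded by the `A_p`
condition, the opposite one by passing to `S` in each weight. The result suits Hölder's inequality
for sums over disjoint `S`. -/
theorem measure_mul_measure_le (h : WeightPair p p' w v A) {c : Euc n} {r : ℝ} (hr : 0 < r)
    {S : Set (Euc n)} (hS : MeasurableSet S) (hSb : S ⊆ box c r) {t : ℝ≥0∞}
    (ht : volume (box c r) ≤ t * volume S) :
    wm v (box c r) * wm w (box c r) ≤ A * volume (box c r) *
      (((A * t) ^ p') ^ (1 / p) * ((A * t) ^ p) ^ (1 / p')) *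
        (wm v S ^ (1 / p) * wm w S ^ (1 / p')) := by
  have hp := h.conj.pos
  have hp' := h.conj.symm.pos
  have hsum : 1 / p + 1 / p' = 1 := by
    simpa only [one_div] using h.conj.inv_add_inv_eq_one
  have h1 := h.measure_box_le hr hS hSb ht
  have h2 := h.symm.measure_box_le hr hS hSb ht
  have e : ∀ a : ℝ≥0∞, a = a ^ (1 / p) * a ^ (1 / p') := fun a => by
    rw [← ENNReal.rpow_add_of_nonneg _ _ (by positivity) (by positivity), hsum, ENNReal.rpow_one]
  calc wm v (box c r) * wm w (box c r)
      = (wm w (box c r) ^ (1 / p) * wm v (box c r) ^ (1 / p')) *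
        (wm v (box c r) ^ (1 / p) * wm w (box c r) ^ (1 / p')) := by
        conv_lhs => rw [e (wm v (box c r)), e (wm w (box c r))]
        ring
    _ ≤ (A * volume (box c r)) * (((A * t) ^ p' * wm v S) ^ (1 / p) *
        ((A * t) ^ p * wm w S) ^ (1 / p')) := by
        refine mul_le_mul' (h.upper c r hr) (mul_le_mul' ?_ ?_)
        · exact ENNReal.rpow_le_rpow h2 (by positivity)
        · exact ENNReal.rpow_le_rpow h1 (by positivity)
    _ = _ := by
        rw [ENNReal.mul_rpow_of_nonneg ((A * t) ^ p') (wm v S) (by positivity),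
          ENNReal.mul_rpow_of_nonneg ((A * t) ^ p) (wm w S) (by positivity)]
        ring

/-! ### Decay at infinity in weighted spaces. -/

/-- The decay factor `(1 + ‖x‖) ^ (-n)`. -/
noncomputable def _root_.CZCommutator.decay (x : Euc n) : ℝ≥0∞ :=
  ENNReal.ofReal (1 / (1 + ‖x‖) ^ n)

theorem _root_.CZCommutator.measurable_decay : Measurable (decay (n := n)) := by
  unfold decay
  fun_prop

/-- Integrability of the decay factor. -/
theorem lintegral_decay_rpow_ne_top [NeZero n] (h : WeightPair p p' w v A) :
    ∫⁻ x, decay x ^ p ∂(wm w) ≠ ∞ := by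
  have hp := h.conj.pos
  have hp' := h.conj.symm.pos
  have hA := h.ne_top
  obtain ⟨θ, hθ0, hθ1, hθ⟩ := h.symm.exists_aInfty
  set B : ℕ → Set (Euc n) := fun j => box 0 (2 ^ j)
  -- Each box fills at most half of the next, so `A_∞` for `v` forces geometric growth of `wm v (B
  -- j)`. The `A_p` condition turns this into a gain for `w`, and integrability depends on it.
  have hgrow : ∀ j, wm v (B 0) ≤ (θ : ℝ≥0∞) ^ j * wm v (B j) := by
    intro j
    induction j with
    | zero => simp
    | succ j ih =>
      have hsub : B j ⊆ B (j + 1) := box_mono 0 (pow_le_pow_right₀ (by norm_num) (by omega))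
      have hvol : 2 * volume (B j) ≤ volume (B (j + 1)) := by
        have : B (j + 1) = box 0 (2 * 2 ^ j) := by simp only [B, pow_succ]; rw [mul_comm]
        rw [this, volume_box_mul 0 0 (by norm_num), ENNReal.ofReal_ofNat]
        gcongr
        exact le_self_pow₀ (by norm_num) (NeZero.ne n)
      calc wm v (B 0) ≤ (θ : ℝ≥0∞) ^ j * wm v (B j) := ih
        _ ≤ (θ : ℝ≥0∞) ^ j * (θ * wm v (B (j + 1))) := by
            gcongr
            exact hθ 0 _ (by positivity) _ hsub (measurableSet_box _ _) hvol
        _ = _ := by rw [pow_succ]; ring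
  set m₀ := wm v (B 0) ^ (p / p')
  have hm0 : m₀ ≠ 0 := by
    have : wm v (B 0) ≠ 0 := h.symm.measure_box_ne_zero 0 (by positivity)
    exact (ENNReal.rpow_pos (pos_iff_ne_zero.2 this) (h.fin_right _ _)).ne'
  have hmt : m₀ ≠ ∞ := ENNReal.rpow_ne_top_of_nonneg (by positivity) (h.fin_right _ _)
  set τ : ℝ≥0∞ := (θ : ℝ≥0∞) ^ (p / p')
  have hτ : τ < 1 := ENNReal.rpow_lt_one (by exact_mod_cast hθ1) (by positivity)
  have hvolB : ∀ j, volume (B j) = ENNReal.ofReal (2 * 2 ^ j) ^ n := fun j => volume_box _ _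
  -- The trivial bound for `wm w (B j)` is of order `volume (B j) ^ p`, exactly cancelled by the
  -- decay factor; the growth of `v` supplies the extra `τ ^ j` that makes the series converge.
  have hB : ∀ j, m₀ * wm w (B j) ≤ τ ^ j * (A ^ p * volume (B j) ^ p) := by
    intro j
    have h1 := ENNReal.rpow_le_rpow (h.upper 0 (2 ^ j) (by positivity)) hp.le
    rw [ENNReal.mul_rpow_of_nonneg _ _ hp.le, ENNReal.mul_rpow_of_nonneg _ _ hp.le,
      ← ENNReal.rpow_mul, ← ENNReal.rpow_mul, one_div_mul_cancel hp.ne', ENNReal.rpow_one,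
      one_div_mul_eq_div] at h1
    have h2 : m₀ ≤ τ ^ j * wm v (B j) ^ (p / p') := by
      have := ENNReal.rpow_le_rpow (hgrow j) (z := p / p') (by positivity)
      rw [ENNReal.mul_rpow_of_nonneg _ _ (by positivity)] at this
      refine this.trans (le_of_eq ?_)
      simp only [τ]
      rw [← ENNReal.rpow_natCast, ← ENNReal.rpow_natCast, ← ENNReal.rpow_mul, ← ENNReal.rpow_mul,
        mul_comm (j : ℝ)]
    calc m₀ * wm w (B j) ≤ τ ^ j * wm v (B j) ^ (p / p') * wm w (B j) := by gcongr
      _ = τ ^ j * (wm w (B j) * wm v (B j) ^ (p / p')) := by ring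
      _ ≤ _ := by gcongr
  have hsplit : ∫⁻ x, decay x ^ p ∂(wm w) ≤ wm w (B 0) + ∑' j : ℕ,
      ((((1 / (2 ^ j * 1) ^ n) ^ p : ℝ).toNNReal : ℝ≥0) : ℝ≥0∞) *
        ∫⁻ _ in box 0 (2 ^ (j + 1) * 1), (1 : ℝ≥0∞) ∂(wm w) := by
    rw [← lintegral_add_compl _ (measurableSet_box (0 : Euc n) 1)]
    refine add_le_add ?_ ?_
    · calc ∫⁻ x in box 0 1, decay x ^ p ∂(wm w) ≤ ∫⁻ _ in box 0 1, 1 ∂(wm w) := by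
            refine lintegral_mono fun x => ENNReal.rpow_le_one ?_ hp.le
            rw [decay, ENNReal.ofReal_le_one]
            refine (div_le_one (by positivity)).2 (one_le_pow₀ ?_)
            linarith [norm_nonneg x]
        _ = wm w (B 0) := by simp [B]
    · refine le_trans (lintegral_mono_ae ?_) (lintegral_compl_box_le 0 one_pos
        (fun s => ((1 / s ^ n) ^ p : ℝ).toNNReal) ?_ fun _ => 1)
      · refine (ae_restrict_iff' (measurableSet_box _ _).compl).2 (ae_of_all _ fun x hx => ?_)
        have hx1 := le_norm_sub_of_notMem_box hx
        rw [sub_zero] at hx1 ⊢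
        rw [decay, ENNReal.ofReal_rpow_of_nonneg (by positivity) hp.le, mul_one]
        refine ENNReal.ofReal_le_ofReal ?_
        gcongr
        linarith
      · intro x hx y hy hxy
        have hx' : (0 : ℝ) < x := hx
        have hy' : (0 : ℝ) < y := hy
        refine Real.toNNReal_le_toNNReal ?_
        gcongr
  refine ne_top_of_le_ne_top (ENNReal.add_ne_top.2 ⟨h.fin_left _ _, ?_⟩) hsplit
  have hterm : m₀ * (∑' j : ℕ, ((((1 / (2 ^ j * 1) ^ n) ^ p : ℝ).toNNReal : ℝ≥0) : ℝ≥0∞) *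
        ∫⁻ _ in box 0 (2 ^ (j + 1) * 1), (1 : ℝ≥0∞) ∂(wm w)) ≤
        τ * (A ^ p * ENNReal.ofReal ((4 ^ n) ^ p)) * ∑' j, τ ^ j := by
    rw [← ENNReal.tsum_mul_left, ← ENNReal.tsum_mul_left]
    refine ENNReal.tsum_le_tsum fun j => ?_
    have e1 : ∫⁻ _ in box 0 (2 ^ (j + 1) * 1), (1 : ℝ≥0∞) ∂(wm w) = wm w (B (j + 1)) := by
      simp [B]
    rw [e1]
    calc m₀ * (ENNReal.ofReal ((1 / (2 ^ j * 1) ^ n) ^ p) * wm w (B (j + 1)))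
        = ENNReal.ofReal ((1 / (2 ^ j * 1) ^ n) ^ p) * (m₀ * wm w (B (j + 1))) := by ring
      _ ≤ ENNReal.ofReal ((1 / (2 ^ j * 1) ^ n) ^ p) *
          (τ ^ (j + 1) * (A ^ p * volume (B (j + 1)) ^ p)) := mul_le_mul_right (hB _) _
      _ = τ ^ (j + 1) * (A ^ p *
          (ENNReal.ofReal ((1 / (2 ^ j * 1) ^ n) ^ p) * volume (B (j + 1)) ^ p)) := by ring
      _ = τ ^ (j + 1) * (A ^ p * ENNReal.ofReal ((4 ^ n) ^ p)) := by
          congr 2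
          rw [hvolB, ← ENNReal.ofReal_pow (by positivity),
            ENNReal.ofReal_rpow_of_nonneg (by positivity) hp.le,
            ← ENNReal.ofReal_mul (by positivity), ← Real.mul_rpow (by positivity) (by positivity)]
          congr 2
          rw [mul_one, one_div, ← inv_pow, ← mul_pow]
          congr 1
          rw [pow_succ]
          field_simp
          norm_num
      _ = _ := by rw [pow_succ]; ring
  have hfin : τ * (A ^ p * ENNReal.ofReal ((4 ^ n) ^ p)) * ∑' j, τ ^ j ≠ ∞ := by
    rw [ENNReal.tsum_geometric]
    have h1 : (1 - τ)⁻¹ ≠ ∞ := ENNReal.inv_ne_top.2 (tsub_pos_of_lt hτ).ne'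
    have h2 : A ^ p ≠ ∞ := ENNReal.rpow_ne_top_of_nonneg hp.le hA
    have h3 : τ ≠ ∞ := (hτ.trans ENNReal.one_lt_top).ne
    finiteness
  intro htop
  rw [htop, ENNReal.mul_top hm0, top_le_iff] at hterm
  exact hfin hterm

end WeightPair

end CZCommutator

namespace CZCommutator

open Set Filter Topology
open scoped NNReal

set_option linter.unusedSectionVars false

variable {n : ℕ} {q : ℝ≥0∞} [Fact (1 ≤ q)]

/-! ### The weighted estimate for commutators -/

/-- The `L^s` average over a box. -/
noncomputable def powAvg (μ : Measure (Euc n)) (s : ℝ) (g : Euc n → ℝ≥0) (P : Euc n × ℝ) : ℝ≥0∞ :=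
  ((∫⁻ x in box P.1 P.2, (g x : ℝ≥0∞) ^ s ∂μ) / μ (box P.1 P.2)) ^ (1 / s)

theorem rpow_mul_rpow_eq_mul_powAvg {μ : Measure (Euc n)} {s s' : ℝ} (hs : s.HolderConjugate s')
    (g : Euc n → ℝ≥0) (P : Euc n × ℝ) (h0 : μ (box P.1 P.2) ≠ 0) (ht : μ (box P.1 P.2) ≠ ∞) :
    μ (box P.1 P.2) ^ (1 / s') * (∫⁻ x in box P.1 P.2, (g x : ℝ≥0∞) ^ s ∂μ) ^ (1 / s) =
      μ (box P.1 P.2) * powAvg μ s g P := by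
  have hs0 := hs.pos
  have e : (1 : ℝ) / s' = 1 - 1 / s := by
    have := hs.inv_add_inv_eq_one
    rw [one_div, one_div]; linarith
  rw [powAvg, ENNReal.div_rpow_of_nonneg _ _ (by positivity), e, ENNReal.rpow_sub _ _ h0 ht,
    ENNReal.rpow_one]
  simp only [div_eq_mul_inv]
  ring

theorem lintegral_le_mul_powAvg {μ : Measure (Euc n)} {s s' : ℝ} (hs : s.HolderConjugate s')
    {g : Euc n → ℝ≥0} (hg : Measurable g) (P : Euc n × ℝ) (h0 : μ (box P.1 P.2) ≠ 0)
    (ht : μ (box P.1 P.2) ≠ ∞) :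
    ∫⁻ x in box P.1 P.2, g x ∂μ ≤ μ (box P.1 P.2) * powAvg μ s g P := by
  rw [← rpow_mul_rpow_eq_mul_powAvg hs g P h0 ht]
  have := ENNReal.lintegral_mul_le_Lp_mul_Lq (μ.restrict (box P.1 P.2)) hs.symm
    (f := fun _ => 1) (g := fun x => (g x : ℝ≥0∞)) (by fun_prop) (by fun_prop)
  simpa using this

/-- Hölder with exponents `s'` and `s`, the oscillation being controlled by John–Nirenberg in
`L^{s'}(μ)`. The price is an `L^s` average of `g` in place of an `L^1` average. -/
theorem exists_lintegral_oscillation_mul_le {μ : Measure (Euc n)} (hac : μ ≪ volume) {θ : ℝ≥0}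
    (hθ0 : 0 < θ) (hθ : θ < 1) (h0 : ∀ c r, 0 < r → μ (box c r) ≠ 0)
    (hfin : ∀ c r, μ (box c r) ≠ ∞)
    (hμ : ∀ c r, 0 < r → ∀ E ⊆ box c r, MeasurableSet E → 2 * volume E ≤ volume (box c r) →
      μ E ≤ θ * μ (box c r)) {s s' : ℝ} (hs : s.HolderConjugate s') :
    ∃ C : ℝ≥0∞, C ≠ ∞ ∧ ∀ b : Euc n → ℂ, LocallyIntegrable b volume → bmoSeminorm b ≠ ∞ →
      ∀ g : Euc n → ℝ≥0, Measurable g → ∀ P : Euc n × ℝ, 0 < P.2 →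
        ∫⁻ x in box P.1 P.2, ‖b x - ⨍ y in box P.1 P.2, b y‖ₑ * g x ∂μ ≤
          C * bmoSeminorm b * (μ (box P.1 P.2) * powAvg μ s g P) := by
  have hs' := hs.symm.pos
  obtain ⟨C, hC, hJN⟩ := exists_lintegral_oscillation_le hθ0 hθ hfin hμ hs'
  refine ⟨C ^ (1 / s'), ENNReal.rpow_ne_top_of_nonneg (by positivity) hC,
    fun b hb hβ g hg P hP => ?_⟩
  have hbm : AEStronglyMeasurable b (μ.restrict (box P.1 P.2)) :=
    (hb.aestronglyMeasurable.mono_ac hac).restrict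
  have h1 := ENNReal.lintegral_mul_le_Lp_mul_Lq (μ.restrict (box P.1 P.2)) hs.symm
    (f := fun x => ‖b x - ⨍ y in box P.1 P.2, b y‖ₑ) (g := fun x => (g x : ℝ≥0∞))
    (hbm.sub aestronglyMeasurable_const).enorm (by fun_prop)
  refine h1.trans ?_
  have h2 := ENNReal.rpow_le_rpow (hJN b hb hβ P.1 P.2 hP) (z := 1 / s') (by positivity)
  rw [ENNReal.mul_rpow_of_nonneg _ _ (by positivity), ENNReal.mul_rpow_of_nonneg _ _ (by positivity),
    ← ENNReal.rpow_mul, mul_one_div_cancel hs'.ne', ENNReal.rpow_one] at h2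
  rw [← rpow_mul_rpow_eq_mul_powAvg hs g P (h0 _ _ hP) (hfin _ _), ← mul_assoc]
  exact mul_le_mul_left h2 _

/-- Written as a power of the plain average of `g ^ s`, the `L^s` average fits the Carleson
embedding with exponent `p / s`. -/
theorem powAvg_rpow (μ : Measure (Euc n)) {s : ℝ} (hs : 0 < s) (g : Euc n → ℝ≥0) (P : Euc n × ℝ)
    (p : ℝ) : powAvg μ s g P ^ p = ((∫⁻ x in box P.1 P.2, ((g x ^ s : ℝ≥0) : ℝ≥0∞) ∂μ) /
      μ (box P.1 P.2)) ^ (p / s) := by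
  rw [powAvg, ← ENNReal.rpow_mul]
  simp only [ENNReal.coe_rpow_of_nonneg _ hs.le]
  congr 1
  field_simp

/-- A bilinear embedding for sparse families. -/
theorem WeightPair.exists_sum_powAvg_mul_le {p p' : ℝ} {w v : Euc n → ℝ≥0} {A : ℝ≥0∞}
    (h : WeightPair p p' w v A) {s : ℝ} (hs : 0 < s) (hsp : s < p) (hsp' : s < p') :
    ∃ C : ℝ≥0∞, C ≠ ∞ ∧ ∀ F G : Euc n → ℝ≥0, Measurable F → Measurable G → ∀ {ι : Type}
      (B : ι → Euc n × ℝ) (S : ι → Set (Euc n)), (∀ i, 0 < (B i).2) →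
      (∀ i, MeasurableSet (S i)) → (∀ i, S i ⊆ box (B i).1 (B i).2) →
      Pairwise (fun i j => Disjoint (S i) (S j)) →
      ∑' i, powAvg (wm v) s F (B i) * powAvg (wm w) s G (B i) *
        (wm v (S i) ^ (1 / p) * wm w (S i) ^ (1 / p')) ≤
        C * ((∫⁻ x, (F x : ℝ≥0∞) ^ p ∂(wm v)) ^ (1 / p) *
          (∫⁻ x, (G x : ℝ≥0∞) ^ p' ∂(wm w)) ^ (1 / p')) := by
  have hp := h.conj.pos
  have hp' := h.conj.symm.pos
  obtain ⟨D₁, hD₁, hd₁⟩ := h.symm.exists_doubling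
  obtain ⟨D₂, hD₂, hd₂⟩ := h.exists_doubling
  -- The condition `s < p` makes the exponent `p / s` exceed `1`; the second embedding needs `s <
  -- p'` in the same way.
  obtain ⟨C₁, hC₁, he₁⟩ := exists_sum_average_rpow_le hD₁ hd₁ h.fin_right
    (t := p / s) ((one_lt_div hs).2 hsp)
  obtain ⟨C₂, hC₂, he₂⟩ := exists_sum_average_rpow_le hD₂ hd₂ h.fin_left
    (t := p' / s) ((one_lt_div hs).2 hsp')
  refine ⟨C₁ ^ (1 / p) * C₂ ^ (1 / p'), ENNReal.mul_ne_top
    (ENNReal.rpow_ne_top_of_nonneg (by positivity) hC₁)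
    (ENNReal.rpow_ne_top_of_nonneg (by positivity) hC₂), fun F G hF hG ι B S hB hSm hSB hd => ?_⟩
  rw [ENNReal.tsum_eq_iSup_sum]
  refine iSup_le fun t => ?_
  have aux : ∀ {r : ℝ}, 0 < r → ∀ {μ : Measure (Euc n)} {g : Euc n → ℝ≥0} {C : ℝ≥0∞},
      (∑ i ∈ t, ((∫⁻ x in box (B i).1 (B i).2, ((g x ^ s : ℝ≥0) : ℝ≥0∞) ∂μ) /
        μ (box (B i).1 (B i).2)) ^ (r / s) * μ (S i) ≤
        C * ∫⁻ x, ((g x ^ s : ℝ≥0) : ℝ≥0∞) ^ (r / s) ∂μ) →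
      (∑ i ∈ t, (powAvg μ s g (B i) * μ (S i) ^ (1 / r)) ^ r) ^ (1 / r) ≤
        C ^ (1 / r) * (∫⁻ x, (g x : ℝ≥0∞) ^ r ∂μ) ^ (1 / r) := by
    intro r hr μ g C hle
    rw [← ENNReal.mul_rpow_of_nonneg _ _ (by positivity)]
    refine ENNReal.rpow_le_rpow ?_ (by positivity)
    convert hle using 1
    · refine Finset.sum_congr rfl fun i _ => ?_
      rw [ENNReal.mul_rpow_of_nonneg _ _ hr.le, powAvg_rpow μ hs, ← ENNReal.rpow_mul,
        one_div_mul_cancel hr.ne', ENNReal.rpow_one]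
    · congr 1
      refine lintegral_congr fun x => ?_
      rw [ENNReal.coe_rpow_of_nonneg _ hs.le, ← ENNReal.rpow_mul, mul_div_cancel₀ _ hs.ne']
  have hd' : (t : Set ι).PairwiseDisjoint S := fun i _ j _ hij => hd hij
  calc ∑ i ∈ t, powAvg (wm v) s F (B i) * powAvg (wm w) s G (B i) *
        (wm v (S i) ^ (1 / p) * wm w (S i) ^ (1 / p'))
      = ∑ i ∈ t, (powAvg (wm v) s F (B i) * wm v (S i) ^ (1 / p)) *
        (powAvg (wm w) s G (B i) * wm w (S i) ^ (1 / p')) :=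
        Finset.sum_congr rfl fun i _ => by ring
    _ ≤ _ := ENNReal.inner_le_Lp_mul_Lq t _ _ h.conj
    _ ≤ (C₁ ^ (1 / p) * (∫⁻ x, (F x : ℝ≥0∞) ^ p ∂(wm v)) ^ (1 / p)) *
        (C₂ ^ (1 / p') * (∫⁻ x, (G x : ℝ≥0∞) ^ p' ∂(wm w)) ^ (1 / p')) :=
        mul_le_mul' (aux hp (he₁ _ (by fun_prop) t B S (fun i _ => hB i) (fun i _ => hSm i)
          (fun i _ => hSB i) hd')) (aux hp' (he₂ _ (by fun_prop) t B S (fun i _ => hB i)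
          (fun i _ => hSm i) (fun i _ => hSB i) hd'))
    _ = _ := by ring

/-- The contribution of one box to the sparse bound. -/
theorem WeightPair.exists_lintegral_sparseTerm_mul_le [NeZero n] {p p' : ℝ} {w v : Euc n → ℝ≥0}
    {A : ℝ≥0∞} (h : WeightPair p p' w v A) {s s' : ℝ} (hs : s.HolderConjugate s') :
    ∃ C : ℝ≥0∞, C ≠ ∞ ∧ ∀ b f : Euc n → ℂ, LocallyIntegrable b volume → bmoSeminorm b ≠ ∞ →
      Measurable f → ∀ G : Euc n → ℝ≥0, Measurable G → ∀ (a : Euc n × ℝ → ℂ) (P : Euc n × ℝ),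
      0 < P.2 → a P = ⨍ y in box P.1 (5 * n * P.2), b y → ∀ S ⊆ box P.1 P.2, MeasurableSet S →
      volume (box P.1 P.2) ≤ 2 * volume S →
      ∫⁻ x in box P.1 P.2, sparseTerm b f a P x * G x ∂(wm w) ≤ C * bmoSeminorm b *
        (powAvg (wm v) s (fun x => ‖f x‖₊ / v x) (P.1, 5 * n * P.2) *
          powAvg (wm w) s G (P.1, 5 * n * P.2) *
            (wm v S ^ (1 / p) * wm w S ^ (1 / p'))) := by
  have hp := h.conj.pos
  have hp' := h.conj.symm.pos
  have hA := h.ne_top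
  have hvm := h.measurable_right
  have hn : (1 : ℝ) ≤ n := by exact_mod_cast NeZero.one_le
  obtain ⟨θ, hθ0, hθ1, hθ⟩ := h.exists_aInfty
  obtain ⟨θ', hθ0', hθ1', hθ'⟩ := h.symm.exists_aInfty
  obtain ⟨C₁, hC₁, h₁⟩ := exists_lintegral_oscillation_mul_le (wm_absolutelyContinuous w) hθ0 hθ1
    (fun c r hr => h.measure_box_ne_zero c hr) h.fin_left hθ hs
  obtain ⟨C₂, hC₂, h₂⟩ := exists_lintegral_oscillation_mul_le (wm_absolutelyContinuous v) hθ0' hθ1'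
    (fun c r hr => h.symm.measure_box_ne_zero c hr) h.fin_right hθ' hs
  -- The dilate has at most `t` times the volume of `S`, as `S` is at least half of the undilated
  -- box.
  set t : ℝ≥0∞ := ENNReal.ofReal (5 * n) ^ n * 2
  set L : ℝ≥0∞ := ((A * t) ^ p') ^ (1 / p) * ((A * t) ^ p) ^ (1 / p')
  have hL : L ≠ ∞ := by
    have ht : A * t ≠ ∞ := by finiteness
    exact ENNReal.mul_ne_top
      (ENNReal.rpow_ne_top_of_nonneg (by positivity) (ENNReal.rpow_ne_top_of_nonneg hp'.le ht))
      (ENNReal.rpow_ne_top_of_nonneg (by positivity) (ENNReal.rpow_ne_top_of_nonneg hp.le ht))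
  refine ⟨(C₁ + C₂) * (A * L), by finiteness, fun b f hb hβ hf G hG a P hP ha S hS hSm hSv => ?_⟩
  have hP' : 0 < 5 * n * P.2 := by positivity
  set B : Euc n × ℝ := (P.1, 5 * n * P.2)
  set β := bmoSeminorm b
  -- Since `v * F = |f|`, Lebesgue averages of `f` become integrals of `F` against `v`, where
  -- John–Nirenberg and the embedding apply.
  set F : Euc n → ℝ≥0 := fun x => ‖f x‖₊ / v x
  have hF : Measurable F := hf.nnnorm.div hvm
  have hbox : box P.1 P.2 ⊆ box B.1 B.2 := box_mono _ (by simp only [B]; nlinarith)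
  set V := volume (box B.1 B.2)
  have hV0 : V ≠ 0 := (volume_box_pos _ hP').ne'
  have hVt : V ≠ ∞ := volume_box_ne_top _ _
  have hvF : ∀ x, (v x : ℝ≥0∞) * F x = ‖f x‖ₑ := fun x => by
    simp only [F]
    rw [← ENNReal.coe_mul, mul_div_cancel₀ _ (h.right_ne_zero x)]
    rfl
  have hbm := hb.aestronglyMeasurable
  have hbm' : AEMeasurable (fun x => ‖b x - a P‖ₑ) volume :=
    (hbm.sub aestronglyMeasurable_const).enorm
  have hbF : AEMeasurable (fun x => ‖b x - a P‖ₑ * (F x : ℝ≥0∞)) volume :=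
    hbm'.mul (by fun_prop)
  have hbG : AEMeasurable (fun x => ‖b x - a P‖ₑ * (G x : ℝ≥0∞)) (wm w) :=
    (hbm'.mono_ac (wm_absolutelyContinuous w)).mul (by fun_prop)
  have d1 : dilAvg f P = (∫⁻ x in box B.1 B.2, F x ∂(wm v)) / V := by
    rw [dilAvg, wm, restrict_withDensity (measurableSet_box _ _),
      lintegral_withDensity_eq_lintegral_mul _ (by fun_prop) (by fun_prop)]
    congr 1
    exact lintegral_congr fun x => (hvF x).symm
  have d2 : dilAvg (fun y => (b y - a P) * f y) P =
      (∫⁻ x in box B.1 B.2, ‖b x - a P‖ₑ * F x ∂(wm v)) / V := by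
    rw [dilAvg, wm, restrict_withDensity (measurableSet_box _ _),
      lintegral_withDensity_eq_lintegral_mul₀ (by fun_prop) hbF.restrict]
    congr 1
    refine lintegral_congr fun x => ?_
    simp only [Pi.mul_apply]
    rw [enorm_mul, ← hvF x]
    ring
  set mF := powAvg (wm v) s F B
  set mG := powAvg (wm w) s G B
  set W := wm w (box B.1 B.2)
  set W' := wm v (box B.1 B.2)
  have hW0 : W ≠ 0 := h.measure_box_ne_zero _ hP'
  have hW0' : W' ≠ 0 := h.symm.measure_box_ne_zero _ hP'
  have k1 : dilAvg f P ≤ W' * mF / V := by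
    rw [d1]
    exact ENNReal.div_le_div_right (lintegral_le_mul_powAvg hs hF B hW0' (h.fin_right _ _)) _
  have k2 : dilAvg (fun y => (b y - a P) * f y) P ≤ C₂ * β * (W' * mF) / V := by
    rw [d2, ha]
    exact ENNReal.div_le_div_right (h₂ b hb hβ F hF B hP') _
  have k3 : ∫⁻ x in box B.1 B.2, ‖b x - a P‖ₑ * G x ∂(wm w) ≤ C₁ * β * (W * mG) := by
    rw [ha]
    exact h₁ b hb hβ G hG B hP'
  have k4 : ∫⁻ x in box B.1 B.2, G x ∂(wm w) ≤ W * mG :=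
    lintegral_le_mul_powAvg hs hG B hW0 (h.fin_left _ _)
  have hkey : W' * W ≤ A * V * L * (wm v S ^ (1 / p) * wm w S ^ (1 / p')) := by
    refine h.measure_mul_measure_le hP' hSm (hS.trans hbox) ?_
    change volume (box P.1 (5 * n * P.2)) ≤ t * volume S
    rw [volume_box_mul P.1 P.1 (by positivity), mul_assoc]
    gcongr
  have hsplit : ∫⁻ x in box P.1 P.2, sparseTerm b f a P x * G x ∂(wm w) ≤
      (∫⁻ x in box B.1 B.2, ‖b x - a P‖ₑ * G x ∂(wm w)) * dilAvg f P +
      (∫⁻ x in box B.1 B.2, G x ∂(wm w)) * dilAvg (fun y => (b y - a P) * f y) P := by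
    rw [← lintegral_mul_const'' _ hbG.restrict, ← lintegral_mul_const'' _ (by fun_prop),
      ← lintegral_add_right _ (by fun_prop)]
    refine (lintegral_mono_set hbox).trans (le_of_eq (lintegral_congr fun x => ?_))
    simp only [sparseTerm]
    ring
  calc _ ≤ (C₁ * β * (W * mG)) * (W' * mF / V) + (W * mG) * (C₂ * β * (W' * mF) / V) :=
        hsplit.trans (add_le_add (mul_le_mul' k3 k1) (mul_le_mul' k4 k2))
    _ = (C₁ + C₂) * β * (mF * mG) * (W' * W) * V⁻¹ := by
        simp only [div_eq_mul_inv]; ring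
    _ ≤ (C₁ + C₂) * β * (mF * mG) *
        (A * V * L * (wm v S ^ (1 / p) * wm w S ^ (1 / p'))) * V⁻¹ :=
        mul_le_mul_left (mul_le_mul_right hkey _) _
    _ = (C₁ + C₂) * (A * L) * β * (mF * mG * (wm v S ^ (1 / p) * wm w S ^ (1 / p'))) *
        (V * V⁻¹) := by ring
    _ = _ := by rw [ENNReal.mul_inv_cancel hV0 hVt, mul_one]

theorem aemeasurable_sparseTerm {μ : Measure (Euc n)} (hμ : μ ≪ volume) {b : Euc n → ℂ}
    (hb : AEStronglyMeasurable b volume) (f : Euc n → ℂ) (a : Euc n × ℝ → ℂ) (P : Euc n × ℝ) :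
    AEMeasurable (sparseTerm b f a P) μ := by
  have : AEMeasurable (fun x => ‖b x - a P‖ₑ) μ :=
    ((hb.mono_ac hμ).sub aestronglyMeasurable_const).enorm
  exact (this.mul_const _).add_const _

/-- The identity `v ^ (1 - p) = w` absorbs the division by `v`, so the norm of `‖f‖ / v` in `L^p(v)`
is that of `f` in `L^p(w)`. -/
theorem WeightPair.lintegral_div_rpow {p p' : ℝ} {w v : Euc n → ℝ≥0} {A : ℝ≥0∞}
    (h : WeightPair p p' w v A) {f : Euc n → ℂ} (hf : Measurable f) :
    ∫⁻ x, ((‖f x‖₊ / v x : ℝ≥0) : ℝ≥0∞) ^ p ∂(wm v) = ∫⁻ x, ‖f x‖ₑ ^ p ∂(wm w) := by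
  have hp := h.conj.pos
  have hv := h.measurable_right
  have hF : Measurable fun x => ‖f x‖₊ / v x := hf.nnnorm.div hv
  rw [lintegral_wm h.measurable_left (hf.enorm.pow_const p).aemeasurable,
    lintegral_wm hv (hF.coe_nnreal_ennreal.pow_const p).aemeasurable]
  refine lintegral_congr fun x => ?_
  have hv0 := h.right_ne_zero x
  rw [h.left_eq x, ← ENNReal.coe_rpow_of_nonneg _ hp.le]
  have e : ‖f x‖ₑ ^ p = ((‖f x‖₊ ^ p : ℝ≥0) : ℝ≥0∞) :=
    (ENNReal.coe_rpow_of_nonneg ‖f x‖₊ hp.le).symm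
  rw [e, ← ENNReal.coe_mul, ← ENNReal.coe_mul]
  congr 1
  rw [NNReal.div_rpow, NNReal.rpow_sub hv0, NNReal.rpow_one]
  ring

/-- The bilinear form of the weighted commutator estimate. -/
theorem IsCZPair.exists_lintegral_comm_mul_le [NeZero n] {T : LqOp n q} {K : Euc n → Euc n → ℂ}
    {C : ℝ} (hT : IsCZPair T K C) (hqtop : q ≠ ∞) {p p' : ℝ} {w v : Euc n → ℝ≥0}
    {A : ℝ≥0∞} (h : WeightPair p p' w v A) :
    ∃ L : ℝ≥0∞, L ≠ ∞ ∧ ∀ b f : Euc n → ℂ, LocallyIntegrable b volume → bmoSeminorm b ≠ ∞ →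
      Measurable f → MemLp f q volume → MemLp (fun x => b x * f x) q volume →
      ∀ G : Euc n → ℝ≥0, Measurable G → ∀ Q : Euc n × ℝ, 0 < Q.2 →
      (∀ y, y ∉ box Q.1 Q.2 → f y = 0) →
      ∫⁻ x in box Q.1 Q.2, ‖comm T b f x‖ₑ * G x ∂(wm w) ≤ L * bmoSeminorm b *
        ((∫⁻ x, ‖f x‖ₑ ^ p ∂(wm w)) ^ (1 / p) *
          (∫⁻ x, (G x : ℝ≥0∞) ^ p' ∂(wm w)) ^ (1 / p')) := by
  have hp := h.conj.pos
  -- The midpoint of `1` and `min p p'`: above `1` for Hölder, below both exponents for the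
  -- embedding.
  set s : ℝ := (1 + min p p') / 2
  have hmin : 1 < min p p' := lt_min h.conj.lt h.conj.symm.lt
  have hs1 : 1 < s := by simp only [s]; linarith
  have hsm : s < min p p' := by simp only [s]; linarith
  have hs : s.HolderConjugate s.conjExponent := Real.HolderConjugate.conjExponent hs1
  obtain ⟨M, hM, hsparse⟩ := hT.exists_sparse_domination hqtop
  obtain ⟨C₁, hC₁, h₁⟩ := h.exists_lintegral_sparseTerm_mul_le hs
  obtain ⟨C₂, hC₂, h₂⟩ := h.exists_sum_powAvg_mul_le (zero_lt_one.trans hs1)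
    (hsm.trans_le (min_le_left _ _)) (hsm.trans_le (min_le_right _ _))
  refine ⟨M * C₁ * C₂, by finiteness, fun b f hb hβ hfm hf hbf G hG Q hQ hfQ => ?_⟩
  have hn : (0 : ℝ) < n := by exact_mod_cast NeZero.pos n
  -- Averages over the dilates, because `dilAvg` integrates `b - a P` there.
  set a : Euc n × ℝ → ℂ := fun P => ⨍ y in box P.1 (5 * n * P.2), b y
  obtain ⟨ch, hch', hdom⟩ := hsparse b f hf hbf a Q hQ hfQ
  have hch : ∀ P, 0 < P.2 → IsSubfamily P (ch P) := fun P hP => (hch' P hP).1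
  have hgen := isSubfamily_gen hch hQ
  set F : Euc n → ℝ≥0 := fun x => ‖f x‖₊ / v x
  have hF : Measurable F := hfm.nnnorm.div h.measurable_right
  let ι : Type := Σ k, gen ch Q k
  -- What the next layer leaves of a box: at least half of its volume, and disjoint over the whole
  -- tree, within a generation and across generations.
  set S : ι → Set (Euc n) := fun i => box i.2.1.1 i.2.1.2 \ layer ch Q (i.1 + 1)
  have hpos : ∀ i : ι, 0 < i.2.1.2 := fun i => (hgen i.1).pos _ i.2.2
  have hSm : ∀ i, MeasurableSet (S i) := fun i =>
    (measurableSet_box _ _).diff (measurableSet_layer hch hQ _)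
  have hSv : ∀ i : ι, volume (box i.2.1.1 i.2.1.2) ≤ 2 * volume (S i) := by
    intro i
    have e1 := measure_inter_add_sdiff (μ := volume) (box i.2.1.1 i.2.1.2)
      (measurableSet_layer hch hQ (i.1 + 1))
    have e2 : 2 * volume (box i.2.1.1 i.2.1.2 ∩ layer ch Q (i.1 + 1)) ≤
        volume (box i.2.1.1 i.2.1.2) := by
      rw [box_inter_layer_succ hch hQ i.2.2]
      exact (hch' _ (hpos i)).2
    have hfin := volume_box_ne_top i.2.1.1 i.2.1.2
    refine (ENNReal.add_le_add_iff_left hfin).1 ?_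
    calc _ = 2 * volume (box i.2.1.1 i.2.1.2 ∩ layer ch Q (i.1 + 1)) + 2 * volume (S i) := by
          rw [← two_mul, ← mul_add, e1]
      _ ≤ _ := by gcongr
  have hlt : ∀ i j : ι, i.1 < j.1 → Disjoint (S i) (S j) := by
    intro i j hij
    refine disjoint_left.2 fun x hx hx' => hx.2 (layer_antitone hch hQ hij ?_)
    exact mem_iUnion₂.2 ⟨_, j.2.2, hx'.1⟩
  have hd : Pairwise fun i j => Disjoint (S i) (S j) := by
    rintro ⟨k, P⟩ ⟨l, R⟩ hne
    rcases lt_trichotomy k l with hkl | rfl | hkl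
    · exact hlt _ _ hkl
    · have hPR : (P : Euc n × ℝ) ≠ R := fun h => hne (by rw [Subtype.ext h])
      exact ((hgen k).disjoint P.2 R.2 hPR).mono sdiff_subset sdiff_subset
    · exact (hlt _ _ hkl).symm
  have hFf : ∫⁻ x, (F x : ℝ≥0∞) ^ p ∂(wm v) = ∫⁻ x, ‖f x‖ₑ ^ p ∂(wm w) :=
    h.lintegral_div_rpow hfm
  have hterm : ∀ P : Euc n × ℝ, AEMeasurable (fun x => sparseTerm b f a P x * G x)
      (wm w) := fun P =>
    (aemeasurable_sparseTerm (wm_absolutelyContinuous w) hb.aestronglyMeasurable f a P).mul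
      hG.coe_nnreal_ennreal.aemeasurable
  have : ∀ k, Countable (gen ch Q k) := fun k => (hgen k).countable.to_subtype
  have hdom' : ∀ᵐ x ∂((wm w).restrict (box Q.1 Q.2)), ‖comm T b f x‖ₑ * G x ≤
      ∑' i : ι, M * (box i.2.1.1 i.2.1.2).indicator
        (fun x => sparseTerm b f a i.2 x * G x) x := by
    rw [ae_restrict_iff' (measurableSet_box _ _)]
    filter_upwards [(wm_absolutelyContinuous w).ae_le hdom] with x hx hxQ
    refine (mul_le_mul_left (hx hxQ) _).trans (le_of_eq ?_)
    rw [ENNReal.tsum_mul_left, mul_assoc, ENNReal.tsum_sigma', ← ENNReal.tsum_mul_right]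
    congr 1
    refine tsum_congr fun k => ?_
    rw [← ENNReal.tsum_mul_right]
    refine tsum_congr fun P => ?_
    by_cases hx' : x ∈ box P.1.1 P.1.2 <;> simp [hx']
  calc ∫⁻ x in box Q.1 Q.2, ‖comm T b f x‖ₑ * G x ∂(wm w)
      ≤ ∫⁻ x in box Q.1 Q.2, ∑' i : ι, M * (box i.2.1.1 i.2.1.2).indicator
        (fun x => sparseTerm b f a i.2 x * G x) x ∂(wm w) := lintegral_mono_ae hdom'
    _ ≤ ∫⁻ x, ∑' i : ι, M * (box i.2.1.1 i.2.1.2).indicator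
        (fun x => sparseTerm b f a i.2 x * G x) x ∂(wm w) := setLIntegral_le_lintegral _ _
    _ = ∑' i : ι, M * ∫⁻ x in box i.2.1.1 i.2.1.2, sparseTerm b f a i.2 x * G x ∂(wm w) := by
        have hi : ∀ i : ι, AEMeasurable ((box i.2.1.1 i.2.1.2).indicator
            (fun x => sparseTerm b f a i.2 x * G x)) (wm w) := fun i =>
          (hterm _).indicator (measurableSet_box _ _)
        rw [lintegral_tsum fun i => (hi i).const_mul _]
        refine tsum_congr fun i => ?_
        rw [lintegral_const_mul'' _ (hi i), lintegral_indicator (measurableSet_box _ _)]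
    _ ≤ ∑' i : ι, M * (C₁ * bmoSeminorm b * (powAvg (wm v) s F (i.2.1.1, 5 * n * i.2.1.2) *
          powAvg (wm w) s G (i.2.1.1, 5 * n * i.2.1.2) *
            (wm v (S i) ^ (1 / p) * wm w (S i) ^ (1 / p')))) :=
        ENNReal.tsum_le_tsum fun i => mul_le_mul_right (h₁ b f hb hβ hfm G hG a i.2 (hpos i) rfl
          (S i) sdiff_subset (hSm i) (hSv i)) _
    _ ≤ M * (C₁ * bmoSeminorm b * (C₂ * ((∫⁻ x, (F x : ℝ≥0∞) ^ p ∂(wm v)) ^ (1 / p) *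
          (∫⁻ x, (G x : ℝ≥0∞) ^ p' ∂(wm w)) ^ (1 / p')))) := by
        rw [ENNReal.tsum_mul_left, ENNReal.tsum_mul_left]
        refine mul_le_mul_right (mul_le_mul_right ?_ _) _
        refine h₂ F G hF hG (fun i : ι => (i.2.1.1, 5 * n * i.2.1.2)) S
          (fun i => mul_pos (by positivity) (hpos i)) hSm
          (fun i => sdiff_subset.trans (box_subset_dilate _ (hpos i))) hd
    _ = _ := by rw [hFf]; ring

/-! ### From the bilinear form to the weighted norm. -/

/-- Duality: an `L^p` bound follows from bounds for the pairings with functions on boxes. -/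
theorem lintegral_rpow_le_of_forall_lintegral_mul_le {μ : Measure (Euc n)} {p p' : ℝ}
    (hpp : p.HolderConjugate p') (hfin : ∀ r, μ (box 0 r) ≠ ∞) {h : Euc n → ℝ≥0}
    (hm : Measurable h) {L : ℝ≥0∞}
    (hL : ∀ (R : ℝ) (G : Euc n → ℝ≥0), Measurable G → (∀ x, x ∉ box 0 R → G x = 0) →
      ∫⁻ x, h x * G x ∂μ ≤ L * (∫⁻ x, (G x : ℝ≥0∞) ^ p' ∂μ) ^ (1 / p')) :
    ∫⁻ x, (h x : ℝ≥0∞) ^ p ∂μ ≤ L ^ p := by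
  have hp := hpp.pos
  have hp' := hpp.symm.pos
  have hp1 : 0 < p - 1 := hpp.sub_one_pos
  set g : ℕ → Euc n → ℝ≥0 := fun N => (box 0 (N + 1)).indicator fun x => min (h x) N
  have hgm : ∀ N, Measurable (g N) := fun N =>
    (hm.min measurable_const).indicator (measurableSet_box _ _)
  have hg0 : ∀ (N : ℕ) x, x ∉ box 0 ((N : ℝ) + 1) → g N x = 0 := fun N x hx => indicator_of_notMem hx _
  have hgle : ∀ N x, g N x ≤ h x := fun N x => by
    by_cases hx : x ∈ box 0 (N + 1) <;> simp [g, hx]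
  have hbd : ∀ N, ∫⁻ x, (g N x : ℝ≥0∞) ^ p ∂μ ≤ L ^ p := by
    intro N
    set X := ∫⁻ x, (g N x : ℝ≥0∞) ^ p ∂μ
    -- Truncation in size and support makes `X` finite, so that the power `X ^ (1 / p')` can be
    -- cancelled.
    have hXt : X ≠ ∞ := by
      have : X ≤ ∫⁻ x, (box 0 (N + 1)).indicator (fun _ => (N : ℝ≥0∞) ^ p) x ∂μ := by
        refine lintegral_mono fun x => ?_
        by_cases hx : x ∈ box 0 (N + 1)
        · simp only [g, indicator_of_mem hx]
          refine ENNReal.rpow_le_rpow ?_ hp.le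
          exact_mod_cast min_le_right _ _
        · rw [hg0 N x hx, ENNReal.coe_zero, ENNReal.zero_rpow_of_pos hp]
          exact zero_le
      refine ne_top_of_le_ne_top ?_ this
      rw [lintegral_indicator (measurableSet_box _ _), lintegral_const, Measure.restrict_apply_univ]
      exact ENNReal.mul_ne_top (ENNReal.rpow_ne_top_of_nonneg hp.le (by finiteness)) (hfin _)
    -- The extremal test function `g ^ (p - 1)`, whose `p'`-th power is `g ^ p`.
    have key := hL (N + 1) (fun x => g N x ^ (p - 1)) ((hgm N).pow_const _) fun x hx => by
      rw [hg0 N x hx, NNReal.zero_rpow hp1.ne']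
    have e1 : ∫⁻ x, ((g N x ^ (p - 1) : ℝ≥0) : ℝ≥0∞) ^ p' ∂μ = X := by
      refine lintegral_congr fun x => ?_
      rw [ENNReal.coe_rpow_of_nonneg _ hp1.le, ← ENNReal.rpow_mul, hpp.sub_one_mul_conj]
    rw [e1] at key
    have h1 : X ≤ L * X ^ (1 / p') := by
      refine le_trans (lintegral_mono fun x => ?_) key
      rw [← ENNReal.coe_mul, ← ENNReal.coe_rpow_of_nonneg _ hp.le, ENNReal.coe_le_coe]
      calc g N x ^ p = g N x * g N x ^ (p - 1) := by
            by_cases h0 : g N x = 0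
            · rw [h0, NNReal.zero_rpow hp.ne', zero_mul]
            · rw [NNReal.rpow_sub h0, NNReal.rpow_one, mul_div_cancel₀ _ h0]
        _ ≤ _ := by gcongr; exact hgle N x
    by_cases hX0 : X = 0
    · rw [hX0]; exact zero_le
    have hX' : X ^ (1 / p') ≠ 0 := (ENNReal.rpow_pos (pos_iff_ne_zero.2 hX0) hXt).ne'
    have hXt' : X ^ (1 / p') ≠ ∞ := ENNReal.rpow_ne_top_of_nonneg (by positivity) hXt
    have h2 : X ^ (1 / p) ≤ L := by
      refine (ENNReal.mul_le_mul_iff_left hX' hXt').1 (le_trans (le_of_eq ?_) h1)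
      rw [← ENNReal.rpow_add _ _ hX0 hXt, one_div, one_div, hpp.inv_add_inv_eq_one,
        ENNReal.rpow_one]
    have h3 := ENNReal.rpow_le_rpow h2 hp.le
    rwa [← ENNReal.rpow_mul, one_div_mul_cancel hp.ne', ENNReal.rpow_one] at h3
  have hlim : ∀ x, Tendsto (fun N => (g N x : ℝ≥0∞) ^ p) atTop (𝓝 ((h x : ℝ≥0∞) ^ p)) := by
    intro x
    refine tendsto_const_nhds.congr' ?_
    obtain ⟨N₁, hN₁⟩ := exists_nat_ge (h x)
    obtain ⟨N₂, hN₂⟩ := exists_nat_gt ‖x‖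
    filter_upwards [eventually_ge_atTop N₁, eventually_ge_atTop N₂] with N h1 h2
    have hx : x ∈ box 0 ((N : ℝ) + 1) := by
      refine mem_box_of_norm_lt ?_
      rw [sub_zero]
      have : (N₂ : ℝ) ≤ N := by exact_mod_cast h2
      linarith
    have hN : h x ≤ N := hN₁.trans (by exact_mod_cast h1)
    simp only [g, indicator_of_mem hx, min_eq_left hN]
  have hmono : ∀ x, Monotone fun N => (g N x : ℝ≥0∞) ^ p := by
    intro x N N' hN
    have hN' : (N : ℝ) ≤ N' := by exact_mod_cast hN
    refine ENNReal.rpow_le_rpow ?_ hp.le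
    rw [ENNReal.coe_le_coe]
    by_cases hx : x ∈ box 0 ((N : ℝ) + 1)
    · have hx' : x ∈ box 0 ((N' : ℝ) + 1) := box_mono _ (by linarith) hx
      simp only [g, indicator_of_mem hx, indicator_of_mem hx']
      exact min_le_min_left _ (by exact_mod_cast hN)
    · rw [hg0 N x hx]; exact zero_le
  refine le_of_tendsto' (lintegral_tendsto_of_tendsto_of_monotone
    (fun N => ((hgm N).coe_nnreal_ennreal.pow_const p).aemeasurable)
    (ae_of_all _ hmono) (ae_of_all _ hlim)) hbd

/-- The weighted `L^p` estimate for commutators with `BMO` functions. -/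
theorem IsCZPair.exists_lintegral_comm_rpow_le [NeZero n] {T : LqOp n q} {K : Euc n → Euc n → ℂ}
    {C : ℝ} (hT : IsCZPair T K C) (hqtop : q ≠ ∞) {p p' : ℝ} {w v : Euc n → ℝ≥0}
    {A : ℝ≥0∞} (h : WeightPair p p' w v A) :
    ∃ L : ℝ≥0∞, L ≠ ∞ ∧ ∀ b f : Euc n → ℂ, LocallyIntegrable b volume → bmoSeminorm b ≠ ∞ →
      MemLp f q volume → MemLp (fun x => b x * f x) q volume →
      Bornology.IsBounded (Function.support f) →
      ∫⁻ x, ‖comm T b f x‖ₑ ^ p ∂(wm w) ≤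
        (L * bmoSeminorm b) ^ p * ∫⁻ x, ‖f x‖ₑ ^ p ∂(wm w) := by
  have hp := h.conj.pos
  obtain ⟨L, hL, hmain⟩ := hT.exists_lintegral_comm_mul_le hqtop h
  refine ⟨L, hL, fun b f hb hβ hf hbf hsupp => ?_⟩
  obtain ⟨R₀, hR₀, hsub⟩ := hsupp.exists_subset_box 0
  -- The sparse bound asks for a measurable function that vanishes everywhere off a box; this
  -- representative changes `f` only on a null set.
  set f' : Euc n → ℂ := (box 0 R₀).indicator (hf.1.mk f)
  have hff' : f =ᵐ[volume] f' := by
    filter_upwards [hf.1.ae_eq_mk] with x hx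
    by_cases hx' : x ∈ box 0 R₀
    · simp only [f', indicator_of_mem hx', hx]
    · simp only [f', indicator_of_notMem hx']
      by_contra h0
      exact hx' (hsub R₀ le_rfl h0)
  have hf'm : Measurable f' := hf.1.stronglyMeasurable_mk.measurable.indicator (measurableSet_box _ _)
  have hbff' : (fun x => b x * f x) =ᵐ[volume] fun x => b x * f' x := by
    filter_upwards [hff'] with x hx
    rw [hx]
  have hcomm : AEMeasurable (fun x => ‖comm T b f x‖₊) volume :=
    (aestronglyMeasurable_comm T hb.aestronglyMeasurable f).nnnorm.aemeasurable
  set u := hcomm.mk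
  have hu : ∀ᵐ x ∂(wm w), (u x : ℝ≥0∞) = ‖comm T b f x‖ₑ := by
    filter_upwards [(wm_absolutelyContinuous w).ae_le hcomm.ae_eq_mk] with x hx
    exact congrArg _ hx.symm
  have e1 : ∫⁻ x, ‖comm T b f x‖ₑ ^ p ∂(wm w) = ∫⁻ x, (u x : ℝ≥0∞) ^ p ∂(wm w) :=
    lintegral_congr_ae (by filter_upwards [hu] with x hx; rw [hx])
  have e2 : ∫⁻ x, ‖f x‖ₑ ^ p ∂(wm w) = ∫⁻ x, ‖f' x‖ₑ ^ p ∂(wm w) :=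
    lintegral_congr_ae (by
      filter_upwards [(wm_absolutelyContinuous w).ae_le hff'] with x hx; rw [hx])
  have e3 : L * bmoSeminorm b * (∫⁻ x, ‖f' x‖ₑ ^ p ∂(wm w)) ^ (1 / p) =
      ((L * bmoSeminorm b) ^ p * ∫⁻ x, ‖f x‖ₑ ^ p ∂(wm w)) ^ (1 / p) := by
    rw [e2, ENNReal.mul_rpow_of_nonneg _ _ (by positivity), ← ENNReal.rpow_mul,
      mul_one_div_cancel hp.ne', ENNReal.rpow_one]
  rw [e1]
  refine (lintegral_rpow_le_of_forall_lintegral_mul_le h.conj (fun r => h.fin_left 0 r)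
    hcomm.measurable_mk (L := L * bmoSeminorm b * (∫⁻ x, ‖f' x‖ₑ ^ p ∂(wm w)) ^ (1 / p))
    fun R G hG hG0 => ?_).trans (le_of_eq ?_)
  · set R' := max R R₀
    have hR' : 0 < R' := hR₀.trans_le (le_max_right _ _)
    have := hmain b f' hb hβ hf'm (hf.ae_eq hff') (hbf.ae_eq hbff') G hG (0, R') hR'
      fun y hy => indicator_of_notMem (fun hy' => hy (box_mono _ (le_max_right _ _) hy')) _
    rw [← comm_congr T hff'] at this
    rw [mul_assoc]
    refine le_trans (le_of_eq ?_) this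
    rw [← lintegral_indicator (measurableSet_box _ _)]
    refine lintegral_congr_ae ?_
    filter_upwards [hu] with x hx
    by_cases hx' : x ∈ box 0 R'
    · rw [indicator_of_mem hx']
      exact congrArg (· * (G x : ℝ≥0∞)) hx
    · rw [indicator_of_notMem hx', hG0 x fun h' => hx' (box_mono _ (le_max_left _ _) h')]
      simp
  · rw [e3, ← ENNReal.rpow_mul, one_div_mul_cancel hp.ne', ENNReal.rpow_one]

end CZCommutator

namespace CZCommutator

open Set Filter Topology
open scoped NNReal

set_option linter.unusedSectionVars false

variable {n : ℕ} {p q : ℝ≥0∞} [Fact (1 ≤ p)] [Fact (1 ≤ q)]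

/-! ### Muckenhoupt weights and weight pairs -/

/-- The constant of the pair is `[ω] ^ (1 / p)`: take the `p`-th root of the `A_p` condition and
multiply by the volume, split as `V ^ (1 / p) * V ^ (1 / p')`. -/
theorem IsMuckenhoupt.exists_weightPair [NeZero n] {p : ℝ} (hp : 1 < p) {ω : Euc n → ℝ}
    (hω : IsMuckenhoupt p ω) :
    ∃ (w v : Euc n → ℝ≥0) (A : ℝ≥0∞), WeightPair p p.conjExponent w v A ∧
      weightMeasure ω = wm w := by
  set p' := p.conjExponent
  have hpp : p.HolderConjugate p' := Real.HolderConjugate.conjExponent hp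
  have hp0 := hpp.pos
  have hp0' := hpp.symm.pos
  have hωm := hω.isWeight.locallyIntegrable.aestronglyMeasurable.aemeasurable
  set ω' := hωm.mk
  have hω'm : Measurable ω' := hωm.measurable_mk
  -- A measurable representative; the value `1` on the null set where it is not positive makes the
  -- duality relation hold at every point.
  set w : Euc n → ℝ≥0 := fun x => if 0 < ω' x then (ω' x).toNNReal else 1
  set v : Euc n → ℝ≥0 := fun x => w x ^ (-(p' / p))
  have hw : Measurable w :=
    Measurable.ite (measurableSet_lt measurable_const hω'm) hω'm.real_toNNReal measurable_const
  have hv : Measurable v := hw.pow_const _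
  have hw0 : ∀ x, w x ≠ 0 := fun x => by
    by_cases hx : 0 < ω' x
    · simp only [w, if_pos hx]
      exact (Real.toNNReal_pos.2 hx).ne'
    · simp only [w, if_neg hx]
      exact one_ne_zero
  have hww : ∀ᵐ x, ENNReal.ofReal (ω x) = w x := by
    filter_upwards [hωm.ae_eq_mk, hω.isWeight.pos] with x h1 h2
    have h3 : 0 < ω' x := by
      change ω x = ω' x at h1
      rwa [← h1]
    simp only [w, if_pos h3]
    rw [h1]
    rfl
  have hvv : ∀ᵐ x, ENNReal.ofReal (ω x) ^ (-(p' / p)) = v x := by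
    filter_upwards [hww] with x hx
    rw [hx, ← ENNReal.coe_rpow_of_ne_zero (hw0 x)]
  have hμ : weightMeasure ω = wm w := withDensity_congr_ae hww
  have hwb : ∀ c r, wm w (box c r) = ∫⁻ x in box c r, ENNReal.ofReal (ω x) := fun c r => by
    rw [← hμ, weightMeasure, withDensity_apply _ (measurableSet_box c r)]
  have hvb : ∀ c r, wm v (box c r) = ∫⁻ x in box c r, ENNReal.ofReal (ω x) ^ (-(p' / p)) :=
    fun c r => by
    rw [wm, withDensity_apply _ (measurableSet_box c r)]
    exact lintegral_congr_ae (ae_restrict_of_ae (hvv.mono fun x hx => hx.symm))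
  have hfin : ∀ c r, wm w (box c r) ≠ ∞ := fun c r => by
    rw [hwb]
    have : IntegrableOn ω (box c r) volume :=
      (hω.isWeight.locallyIntegrable.integrableOn_isCompact (isCompact_cube c r)).mono_set
        (box_subset_cube c r)
    exact this.lintegral_lt_top.ne
  have hap : ∀ c r, 0 < r → wm w (box c r) / volume (box c r) *
      (wm v (box c r) / volume (box c r)) ^ (p / p') ≤ apConst p ω := fun c r hr => by
    have h : (⨍⁻ x in cube c r, ENNReal.ofReal (ω x) ∂volume) *
        (⨍⁻ x in cube c r, ENNReal.ofReal (ω x) ^ (-(p' / p)) ∂volume) ^ (p / p') ≤ apConst p ω :=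
      le_iSup_of_le c (le_iSup_of_le r (le_iSup_of_le hr le_rfl))
    rwa [← Measure.restrict_congr_set (box_ae_eq_cube c r), setLAverage_eq, setLAverage_eq,
      ← hwb, ← hvb] at h
  have hA := hω.apConst_lt_top.ne
  have hwpos : ∀ c r, 0 < r → wm w (box c r) ≠ 0 := fun c r hr h0 => by
    have : volume ≪ wm w := withDensity_absolutelyContinuous'
      hw.coe_nnreal_ennreal.aemeasurable (ae_of_all _ fun x => by simpa using hw0 x)
    exact (volume_box_pos c hr).ne' (this h0)
  -- As `w` has positive mass on a box, infinite mass of `v` would make the `A_p` product infinite.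
  have hvfin : ∀ c r, 0 < r → wm v (box c r) ≠ ∞ := fun c r hr htop => by
    have h1 := hap c r hr
    rw [htop, ENNReal.top_div_of_ne_top (volume_box_ne_top c r),
      ENNReal.top_rpow_of_pos (by positivity), ENNReal.mul_top, top_le_iff] at h1
    · exact hA h1
    · exact ENNReal.div_ne_zero.2 ⟨hwpos c r hr, volume_box_ne_top c r⟩
  refine ⟨w, v, apConst p ω ^ (1 / p), ⟨hpp, hw, hv, fun x => ?_,
    ENNReal.rpow_ne_top_of_nonneg (by positivity) hA, hfin, fun c r => ?_, fun c r hr => ?_⟩, hμ⟩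
  · simp only [v]
    rw [← NNReal.rpow_mul, ← NNReal.rpow_add (hw0 x)]
    have : 1 / p + -(p' / p) * (1 / p') = 0 := by field_simp; ring
    rw [this, NNReal.rpow_zero]
  · exact ne_top_of_le_ne_top (hvfin c (max r 1) (by positivity))
      (measure_mono (box_mono c (le_max_left _ _)))
  · set V := volume (box c r)
    have hV0 : V ≠ 0 := (volume_box_pos c hr).ne'
    have hVt : V ≠ ∞ := volume_box_ne_top c r
    have h1 := ENNReal.rpow_le_rpow (hap c r hr) (z := 1 / p) (by positivity)
    rw [ENNReal.mul_rpow_of_nonneg _ _ (by positivity), ← ENNReal.rpow_mul,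
      ENNReal.div_rpow_of_nonneg _ _ (by positivity)] at h1
    have e : p / p' * (1 / p) = 1 / p' := by field_simp
    rw [e, ENNReal.div_rpow_of_nonneg _ _ (by positivity)] at h1
    have hVV : V = V ^ (1 / p) * V ^ (1 / p') := by
      rw [← ENNReal.rpow_add _ _ hV0 hVt, one_div, one_div, hpp.inv_add_inv_eq_one,
        ENNReal.rpow_one]
    have f1 : V ^ (1 / p) ≠ 0 := (ENNReal.rpow_pos (pos_iff_ne_zero.2 hV0) hVt).ne'
    have f2 : V ^ (1 / p') ≠ 0 := (ENNReal.rpow_pos (pos_iff_ne_zero.2 hV0) hVt).ne'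
    have g1 : V ^ (1 / p) ≠ ∞ := ENNReal.rpow_ne_top_of_nonneg (by positivity) hVt
    have g2 : V ^ (1 / p') ≠ ∞ := ENNReal.rpow_ne_top_of_nonneg (by positivity) hVt
    calc wm w (box c r) ^ (1 / p) * wm v (box c r) ^ (1 / p')
        = (wm w (box c r) ^ (1 / p) / V ^ (1 / p) * V ^ (1 / p)) *
          (wm v (box c r) ^ (1 / p') / V ^ (1 / p') * V ^ (1 / p')) := by
          rw [ENNReal.div_mul_cancel f1 g1, ENNReal.div_mul_cancel f2 g2]
      _ = (wm w (box c r) ^ (1 / p) / V ^ (1 / p) * (wm v (box c r) ^ (1 / p') / V ^ (1 / p'))) *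
          (V ^ (1 / p) * V ^ (1 / p')) := by ring
      _ ≤ _ := by rw [← hVV]; exact mul_le_mul_left h1 _

theorem WeightPair.isLocallyFiniteMeasure {p p' : ℝ} {w v : Euc n → ℝ≥0} {A : ℝ≥0∞}
    (h : WeightPair p p' w v A) : IsLocallyFiniteMeasure (wm w) :=
  ⟨fun x => ⟨box x 1, mem_of_superset ((isOpen_openCube x 1).mem_nhds fun i => by simp)
    fun y hy i => ⟨by linarith [(abs_lt.1 (hy i)).1], by linarith [(abs_lt.1 (hy i)).2]⟩,
    (h.fin_left x 1).lt_top⟩⟩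

/-! ### The seminorm -/

theorem bmoSeminorm_le_of_bound {g : Euc n → ℂ} {M : ℝ≥0∞} (hg : ∀ x, ‖g x‖ₑ ≤ M) :
    bmoSeminorm g ≤ 2 * M := by
  have havg : ∀ (c : Euc n) (r : ℝ) (f : Euc n → ℝ≥0∞) (L : ℝ≥0∞), (∀ x, f x ≤ L) →
      (∫⁻ x in box c r, f x) / volume (box c r) ≤ L := fun c r f L hf => by
    refine ENNReal.div_le_of_le_mul ?_
    calc ∫⁻ x in box c r, f x ≤ ∫⁻ _ in box c r, L := lintegral_mono hf
      _ = _ := by rw [lintegral_const, Measure.restrict_apply_univ]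
  refine iSup_le fun c => iSup_le fun r => iSup_le fun hr => ?_
  rw [← Measure.restrict_congr_set (box_ae_eq_cube c r), setLAverage_eq]
  refine havg c r _ _ fun x => enorm_sub_le.trans ?_
  rw [two_mul]
  exact add_le_add (hg x) ((enorm_setAverage_le g _).trans (havg c r _ _ hg))

theorem bmoSeminorm_add_le {b g : Euc n → ℂ} (hb : LocallyIntegrable b volume)
    (hg : LocallyIntegrable g volume) :
    bmoSeminorm (fun x => b x + g x) ≤ bmoSeminorm b + bmoSeminorm g := by
  refine iSup_le fun c => iSup_le fun r => iSup_le fun hr => ?_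
  have hV0 : volume (box c r) ≠ 0 := (volume_box_pos c hr).ne'
  have hVt := volume_box_ne_top c r
  rw [← Measure.restrict_congr_set (box_ae_eq_cube c r), setLAverage_eq,
    ENNReal.div_le_iff hV0 hVt, add_mul]
  have hav : ⨍ y in box c r, (b y + g y) = (⨍ y in box c r, b y) + ⨍ y in box c r, g y := by
    rw [setAverage_eq, setAverage_eq, setAverage_eq,
      integral_add (hb.integrableOn_box c r) (hg.integrableOn_box c r), smul_add]
  refine le_trans ?_ (add_le_add (lintegral_sub_average_le b c hr) (lintegral_sub_average_le g c hr))
  have hm : AEMeasurable (fun x => ‖b x - ⨍ y in box c r, b y‖ₑ) (volume.restrict (box c r)) :=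
    (hb.aestronglyMeasurable.sub aestronglyMeasurable_const).enorm.restrict
  rw [← lintegral_add_left' hm]
  refine lintegral_mono fun x => ?_
  rw [hav, add_sub_add_comm]
  exact enorm_add_le _ _

theorem bmoSeminorm_ne_top_of_continuous {φ : Euc n → ℂ} (hφ : Continuous φ)
    (hc : HasCompactSupport φ) : bmoSeminorm φ ≠ ∞ := by
  obtain ⟨M, hM⟩ := hc.exists_bound_of_continuous hφ
  refine ne_top_of_le_ne_top (b := 2 * ENNReal.ofReal M) (by finiteness)
    (bmoSeminorm_le_of_bound fun x => ?_)
  rw [← ofReal_norm]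
  exact ENNReal.ofReal_le_ofReal (hM x)

/-! ### Bounded functions with compact support -/

/-- Bounded measurable functions with compact support. -/
def boundedCompact (n : ℕ) : Submodule ℂ (Euc n → ℂ) where
  carrier := {f | MemLp f ∞ volume ∧ HasCompactSupport f}
  add_mem' hf hg := ⟨hf.1.add hg.1, hf.2.add hg.2⟩
  zero_mem' := ⟨MemLp.zero, HasCompactSupport.zero⟩
  smul_mem' c _ hf := ⟨hf.1.const_smul c, hf.2.smul_left (f := fun _ => c)⟩

theorem memLp_of_mem_boundedCompact {f : Euc n → ℂ} (hf : f ∈ boundedCompact n)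
    {μ : Measure (Euc n)} (hμ : μ ≪ volume) [IsLocallyFiniteMeasure μ] (r : ℝ≥0∞) :
    MemLp f r μ := by
  have h1 : MemLp f ∞ μ := ⟨hf.1.1.mono_ac hμ, by
    have := hf.1.2
    rw [eLpNorm_exponent_top] at this ⊢
    exact (eLpNormEssSup_mono_measure f hμ).trans_lt this⟩
  exact h1.mono_exponent_of_measure_support_ne_top
    (fun x hx => image_eq_zero_of_notMem_tsupport hx) hf.2.measure_lt_top.ne le_top

theorem isBounded_support_of_mem_boundedCompact {f : Euc n → ℂ} (hf : f ∈ boundedCompact n) :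
    Bornology.IsBounded (Function.support f) :=
  hf.2.isCompact.isBounded.subset (subset_tsupport f)

/-- `b` need not be bounded. John–Nirenberg for Lebesgue measure, with `θ = 1 / 2`, puts `b - a` in
`L^q` of a box containing the support of `f`. -/
theorem memLp_mul_of_bmo [NeZero n] {b f : Euc n → ℂ} (hqtop : q ≠ ∞)
    (hb : LocallyIntegrable b volume) (hβ : bmoSeminorm b ≠ ∞) (hf : f ∈ boundedCompact n) :
    MemLp (fun x => b x * f x) q volume := by
  obtain ⟨R, hR, hsub⟩ := (isBounded_support_of_mem_boundedCompact hf).exists_subset_box 0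
  have hq0 : q ≠ 0 := (zero_lt_one.trans_le Fact.out).ne'
  have hqr : 0 < q.toReal := ENNReal.toReal_pos hq0 hqtop
  obtain ⟨C, hC, hJN⟩ := exists_lintegral_oscillation_le (μ := (volume : Measure (Euc n)))
    (θ := 2⁻¹) (by positivity) (by rw [← NNReal.coe_lt_coe]; push_cast; norm_num) volume_box_ne_top
    (fun c r hr E _ _ hE => by
      have := mul_le_mul_right hE (2⁻¹ : ℝ≥0∞)
      rw [← mul_assoc, ENNReal.inv_mul_cancel (by norm_num) (by norm_num), one_mul] at this
      rwa [ENNReal.coe_inv (by norm_num), ENNReal.coe_ofNat]) hqr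
  set a := ⨍ y in box 0 R, b y
  have h1 : MemLp ((box 0 R).indicator fun x => b x - a) q volume := by
    rw [memLp_indicator_iff_restrict (measurableSet_box _ _)]
    refine ⟨(hb.aestronglyMeasurable.sub aestronglyMeasurable_const).restrict, ?_⟩
    rw [eLpNorm_lt_top_iff_lintegral_rpow_enorm_lt_top hq0 hqtop]
    refine (hJN b hb hβ 0 R hR).trans_lt ?_
    have := volume_box_ne_top (0 : Euc n) R
    have := ENNReal.rpow_ne_top_of_nonneg hqr.le hβ
    exact (by finiteness : C * bmoSeminorm b ^ q.toReal * volume (box (0 : Euc n) R) ≠ ∞).lt_top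
  have h2 : MemLp (fun x => f x * (box 0 R).indicator (fun x => b x - a) x) q volume :=
    h1.mul' hf.1
  have h3 : MemLp f q volume := memLp_of_mem_boundedCompact hf Measure.AbsolutelyContinuous.rfl q
  have e : (fun x => b x * f x) =
      fun x => f x * (box 0 R).indicator (fun x => b x - a) x + a * f x := by
    ext x
    by_cases hx : f x = 0
    · simp [hx]
    · rw [indicator_of_mem (hsub R le_rfl hx)]
      ring
  rw [e]
  exact h2.add (h3.const_mul a)

end CZCommutator

namespace CZCommutator

open Set Filter Topology
open scoped NNReal

set_option linter.unusedSectionVars false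

variable {n : ℕ} {p q : ℝ≥0∞} [Fact (1 ≤ p)] [Fact (1 ≤ q)]

/-! ### The commutator as a bounded operator -/

/-- The inclusion of the bounded compactly supported functions into `L^p(μ)`. -/
noncomputable def toLpMap (p : ℝ≥0∞) [Fact (1 ≤ p)] {μ : Measure (Euc n)} (hμ : μ ≪ volume)
    [IsLocallyFiniteMeasure μ] : boundedCompact n →ₗ[ℂ] Lp ℂ p μ where
  toFun f := (memLp_of_mem_boundedCompact f.2 hμ p).toLp f
  map_add' f g := MemLp.toLp_add (memLp_of_mem_boundedCompact f.2 hμ p)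
    (memLp_of_mem_boundedCompact g.2 hμ p)
  map_smul' c f := MemLp.toLp_const_smul c (memLp_of_mem_boundedCompact f.2 hμ p)

theorem denseRange_toLpMap (hp : p ≠ ∞) {μ : Measure (Euc n)} (hμ : μ ≪ volume)
    [IsLocallyFiniteMeasure μ] : DenseRange (toLpMap p hμ) := by
  intro F
  rw [EMetric.mem_closure_iff]
  intro ε hε
  -- The distance `ε` lives in `[0, ∞]`; the minimum with `1` deals with `ε = ∞`, where halving
  -- gives nothing smaller.
  obtain ⟨g, hgc, hg, hgcont, hgm⟩ := (Lp.memLp F).exists_hasCompactSupport_eLpNorm_sub_le hp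
    (ε := min (ε / 2) 1) (lt_min (ENNReal.half_pos hε.ne') one_pos).ne'
  have hgb : g ∈ boundedCompact n :=
    ⟨hgcont.memLp_of_hasCompactSupport hgc, hgc⟩
  refine ⟨_, ⟨⟨g, hgb⟩, rfl⟩, ?_⟩
  rw [Lp.edist_def]
  have : eLpNorm (⇑F - ⇑(toLpMap p hμ ⟨g, hgb⟩)) p μ = eLpNorm (⇑F - g) p μ :=
    eLpNorm_congr_ae ((ae_eq_refl _).sub
      (MemLp.coeFn_toLp (memLp_of_mem_boundedCompact hgb hμ p)))
  rw [this]
  refine hg.trans_lt ?_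
  rcases eq_or_ne ε ∞ with rfl | hεt
  · exact (min_le_right _ _).trans_lt ENNReal.one_lt_top
  · exact (min_le_left _ _).trans_lt (ENNReal.half_lt_self hε.ne' hεt)

theorem opNorm_le_of_toLpMap (hp : p ≠ ∞) {μ : Measure (Euc n)} (hμ : μ ≪ volume)
    [IsLocallyFiniteMeasure μ] (S : Lp ℂ p μ →L[ℂ] Lp ℂ p μ) {C : ℝ} (hC : 0 ≤ C)
    (hS : ∀ f, ‖S (toLpMap p hμ f)‖ ≤ C * ‖toLpMap p hμ f‖) : ‖S‖ ≤ C := by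
  refine S.opNorm_le_bound hC fun F => ?_
  refine (denseRange_toLpMap hp hμ).induction_on F ?_ hS
  exact isClosed_le (by fun_prop) (by fun_prop)

theorem comm_const_mul (T : LqOp n q) {b f : Euc n → ℂ} (hf : MemLp f q volume)
    (hbf : MemLp (fun x => b x * f x) q volume) (c : ℂ) :
    comm T b (fun x => c * f x) =ᵐ[volume] fun x => c * comm T b f x := by
  have e : (fun y => b y * (c * f y)) = fun y => c * (b y * f y) := by ext y; ring
  filter_upwards [app_const_mul T hf c, app_const_mul T hbf c] with x h1 h2
  simp only [comm]
  rw [e, h1, h2]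
  ring

/-- The estimate for commutators in terms of `L^p` norms. -/
theorem IsCZPair.exists_eLpNorm_comm_le [NeZero n] {T : LqOp n q} {K : Euc n → Euc n → ℂ}
    {C : ℝ} (hT : IsCZPair T K C) (hqtop : q ≠ ∞) (hp : p ≠ ∞) {p' : ℝ} {w v : Euc n → ℝ≥0}
    {A : ℝ≥0∞} (h : WeightPair p.toReal p' w v A) :
    ∃ L : ℝ≥0∞, L ≠ ∞ ∧ ∀ b f : Euc n → ℂ, LocallyIntegrable b volume → bmoSeminorm b ≠ ∞ →
      MemLp f q volume → MemLp (fun x => b x * f x) q volume →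
      Bornology.IsBounded (Function.support f) →
      eLpNorm (comm T b f) p (wm w) ≤ L * bmoSeminorm b * eLpNorm f p (wm w) := by
  have hp0 : p ≠ 0 := (zero_lt_one.trans_le Fact.out).ne'
  have hpr := h.conj.pos
  obtain ⟨L, hL, hmain⟩ := hT.exists_lintegral_comm_rpow_le hqtop h
  refine ⟨L, hL, fun b f hb hβ hf hbf hs => ?_⟩
  rw [eLpNorm_eq_lintegral_rpow_enorm_toReal hp0 hp, eLpNorm_eq_lintegral_rpow_enorm_toReal hp0 hp]
  refine (ENNReal.rpow_le_rpow (hmain b f hb hβ hf hbf hs) (by positivity)).trans (le_of_eq ?_)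
  rw [ENNReal.mul_rpow_of_nonneg _ _ (by positivity), ← ENNReal.rpow_mul,
    mul_one_div_cancel hpr.ne', ENNReal.rpow_one]

/-- `S` is the bounded extension of the commutator to `L^p(μ)`. -/
def IsCommOn (μ : Measure (Euc n)) (b : Euc n → ℂ) (T : LqOp n q)
    (S : Lp ℂ p μ →L[ℂ] Lp ℂ p μ) : Prop :=
  ∀ f : Euc n → ℂ, MemLp f ∞ volume → HasCompactSupport f →
    ∃ (hω : MemLp f p μ) (hf : MemLp f q volume) (hbf : MemLp (fun x => b x * f x) q volume),
      ∀ᵐ x, S (hω.toLp f) x = b x * T (hf.toLp f) x - T (hbf.toLp (fun x => b x * f x)) x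

theorem IsCommOn.ae_eq {μ : Measure (Euc n)} (hμ : μ ≪ volume) [IsLocallyFiniteMeasure μ]
    {b : Euc n → ℂ} {T : LqOp n q} {S : Lp ℂ p μ →L[ℂ] Lp ℂ p μ} (hS : IsCommOn μ b T S)
    (f : boundedCompact n) : S (toLpMap p hμ f) =ᵐ[volume] comm T b f := by
  obtain ⟨hω, hf, hbf, hx⟩ := hS f f.2.1 f.2.2
  filter_upwards [hx] with x hx
  rw [comm, app_of_memLp T hf, app_of_memLp T hbf, ← hx]
  rfl

theorem IsCommOn.unique (hp : p ≠ ∞) {μ : Measure (Euc n)} (hμ : μ ≪ volume)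
    [IsLocallyFiniteMeasure μ] {b : Euc n → ℂ} {T : LqOp n q} {S S' : Lp ℂ p μ →L[ℂ] Lp ℂ p μ}
    (hS : IsCommOn μ b T S) (hS' : IsCommOn μ b T S') : S = S' := by
  have h : (S : Lp ℂ p μ → Lp ℂ p μ) = S' :=
    (denseRange_toLpMap hp hμ).equalizer S.continuous S'.continuous (funext fun f =>
      Lp.ext (hμ.ae_le ((hS.ae_eq hμ f).trans (hS'.ae_eq hμ f).symm)))
  exact DFunLike.coe_injective h

theorem IsCZPair.exists_isCommOn [NeZero n] {T : LqOp n q} {K : Euc n → Euc n → ℂ}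
    {C : ℝ} (hT : IsCZPair T K C) (hqtop : q ≠ ∞) (hp : p ≠ ∞) {p' : ℝ} {w v : Euc n → ℝ≥0}
    {A : ℝ≥0∞} (h : WeightPair p.toReal p' w v A) {b : Euc n → ℂ}
    (hb : LocallyIntegrable b volume) (hβ : bmoSeminorm b ≠ ∞) :
    ∃ S : Lp ℂ p (wm w) →L[ℂ] Lp ℂ p (wm w), IsCommOn (wm w) b T S := by
  have := h.isLocallyFiniteMeasure
  have hμ := wm_absolutelyContinuous w
  obtain ⟨L, hL, hle⟩ := hT.exists_eLpNorm_comm_le hqtop hp h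
  have hq' : ∀ f : boundedCompact n, MemLp (f : Euc n → ℂ) q volume := fun f =>
    memLp_of_mem_boundedCompact f.2 Measure.AbsolutelyContinuous.rfl q
  have hbq : ∀ f : boundedCompact n, MemLp (fun x => b x * (f : Euc n → ℂ) x) q volume := fun f =>
    memLp_mul_of_bmo hqtop hb hβ f.2
  have hfp : ∀ f : boundedCompact n, MemLp (f : Euc n → ℂ) p (wm w) := fun f =>
    memLp_of_mem_boundedCompact f.2 hμ p
  have hbd := fun f : boundedCompact n => hle b f hb hβ (hq' f) (hbq f)
    (isBounded_support_of_mem_boundedCompact f.2)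
  have hLβ : L * bmoSeminorm b ≠ ∞ := by finiteness
  have hm : ∀ f : boundedCompact n, MemLp (comm T b f) p (wm w) := fun f =>
    ⟨(aestronglyMeasurable_comm T hb.aestronglyMeasurable f).mono_ac hμ,
      (hbd f).trans_lt (ENNReal.mul_lt_top hLβ.lt_top (hfp f).2)⟩
  let g : boundedCompact n →ₗ[ℂ] Lp ℂ p (wm w) :=
    { toFun := fun f => (hm f).toLp _
      map_add' := fun f f' => by
        rw [← MemLp.toLp_add]
        exact MemLp.toLp_congr _ _ (hμ.ae_le (comm_add T (hq' f) (hbq f) (hq' f') (hbq f')))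
      map_smul' := fun c f => by
        rw [RingHom.id_apply, ← MemLp.toLp_const_smul]
        exact MemLp.toLp_congr _ _ (hμ.ae_le (comm_const_mul T (hq' f) (hbq f) c)) }
  have hg : ∀ f, ‖g f‖ ≤ (L * bmoSeminorm b).toReal * ‖toLpMap p hμ f‖ := fun f => by
    change ‖(hm f).toLp _‖ ≤ _ * ‖(hfp f).toLp _‖
    rw [Lp.norm_toLp, Lp.norm_toLp, ← ENNReal.toReal_mul]
    exact ENNReal.toReal_mono (ENNReal.mul_ne_top hLβ (hfp f).2.ne) (hbd f)
  refine ⟨g.extendOfNorm (toLpMap p hμ), fun f hf1 hf2 => ?_⟩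
  set F : boundedCompact n := ⟨f, hf1, hf2⟩
  refine ⟨hfp F, hq' F, hbq F, ?_⟩
  have h1 : g.extendOfNorm (toLpMap p hμ) ((hfp F).toLp f) = (hm F).toLp _ :=
    LinearMap.extendOfNorm_eq (denseRange_toLpMap hp hμ) ⟨_, hg⟩ F
  rw [h1]
  -- The identity is required almost everywhere for Lebesgue measure, hence the absolute continuity
  -- in this direction, which holds because `w` never vanishes.
  filter_upwards [h.volume_absolutelyContinuous.ae_le (hm F).coeFn_toLp] with x hx
  rw [hx, comm, app_of_memLp T (hq' F), app_of_memLp T (hbq F)]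

end CZCommutator

namespace CZCommutator

open Set Filter Topology
open scoped NNReal

set_option linter.unusedSectionVars false

variable {n : ℕ} {p q : ℝ≥0∞} [Fact (1 ≤ p)] [Fact (1 ≤ q)]

/-! ### The part of the commutator near the diagonal -/

/-- The kernel of the commutator, cut off near the diagonal along a grid. -/
noncomputable def farKer (K : Euc n → Euc n → ℂ) (φ : Euc n → ℂ) (l : ℝ) (x y : Euc n) : ℂ :=
  (box (gridCtr 0 l x) (5 * n * l))ᶜ.indicator (fun y => (φ x - φ y) * K x y) y

/-- The cells whose dilate contains `y` are disjoint, of equal volume, and contained in `box y ((t +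
1) * l)`; comparing volumes counts them. -/
theorem tsum_indicator_box_gridCtr_le {l : ℝ} (hl : 0 < l) {t : ℝ} (ht : 0 ≤ t) (y : Euc n) :
    ∑' z : range (gridCtr (0 : Euc n) l), (box z.1 (t * l)).indicator (1 : Euc n → ℝ≥0∞) y ≤
      ENNReal.ofReal (t + 1) ^ n := by
  have hV0 : volume (box y l) ≠ 0 := (volume_box_pos y hl).ne'
  have hVt := volume_box_ne_top y l
  have : Countable (range (gridCtr (0 : Euc n) l)) := (countable_range_gridCtr 0 l).to_subtype
  classical
  set E : range (gridCtr (0 : Euc n) l) → Set (Euc n) := fun z =>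
    if y ∈ box z.1 (t * l) then box z.1 l else ∅
  have hEsub : ∀ z, E z ⊆ box z.1 l := fun z => by
    by_cases h : y ∈ box z.1 (t * l) <;> simp [E, h]
  have hd : Pairwise fun z z' => Disjoint (E z) (E z') := by
    rintro ⟨_, x, rfl⟩ ⟨_, x', rfl⟩ hne
    refine disjoint_left.2 fun u hu hu' => hne (Subtype.ext ?_)
    exact (gridCtr_eq_of_mem hl (hEsub _ hu)).symm.trans (gridCtr_eq_of_mem hl (hEsub _ hu'))
  have hm : ∀ z, MeasurableSet (E z) := fun z => by
    by_cases h : y ∈ box z.1 (t * l) <;> simp [E, h, measurableSet_box]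
  have hE : ∀ z, volume (E z) =
      (box z.1 (t * l)).indicator (1 : Euc n → ℝ≥0∞) y * volume (box y l) := fun z => by
    by_cases h : y ∈ box z.1 (t * l)
    · simp only [E, h, if_true, indicator_of_mem, Pi.one_apply, one_mul]
      rw [volume_box, volume_box]
    · simp [E, h]
  have hsub : (⋃ z, E z) ⊆ box y ((t + 1) * l) := by
    refine iUnion_subset fun z u hu i => ?_
    by_cases h : y ∈ box z.1 (t * l)
    · simp only [E, h, if_true] at hu
      have h1 := hu i
      have h2 := h i
      constructor <;> linarith
    · simp [E, h] at hu
  refine (ENNReal.mul_le_mul_iff_left hV0 hVt).1 ?_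
  calc _ = ∑' z, volume (E z) := by rw [← ENNReal.tsum_mul_right]; exact (tsum_congr hE).symm
    _ = volume (⋃ z, E z) := (measure_iUnion hd hm).symm
    _ ≤ volume (box y ((t + 1) * l)) := measure_mono hsub
    _ = _ := volume_box_mul y y (by positivity) l

theorem four_mul_le_norm_sub_of_notMem_box [NeZero n] {c x y : Euc n} {l : ℝ} (hl : 0 < l)
    (hx : x ∈ box c l) (hy : y ∉ box c (5 * n * l)) : 4 * (n * l) ≤ ‖x - y‖ := by
  have h1 := le_norm_sub_of_notMem_box hy
  have h2 := norm_sub_center_le hl.le hx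
  have h3 : ‖y - c‖ ≤ ‖x - y‖ + ‖x - c‖ := by
    rw [norm_sub_rev x y]
    exact norm_sub_le_norm_sub_add_norm_sub _ _ _
  linarith

/-- On a cell the kernel represents the contribution of `f` off the dilate `B`. The rest is a
commutator of `B.indicator f`, from whose symbol the constant `φ z` is subtracted. Because the cut
depends only on the cell of `x`, no truncated singular integral has to be estimated. -/
theorem IsCZPair.comm_sub_integral_ae_eq [NeZero n] {T : LqOp n q} {K : Euc n → Euc n → ℂ}
    {C : ℝ} (hT : IsCZPair T K C) {φ f : Euc n → ℂ} (hφ : Continuous φ) (hf : f ∈ boundedCompact n)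
    (z : Euc n) {l : ℝ} (hl : 0 < l) :
    ∀ᵐ x, x ∈ box z l → comm T φ f x -
      ∫ y, (box z (5 * n * l))ᶜ.indicator (fun y => (φ x - φ y) * K x y) y * f y =
      comm T ((box z (5 * n * l)).indicator fun x => φ x - φ z)
        ((box z (5 * n * l)).indicator f) x := by
  have hn : (1 : ℝ) ≤ n := by exact_mod_cast NeZero.one_le
  set B := box z (5 * n * l)
  have hB : MeasurableSet B := measurableSet_box _ _
  set f₁ := B.indicator f
  set f₂ := Bᶜ.indicator f
  have hsum : f = fun x => f₁ x + f₂ x := (indicator_self_add_compl B f).symm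
  have hmul : ∀ {g : Euc n → ℂ}, g ∈ boundedCompact n → ∀ {ψ : Euc n → ℂ}, Continuous ψ →
      (fun x => ψ x * g x) ∈ boundedCompact n := fun {g} hg {ψ} hψ => by
    obtain ⟨M, hM⟩ := hg.2.isCompact.exists_bound_of_continuousOn hψ.continuousOn
    have hψ' : MemLp ((tsupport g).indicator ψ) ∞ volume :=
      memLp_top_of_bound (hψ.aestronglyMeasurable.indicator (isClosed_tsupport g).measurableSet)
        (max M 0) (ae_of_all _ fun x => by
          by_cases hx : x ∈ tsupport g
          · rw [indicator_of_mem hx]; exact (hM x hx).trans (le_max_left _ _)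
          · rw [indicator_of_notMem hx, norm_zero]; exact le_max_right _ _)
    refine ⟨(hg.1.mul' hψ').ae_eq (ae_of_all _ fun x => ?_), hg.2.mul_left⟩
    by_cases hx : x ∈ tsupport g
    · simp only [indicator_of_mem hx]
    · simp only [image_eq_zero_of_notMem_tsupport hx, mul_zero]
  have hind : ∀ {g : Euc n → ℂ}, g ∈ boundedCompact n → ∀ {S : Set (Euc n)}, MeasurableSet S →
      S.indicator g ∈ boundedCompact n := fun {g} hg {S} hS =>
    ⟨hg.1.indicator hS, hg.2.mono (by simp)⟩
  have hLq : ∀ {g : Euc n → ℂ}, g ∈ boundedCompact n → ∀ r, MemLp g r volume := fun hg r =>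
    memLp_of_mem_boundedCompact hg Measure.AbsolutelyContinuous.rfl r
  have hf₁ := hind hf hB
  have hf₂ := hind hf hB.compl
  -- Removing the open cube, rather than `B`, keeps `F` compact; `F` still misses `box z l`, on
  -- which the representation is wanted.
  set F := tsupport f \ {x : Euc n | ∀ i, |x i - z i| < 5 * n * l}
  have hF : IsCompact F := hf.2.isCompact.diff (isOpen_openCube z _)
  have hopen : ∀ x, (∀ i, |x i - z i| < 5 * n * l) → x ∈ B := fun x hx i =>
    ⟨by linarith [(abs_lt.1 (hx i)).1], by linarith [(abs_lt.1 (hx i)).2]⟩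
  have hF₂ : ∀ y, y ∉ F → f₂ y = 0 := fun y hy => by
    by_cases hyB : y ∈ B
    · exact indicator_of_notMem (notMem_compl_iff.2 hyB) _
    · have : y ∉ tsupport f := fun h => hy ⟨h, fun h' => hyB (hopen y h')⟩
      simp only [f₂, indicator_of_mem (show y ∈ Bᶜ from hyB)]
      exact image_eq_zero_of_notMem_tsupport this
  have hxF : ∀ x ∈ box z l, x ∉ F := fun x hx h => h.2 fun i => by
    have := hx i
    exact abs_lt.2 ⟨by nlinarith, by nlinarith⟩
  filter_upwards [comm_add T (hLq hf₁ q) (hLq (hmul hf₁ hφ) q) (hLq hf₂ q) (hLq (hmul hf₂ hφ) q),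
    comm_sub_const T (hLq hf₁ q) (hLq (hmul hf₁ hφ) q) (φ z),
    hT.app_ae_eq (hLq hf₂ q) hF hF₂,
    hT.app_ae_eq (hLq (hmul hf₂ hφ) q) hF fun y hy => mul_eq_zero_of_right _ (hF₂ y hy)]
    with x h1 h2 h3 h4 hx
  have hxB : x ∈ B := box_subset_dilate z hl hx
  rw [← hsum] at h1
  have hd : ∀ {g : Euc n → ℂ}, (∀ y ∈ B, g y = 0) → ∀ y, g y ≠ 0 → l ≤ ‖x - y‖ :=
    fun hg y hy => by
    have hyB : y ∉ B := fun h => hy (hg y h)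
    have := four_mul_le_norm_sub_of_notMem_box hl hx hyB
    nlinarith
  have hf₂0 : ∀ y ∈ B, f₂ y = 0 := fun y hy => indicator_of_notMem (notMem_compl_iff.2 hy) _
  have hi₁ := hT.integrable_kernel_mul (memLp_one_iff_integrable.1 (hLq hf₂ 1)) (x := x) hl
    (hd hf₂0)
  have hi₂ := hT.integrable_kernel_mul (memLp_one_iff_integrable.1 (hLq (hmul hf₂ hφ) 1)) (x := x)
    hl (hd fun y hy => mul_eq_zero_of_right _ (hf₂0 y hy))
  have e2 : comm T φ f₂ x = ∫ y, Bᶜ.indicator (fun y => (φ x - φ y) * K x y) y * f y := by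
    rw [comm, h3 (hxF x hx), h4 (hxF x hx), ← integral_const_mul,
      ← integral_sub (hi₁.const_mul _) hi₂]
    congr 1
    ext y
    by_cases hy : y ∈ B
    · simp [hy]
    · simp only [indicator_of_mem (show y ∈ Bᶜ from hy)]
      ring
  rw [h1, e2, add_sub_cancel_right, h2, comm, indicator_of_mem hxB]
  congr 2
  ext y
  by_cases hy : y ∈ B <;> simp [f₁, hy]

/-- On each cell the symbol `ψ` is at most `ε` in size, so its seminorm is at most `2 * ε` and the
weighted commutator estimate gives the local bound. Bounded overlap of the dilates then permits
summation over the cells. -/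
theorem IsCZPair.exists_lintegral_comm_sub_integral_le [NeZero n] {T : LqOp n q}
    {K : Euc n → Euc n → ℂ} {C : ℝ} (hT : IsCZPair T K C) (hqtop : q ≠ ∞) {p p' : ℝ}
    {w v : Euc n → ℝ≥0} {A : ℝ≥0∞} (h : WeightPair p p' w v A) :
    ∃ L : ℝ≥0∞, L ≠ ∞ ∧ ∀ φ : Euc n → ℂ, Continuous φ → ∀ l, 0 < l → ∀ ε : ℝ≥0∞, ε ≠ ∞ →
      (∀ z, ∀ y ∈ box z (5 * n * l), ‖φ y - φ z‖ₑ ≤ ε) → ∀ f ∈ boundedCompact n,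
      ∫⁻ x, ‖comm T φ f x - ∫ y, farKer K φ l x y * f y‖ₑ ^ p ∂(wm w) ≤
        L * ε ^ p * ∫⁻ x, ‖f x‖ₑ ^ p ∂(wm w) := by
  have hp := h.conj.pos
  obtain ⟨L, hL, hmain⟩ := hT.exists_lintegral_comm_rpow_le hqtop h
  refine ⟨(L * 2) ^ p * ENNReal.ofReal (5 * n + 1) ^ n, ENNReal.mul_ne_top
    (ENNReal.rpow_ne_top_of_nonneg hp.le (by finiteness)) (by finiteness),
    fun φ hφ l hl ε hε hosc f hf => ?_⟩
  have : Countable (range (gridCtr (0 : Euc n) l)) := (countable_range_gridCtr 0 l).to_subtype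
  have hcov : (⋃ z : range (gridCtr (0 : Euc n) l), box z.1 l) = univ :=
    eq_univ_of_forall fun x => mem_iUnion.2 ⟨⟨_, x, rfl⟩, mem_box_gridCtr 0 hl x⟩
  have hfq : MemLp f q volume := memLp_of_mem_boundedCompact hf Measure.AbsolutelyContinuous.rfl q
  have hfm : AEMeasurable (fun x => ‖f x‖ₑ ^ p) (wm w) :=
    (hf.1.1.mono_ac (wm_absolutelyContinuous w)).enorm.pow_const _
  have hcell : ∀ z : range (gridCtr (0 : Euc n) l),
      ∫⁻ x in box z.1 l, ‖comm T φ f x - ∫ y, farKer K φ l x y * f y‖ₑ ^ p ∂(wm w) ≤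
        (L * 2 * ε) ^ p * ∫⁻ x in box z.1 (5 * n * l), ‖f x‖ₑ ^ p ∂(wm w) := by
    rintro ⟨_, x₀, rfl⟩
    set z := gridCtr (0 : Euc n) l x₀
    set B := box z (5 * n * l)
    set ψ : Euc n → ℂ := B.indicator fun x => φ x - φ z
    have hψ : ∀ x, ‖ψ x‖ₑ ≤ ε := fun x => by
      by_cases hx : x ∈ B
      · simp only [ψ, indicator_of_mem hx]; exact hosc z x hx
      · simp [ψ, indicator_of_notMem hx]
    have hψm : AEStronglyMeasurable ψ volume :=
      (hφ.sub continuous_const).aestronglyMeasurable.indicator (measurableSet_box _ _)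
    have hψtop : MemLp ψ ∞ volume := memLp_top_of_bound hψm ε.toReal (ae_of_all _ fun x => by
      rw [← toReal_enorm]; exact ENNReal.toReal_mono hε (hψ x))
    have hg : MemLp (B.indicator f) q volume := hfq.indicator (measurableSet_box _ _)
    have hm := hmain ψ (B.indicator f) (hψtop.locallyIntegrable le_top)
      (ne_top_of_le_ne_top (by finiteness) (bmoSeminorm_le_of_bound hψ)) hg (hg.mul' hψtop)
      ((isBounded_box _ _).subset support_indicator_subset)
    calc ∫⁻ x in box z l, ‖comm T φ f x - ∫ y, farKer K φ l x y * f y‖ₑ ^ p ∂(wm w)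
        ≤ ∫⁻ x in box z l, ‖comm T ψ (B.indicator f) x‖ₑ ^ p ∂(wm w) := by
          refine lintegral_mono_ae ((ae_restrict_iff' (measurableSet_box _ _)).2 ?_)
          filter_upwards [(wm_absolutelyContinuous w).ae_le
            (hT.comm_sub_integral_ae_eq hφ hf z hl)] with x hx hxz
          rw [← hx hxz]
          simp only [farKer, gridCtr_eq_of_mem hl hxz]
          exact le_rfl
      _ ≤ ∫⁻ x, ‖comm T ψ (B.indicator f) x‖ₑ ^ p ∂(wm w) := setLIntegral_le_lintegral _ _
      _ ≤ (L * bmoSeminorm ψ) ^ p * ∫⁻ x, ‖B.indicator f x‖ₑ ^ p ∂(wm w) := hm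
      _ ≤ (L * 2 * ε) ^ p * ∫⁻ x, ‖B.indicator f x‖ₑ ^ p ∂(wm w) := by
          refine mul_le_mul_left (ENNReal.rpow_le_rpow ?_ hp.le) _
          rw [mul_assoc]
          exact mul_le_mul_right (bmoSeminorm_le_of_bound hψ) _
      _ = _ := by
          rw [← lintegral_indicator (measurableSet_box _ _)]
          congr 1
          refine lintegral_congr fun x => ?_
          by_cases hx : x ∈ B
          · rw [indicator_of_mem hx]
            exact (indicator_of_mem hx fun x => ‖f x‖ₑ ^ p).symm
          · rw [indicator_of_notMem hx, enorm_zero, ENNReal.zero_rpow_of_pos hp]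
            exact (indicator_of_notMem hx fun x => ‖f x‖ₑ ^ p).symm
  calc ∫⁻ x, ‖comm T φ f x - ∫ y, farKer K φ l x y * f y‖ₑ ^ p ∂(wm w)
      = ∫⁻ x in ⋃ z : range (gridCtr (0 : Euc n) l), box z.1 l,
        ‖comm T φ f x - ∫ y, farKer K φ l x y * f y‖ₑ ^ p ∂(wm w) := by
        rw [hcov, setLIntegral_univ]
    _ ≤ ∑' z : range (gridCtr (0 : Euc n) l), ∫⁻ x in box z.1 l,
        ‖comm T φ f x - ∫ y, farKer K φ l x y * f y‖ₑ ^ p ∂(wm w) := lintegral_iUnion_le _ _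
    _ ≤ ∑' z : range (gridCtr (0 : Euc n) l),
        (L * 2 * ε) ^ p * ∫⁻ x in box z.1 (5 * n * l), ‖f x‖ₑ ^ p ∂(wm w) :=
        ENNReal.tsum_le_tsum hcell
    _ = (L * 2 * ε) ^ p * ∫⁻ x, (∑' z : range (gridCtr (0 : Euc n) l),
        (box z.1 (5 * n * l)).indicator 1 x) * ‖f x‖ₑ ^ p ∂(wm w) := by
        rw [ENNReal.tsum_mul_left]
        congr 1
        simp_rw [← ENNReal.tsum_mul_right]
        have hm : ∀ z : range (gridCtr (0 : Euc n) l), AEMeasurable (fun x =>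
            (box z.1 (5 * n * l)).indicator (1 : Euc n → ℝ≥0∞) x * ‖f x‖ₑ ^ p) (wm w) := fun z =>
          (measurable_one.indicator (measurableSet_box _ _)).aemeasurable.mul hfm
        rw [lintegral_tsum hm]
        refine tsum_congr fun z => ?_
        rw [← lintegral_indicator (measurableSet_box _ _)]
        refine lintegral_congr fun x => ?_
        by_cases hx : x ∈ box z.1 (5 * n * l) <;> simp [hx]
    _ ≤ (L * 2 * ε) ^ p * ∫⁻ x, ENNReal.ofReal (5 * n + 1) ^ n * ‖f x‖ₑ ^ p ∂(wm w) := by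
        refine mul_le_mul_right (lintegral_mono fun x => ?_) _
        exact mul_le_mul_left (tsum_indicator_box_gridCtr_le hl (by positivity) x) _
    _ = _ := by
        rw [lintegral_const_mul'' _ hfm, ENNReal.mul_rpow_of_nonneg (L * 2) ε hp.le]
        ring

end CZCommutator

namespace CZCommutator

open Set Filter Topology
open scoped NNReal

set_option linter.unusedSectionVars false

variable {n : ℕ} {p q : ℝ≥0∞} [Fact (1 ≤ p)] [Fact (1 ≤ q)]

/-! ### The part of the commutator away from the diagonal -/

section kernel

variable [NeZero n] {T : LqOp n q} {K : Euc n → Euc n → ℂ} {C : ℝ} {φ : Euc n → ℂ} {M : ℝ}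

theorem gridCtr_eq_of_gridCtr_div_eq {a x z : Euc n} {l : ℝ} (hl : 0 < l) (m : ℕ)
    (h : gridCtr a (l / 2 ^ m) x = gridCtr a (l / 2 ^ m) z) : gridCtr a l x = gridCtr a l z := by
  induction m with
  | zero => simpa using h
  | succ m ih =>
    refine ih (gridCtr_half (by positivity) ?_)
    rwa [div_div, ← pow_succ]

/-- For `x` in a bounded set and `‖x - y‖ ≥ l`, the quantities `‖x - y‖` and `1 + ‖y‖` are related
by `1 + ‖y‖ ≤ (1 + (1 + n * R) / l) * ‖x - y‖`. -/
theorem inv_norm_sub_pow_le {x y : Euc n} {l R : ℝ} (hl : 0 < l) (hR : 0 ≤ R)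
    (hx : x ∈ box 0 R) (hxy : l ≤ ‖x - y‖) :
    1 / ‖x - y‖ ^ n ≤ (1 + (1 + n * R) / l) ^ n * (1 / (1 + ‖y‖) ^ n) := by
  have h0 : 0 < ‖x - y‖ := hl.trans_le hxy
  have hxR : ‖x‖ ≤ n * R := by
    have := norm_sub_center_le hR hx
    rwa [sub_zero] at this
  have h1 : ‖y‖ ≤ ‖x‖ + ‖x - y‖ := by
    have := norm_sub_le x (x - y)
    rwa [sub_sub_cancel] at this
  have h2 : 1 + n * R ≤ (1 + n * R) / l * ‖x - y‖ := by
    rw [div_mul_eq_mul_div, le_div_iff₀ hl]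
    exact mul_le_mul_of_nonneg_left hxy (by positivity)
  have h3 : 1 + ‖y‖ ≤ (1 + (1 + n * R) / l) * ‖x - y‖ := by linarith
  rw [mul_one_div, div_le_div_iff₀ (by positivity) (by positivity), one_mul, ← mul_pow]
  exact pow_le_pow_left₀ (by positivity) h3 n

theorem le_norm_sub_of_notMem_dilate {x y : Euc n} {l : ℝ} (hl : 0 < l)
    (hy : y ∉ box (gridCtr 0 l x) (5 * n * l)) : l ≤ ‖x - y‖ := by
  have hn : (1 : ℝ) ≤ n := by exact_mod_cast NeZero.one_le
  have := four_mul_le_norm_sub_of_notMem_box hl (mem_box_gridCtr 0 hl x) hy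
  nlinarith

theorem IsCZPair.norm_farKer_le (hT : IsCZPair T K C) (hM : ∀ x, ‖φ x‖ ≤ M) {l R : ℝ} (hl : 0 < l)
    (hR : 0 ≤ R) {x : Euc n} (hx : x ∈ box 0 R) (y : Euc n) :
    ‖farKer K φ l x y‖ ≤ 2 * M * C * (1 + (1 + n * R) / l) ^ n * (1 / (1 + ‖y‖) ^ n) := by
  have hC := hT.nonneg
  have hM0 : 0 ≤ M := (norm_nonneg _).trans (hM 0)
  by_cases hy : y ∈ box (gridCtr 0 l x) (5 * n * l)
  · rw [farKer, indicator_of_notMem (notMem_compl_iff.2 hy), norm_zero]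
    positivity
  · have hxy := le_norm_sub_of_notMem_dilate hl hy
    rw [farKer, indicator_of_mem (mem_compl hy), norm_mul]
    calc ‖φ x - φ y‖ * ‖K x y‖ ≤ (2 * M) * (C / ‖x - y‖ ^ n) := by
          refine mul_le_mul ?_ (hT.kernel.size x y ?_) (norm_nonneg _) (by positivity)
          · linarith [norm_sub_le (φ x) (φ y), hM x, hM y]
          · rintro rfl
            simp at hxy
            linarith
      _ = 2 * M * C * (1 / ‖x - y‖ ^ n) := by ring
      _ ≤ 2 * M * C * ((1 + (1 + n * R) / l) ^ n * (1 / (1 + ‖y‖) ^ n)) :=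
          mul_le_mul_of_nonneg_left (inv_norm_sub_pow_le hl hR hx hxy) (by positivity)
      _ = _ := by ring

theorem IsCZPair.aestronglyMeasurable_farKer (hT : IsCZPair T K C) (hφ : Continuous φ) (l : ℝ)
    (x : Euc n) : AEStronglyMeasurable (farKer K φ l x) volume :=
  ((continuous_const.sub hφ).aestronglyMeasurable.mul
    (hT.kernel.aestronglyMeasurable x)).indicator (measurableSet_box _ _).compl

theorem enorm_le_decay {a : ℂ} {D : ℝ} (hD : 0 ≤ D) {y : Euc n}
    (h : ‖a‖ ≤ D * (1 / (1 + ‖y‖) ^ n)) : ‖a‖ₑ ≤ ENNReal.ofReal D * decay y := by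
  rw [decay, ← ENNReal.ofReal_mul hD, ← ofReal_norm]
  exact ENNReal.ofReal_le_ofReal h

theorem IsCZPair.enorm_farKer_le (hT : IsCZPair T K C) (hM : ∀ x, ‖φ x‖ ≤ M) {l : ℝ} (hl : 0 < l)
    (x : Euc n) : ∃ D : ℝ≥0∞, D ≠ ∞ ∧ ∀ y, ‖farKer K φ l x y‖ₑ ≤ D * decay y := by
  have hC := hT.nonneg
  have hM0 : 0 ≤ M := (norm_nonneg _).trans (hM 0)
  obtain ⟨R, hR, hx⟩ := (Bornology.isBounded_singleton (x := x)).exists_subset_box 0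
  refine ⟨_, ENNReal.ofReal_ne_top, fun y => enorm_le_decay (by positivity)
    (hT.norm_farKer_le hM hl hR.le (hx R le_rfl rfl) y)⟩

theorem decay_le_one (y : Euc n) : decay y ≤ 1 := by
  rw [decay, ENNReal.ofReal_le_one]
  refine (div_le_one (by positivity)).2 (one_le_pow₀ ?_)
  linarith [norm_nonneg y]

theorem IsCZPair.integrable_farKer_mul (hT : IsCZPair T K C) (hφ : Continuous φ)
    (hM : ∀ x, ‖φ x‖ ≤ M) {l : ℝ} (hl : 0 < l) (x : Euc n) {f : Euc n → ℂ}
    (hf : f ∈ boundedCompact n) : Integrable (fun y => farKer K φ l x y * f y) volume := by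
  obtain ⟨D, hD, hk⟩ := hT.enorm_farKer_le hM hl x
  have hfi : Integrable f volume := memLp_one_iff_integrable.1
    (memLp_of_mem_boundedCompact hf Measure.AbsolutelyContinuous.rfl 1)
  refine hfi.bdd_mul (hT.aestronglyMeasurable_farKer hφ l x) (c := D.toReal)
    (ae_of_all _ fun y => ?_)
  rw [← toReal_enorm]
  refine ENNReal.toReal_mono hD ((hk y).trans ?_)
  calc D * decay y ≤ D * 1 := mul_le_mul_right (decay_le_one y) D
    _ = D := mul_one D

/-- On a bounded set the cut off kernel can be evaluated at the centres of a fine grid. -/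
theorem IsCZPair.exists_farKer_sub_le (hT : IsCZPair T K C) (hφ : Continuous φ)
    (hφc : HasCompactSupport φ) {l R ε : ℝ} (hl : 0 < l) (hR : 0 ≤ R) (hε : 0 < ε) :
    ∃ η : ℝ, 0 < η ∧ ∀ x ∈ box 0 R, ∀ y,
      ‖farKer K φ l x y - farKer K φ l (gridCtr 0 η x) y‖ ≤ ε * (1 / (1 + ‖y‖) ^ n) := by
  have hn : (1 : ℝ) ≤ n := by exact_mod_cast NeZero.one_le
  have hC := hT.nonneg
  obtain ⟨M, hM⟩ := hφc.exists_bound_of_continuous hφ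
  have hM0 : 0 ≤ M := (norm_nonneg _).trans (hM 0)
  set B : ℝ := (1 + (1 + n * R) / l) ^ n
  have hB : 0 ≤ B := by positivity
  set ε₁ : ℝ := ε / (2 * (C * B + 1))
  have hε₁ : 0 < ε₁ := by positivity
  obtain ⟨δ, hδ, hunif⟩ := Metric.uniformContinuous_iff.1
    (hφc.uniformContinuous_of_continuous hφ) ε₁ hε₁
  have hlim : Tendsto (fun m : ℕ => (1 / 2 : ℝ) ^ m) atTop (𝓝 0) :=
    tendsto_pow_atTop_nhds_zero_of_lt_one (by norm_num) (by norm_num)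
  have hlim1 : Tendsto (fun m : ℕ => n * l * (1 / 2 : ℝ) ^ m) atTop (𝓝 0) := by
    simpa using hlim.const_mul (n * l)
  have hlim2 : Tendsto (fun m : ℕ => M * (1 / 2 : ℝ) ^ m) atTop (𝓝 0) := by
    simpa using hlim.const_mul M
  obtain ⟨m, h1, h2⟩ := ((hlim1.eventually_lt_const hδ).and (hlim2.eventually_lt_const hε₁)).exists
  have hm1 : (1 / 2 : ℝ) ^ m ≤ 1 := pow_le_one₀ (by norm_num) (by norm_num)
  have hη : l / 2 ^ m = l * (1 / 2) ^ m := by rw [one_div, inv_pow, div_eq_mul_inv]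
  have hηpos : 0 < l / 2 ^ m := by positivity
  -- A dyadic fraction of `l`, so that the fine grid refines the coarse one: `x` and its fine centre
  -- `z` share the coarse cell, and the two cut-offs coincide.
  refine ⟨l / 2 ^ m, hηpos, fun x hx y => ?_⟩
  set z := gridCtr 0 (l / 2 ^ m) x
  have hzz : gridCtr 0 l z = gridCtr 0 l x :=
    gridCtr_eq_of_gridCtr_div_eq hl m (gridCtr_eq_of_mem hηpos (self_mem_box _ hηpos))
  have hxz : ‖x - z‖ ≤ n * (l / 2 ^ m) :=
    norm_sub_center_le hηpos.le (mem_box_gridCtr 0 hηpos x)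
  by_cases hy : y ∈ box (gridCtr 0 l x) (5 * n * l)
  · simp only [farKer]
    rw [hzz, indicator_of_notMem (notMem_compl_iff.2 hy),
      indicator_of_notMem (notMem_compl_iff.2 hy), sub_zero, norm_zero]
    positivity
  have h4 := four_mul_le_norm_sub_of_notMem_box hl (mem_box_gridCtr 0 hl x) hy
  have hxy := le_norm_sub_of_notMem_dilate hl hy
  have hxy0 : 0 < ‖x - y‖ := hl.trans_le hxy
  have hne : x ≠ y := by
    rintro rfl
    simp at hxy0
  have hηl : n * (l / 2 ^ m) ≤ n * l := by
    rw [hη]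
    nlinarith [mul_pos (zero_lt_one.trans_le hn) hl]
  have hφz : ‖φ x - φ z‖ ≤ ε₁ := by
    rw [← dist_eq_norm]
    refine (hunif ?_).le
    rw [dist_eq_norm]
    refine hxz.trans_lt ?_
    rw [hη]
    linarith
  simp only [farKer]
  rw [hzz, indicator_of_mem (mem_compl hy), indicator_of_mem (mem_compl hy)]
  -- The first term is small by uniform continuity of `φ`, the second by smoothness of the kernel.
  have e : (φ x - φ y) * K x y - (φ z - φ y) * K z y =
      (φ x - φ z) * K x y + (φ z - φ y) * (K x y - K z y) := by ring
  rw [e]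
  have hK1 : ‖K x y‖ ≤ C * (1 / ‖x - y‖ ^ n) := by
    rw [mul_one_div]
    exact hT.kernel.size x y hne
  have hK2 : ‖K x y - K z y‖ ≤ C * (1 / ‖x - y‖ ^ n) * ((1 / 2) ^ m * 2⁻¹) := by
    refine (hT.kernel.smooth_left x z y hne (by linarith)).trans ?_
    rw [mul_assoc]
    refine mul_le_mul_of_nonneg_left ?_ hC
    have e' : ‖x - z‖ / ‖x - y‖ ^ (n + 1) = 1 / ‖x - y‖ ^ n * (‖x - z‖ / ‖x - y‖) := by
      rw [pow_succ]
      field_simp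
    rw [e']
    refine mul_le_mul_of_nonneg_left ?_ (by positivity)
    rw [div_le_iff₀ hxy0]
    calc ‖x - z‖ ≤ n * (l * (1 / 2) ^ m) := by rw [← hη]; exact hxz
      _ = (1 / 2) ^ m * 2⁻¹ * (2 * (n * l)) := by ring
      _ ≤ _ := mul_le_mul_of_nonneg_left (by nlinarith [mul_pos (zero_lt_one.trans_le hn) hl])
          (by positivity)
  have hφ2 : ‖φ z - φ y‖ ≤ 2 * M := by linarith [norm_sub_le (φ z) (φ y), hM z, hM y]
  calc ‖(φ x - φ z) * K x y + (φ z - φ y) * (K x y - K z y)‖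
      ≤ ε₁ * (C * (1 / ‖x - y‖ ^ n)) +
        2 * M * (C * (1 / ‖x - y‖ ^ n) * ((1 / 2) ^ m * 2⁻¹)) := by
        refine (norm_add_le _ _).trans ?_
        rw [norm_mul, norm_mul]
        exact add_le_add (mul_le_mul hφz hK1 (norm_nonneg _) hε₁.le)
          (mul_le_mul hφ2 hK2 (norm_nonneg _) (by positivity))
    _ = (ε₁ + M * (1 / 2) ^ m) * C * (1 / ‖x - y‖ ^ n) := by ring
    _ ≤ (ε₁ + ε₁) * C * (B * (1 / (1 + ‖y‖) ^ n)) :=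
        mul_le_mul (mul_le_mul_of_nonneg_right (by linarith) hC)
          (inv_norm_sub_pow_le hl hR hx hxy) (by positivity) (by positivity)
    _ = (2 * ε₁ * (C * B)) * (1 / (1 + ‖y‖) ^ n) := by ring
    _ ≤ ε * (1 / (1 + ‖y‖) ^ n) := by
        refine mul_le_mul_of_nonneg_right ?_ (by positivity)
        calc 2 * ε₁ * (C * B) ≤ 2 * ε₁ * (C * B + 1) := by
              refine mul_le_mul_of_nonneg_left (by linarith) (by positivity)
          _ = ε := by simp only [ε₁]; field_simp

/-- Outside a large box the cut off kernel decays. -/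
theorem IsCZPair.enorm_farKer_le_of_notMem (hT : IsCZPair T K C) (hM : ∀ x, ‖φ x‖ ≤ M) {r R : ℝ}
    (hr : 0 < r) (hφr : ∀ x, x ∉ box 0 r → φ x = 0) (hR : 2 * (n * r) + 1 ≤ R) (l : ℝ) {x : Euc n}
    (hx : x ∉ box 0 R) (y : Euc n) :
    ‖farKer K φ l x y‖ₑ ≤ ENNReal.ofReal (M * C * 4 ^ n) * decay x * (box 0 r).indicator 1 y := by
  have hn : (1 : ℝ) ≤ n := by exact_mod_cast NeZero.one_le
  have hC := hT.nonneg
  have hM0 : 0 ≤ M := (norm_nonneg _).trans (hM 0)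
  have hφx : φ x = 0 := hφr x fun h => hx (box_mono _ (by nlinarith) h)
  by_cases hy : y ∈ (box (gridCtr 0 l x) (5 * n * l))ᶜ
  swap
  · rw [farKer, indicator_of_notMem hy, enorm_zero]
    exact zero_le
  rw [farKer, indicator_of_mem hy, hφx]
  by_cases hyr : y ∈ box 0 r
  swap
  · rw [hφr y hyr, sub_zero, zero_mul, enorm_zero]
    exact zero_le
  rw [indicator_of_mem hyr, Pi.one_apply, mul_one]
  have hxR := le_norm_sub_of_notMem_box hx
  have hyR := norm_sub_center_le hr.le hyr
  rw [sub_zero] at hxR hyR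
  have h1 : ‖x‖ ≤ ‖y‖ + ‖x - y‖ := by
    have := norm_add_le y (x - y)
    rwa [add_sub_cancel] at this
  -- Here `‖y‖ ≤ n * r` and `‖x‖ ≥ 2 * (n * r) + 1`.
  have h2 : 1 + ‖x‖ ≤ 4 * ‖x - y‖ := by nlinarith
  have h0 : 0 < ‖x - y‖ := by nlinarith [norm_nonneg x]
  have hne : x ≠ y := by
    rintro rfl
    simp at h0
  refine enorm_le_decay (by positivity) ?_
  rw [norm_mul, zero_sub, norm_neg]
  calc ‖φ y‖ * ‖K x y‖ ≤ M * (C * (1 / ‖x - y‖ ^ n)) := by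
        refine mul_le_mul (hM y) ?_ (norm_nonneg _) hM0
        rw [mul_one_div]
        exact hT.kernel.size x y hne
    _ ≤ M * (C * (4 ^ n * (1 / (1 + ‖x‖) ^ n))) := by
        refine mul_le_mul_of_nonneg_left (mul_le_mul_of_nonneg_left ?_ hC) hM0
        rw [mul_one_div, div_le_div_iff₀ (by positivity) (by positivity), one_mul, ← mul_pow]
        exact pow_le_pow_left₀ (by positivity) h2 n
    _ = _ := by ring

end kernel

/-! ### Finite rank approximation -/

section rank

variable [NeZero n] {T : LqOp n q} {K : Euc n → Euc n → ℂ} {C : ℝ} {φ : Euc n → ℂ}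
  {p' : ℝ} {w v : Euc n → ℝ≥0} {A : ℝ≥0∞}

theorem WeightPair.lintegral_decay_mul_le (h : WeightPair p.toReal p' w v A) {f : Euc n → ℂ}
    (hf : f ∈ boundedCompact n) :
    ∫⁻ y, decay y * ‖f y‖ₑ ≤ (∫⁻ y, decay y ^ p' ∂(wm v)) ^ (1 / p') *
      (∫⁻ y, ‖f y‖ₑ ^ p.toReal ∂(wm w)) ^ (1 / p.toReal) := by
  have := h.lintegral_mul_le hf.1.1.enorm (measurable_decay (n := n)).aemeasurable
  rw [mul_comm]
  refine le_trans (le_of_eq (lintegral_congr fun y => mul_comm _ _)) this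

theorem WeightPair.lintegral_box_le (h : WeightPair p.toReal p' w v A) {f : Euc n → ℂ}
    (hf : f ∈ boundedCompact n) (r : ℝ) :
    ∫⁻ y in box 0 r, ‖f y‖ₑ ≤ wm v (box 0 r) ^ (1 / p') *
      (∫⁻ y, ‖f y‖ₑ ^ p.toReal ∂(wm w)) ^ (1 / p.toReal) := by
  have hp' := h.conj.symm.pos
  have := h.lintegral_mul_le hf.1.1.enorm
    (measurable_one.indicator (measurableSet_box (0 : Euc n) r)).aemeasurable
  have e1 : ∫⁻ y, ‖f y‖ₑ * (box 0 r).indicator 1 y = ∫⁻ y in box 0 r, ‖f y‖ₑ := by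
    rw [← lintegral_indicator (measurableSet_box _ _)]
    refine lintegral_congr fun y => ?_
    by_cases hy : y ∈ box 0 r <;> simp [hy]
  have e2 : ∫⁻ y, (box (0 : Euc n) r).indicator (1 : Euc n → ℝ≥0∞) y ^ p' ∂(wm v) =
      wm v (box 0 r) := by
    rw [← lintegral_indicator_one (measurableSet_box _ _)]
    refine lintegral_congr fun y => ?_
    by_cases hy : y ∈ box 0 r <;> simp [hy, hp']
  rw [e1, e2] at this
  rwa [mul_comm]

/-- Integration against the cut off kernel is a bounded functional. -/
theorem IsCZPair.exists_functional (hT : IsCZPair T K C) (hp : p ≠ ∞)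
    (h : WeightPair p.toReal p' w v A) [IsLocallyFiniteMeasure (wm w)] (hφ : Continuous φ)
    (hφc : HasCompactSupport φ) {l : ℝ} (hl : 0 < l) (z : Euc n) :
    ∃ ℓ : Lp ℂ p (wm w) →L[ℂ] ℂ, ∀ f : boundedCompact n,
      ℓ (toLpMap p (wm_absolutelyContinuous w) f) =
        ∫ y, farKer K φ l z y * (f : Euc n → ℂ) y := by
  have hp0 : p ≠ 0 := (zero_lt_one.trans_le Fact.out).ne'
  have hp' := h.conj.symm.pos
  obtain ⟨M, hM⟩ := hφc.exists_bound_of_continuous hφ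
  obtain ⟨D, hD, hk⟩ := hT.enorm_farKer_le hM hl z
  have hμ := wm_absolutelyContinuous w
  have hint := fun f : boundedCompact n => hT.integrable_farKer_mul hφ hM hl z f.2
  let g : boundedCompact n →ₗ[ℂ] ℂ :=
    { toFun := fun f => ∫ y, farKer K φ l z y * (f : Euc n → ℂ) y
      map_add' := fun f f' => by
        rw [← integral_add (hint f) (hint f')]
        refine integral_congr_ae (ae_of_all _ fun y => ?_)
        exact mul_add _ _ _
      map_smul' := fun c f => by
        rw [RingHom.id_apply, smul_eq_mul, ← integral_const_mul]
        refine integral_congr_ae (ae_of_all _ fun y => ?_)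
        exact mul_left_comm _ _ _ }
  set E := D * (∫⁻ y, decay y ^ p' ∂(wm v)) ^ (1 / p')
  have hE : E ≠ ∞ := ENNReal.mul_ne_top hD
    (ENNReal.rpow_ne_top_of_nonneg (by positivity) h.symm.lintegral_decay_rpow_ne_top)
  have hg : ∀ f, ‖g f‖ ≤ E.toReal * ‖toLpMap p hμ f‖ := fun f => by
    have hfp := memLp_of_mem_boundedCompact f.2 hμ p
    change _ ≤ _ * ‖hfp.toLp _‖
    rw [Lp.norm_toLp, ← ENNReal.toReal_mul, ← toReal_enorm]
    refine ENNReal.toReal_mono (ENNReal.mul_ne_top hE hfp.2.ne) ?_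
    rw [eLpNorm_eq_lintegral_rpow_enorm_toReal hp0 hp, mul_assoc]
    calc ‖g f‖ₑ ≤ ∫⁻ y, ‖farKer K φ l z y * (f : Euc n → ℂ) y‖ₑ :=
          enorm_integral_le_lintegral_enorm _
      _ ≤ ∫⁻ y, D * (decay y * ‖(f : Euc n → ℂ) y‖ₑ) := lintegral_mono fun y => by
          rw [enorm_mul, ← mul_assoc]
          exact mul_le_mul_left (hk y) _
      _ = D * ∫⁻ y, decay y * ‖(f : Euc n → ℂ) y‖ₑ := lintegral_const_mul' _ _ hD
      _ ≤ _ := mul_le_mul_right (h.lintegral_decay_mul_le f.2) D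
  exact ⟨g.extendOfNorm (toLpMap p hμ), fun f =>
    LinearMap.extendOfNorm_eq (denseRange_toLpMap hp hμ) ⟨_, hg⟩ f⟩

/-- The operator whose kernel is the cut off kernel evaluated at grid centres is compact. -/
theorem IsCZPair.exists_finite_rank (hT : IsCZPair T K C) (hp : p ≠ ∞)
    (h : WeightPair p.toReal p' w v A) [IsLocallyFiniteMeasure (wm w)] (hφ : Continuous φ)
    (hφc : HasCompactSupport φ) {l η : ℝ} (hl : 0 < l) (hη : 0 < η) (R : ℝ) :
    ∃ F : Lp ℂ p (wm w) →L[ℂ] Lp ℂ p (wm w), IsCompactOperator F ∧ ∀ f : boundedCompact n,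
      F (toLpMap p (wm_absolutelyContinuous w) f) =ᵐ[wm w]
        (box 0 R).indicator fun x => ∫ y, farKer K φ l (gridCtr 0 η x) y * (f : Euc n → ℂ) y := by
  classical
  choose ℓ hℓ using fun z => hT.exists_functional hp h hφ hφc hl z
  -- Only finitely many cells meet the large box; each contributes one operator of rank at most one.
  set J := (finite_image_gridCtr (0 : Euc n) hη 0 R).toFinset
  have hEm : ∀ z : Euc n, MeasurableSet (box 0 R ∩ box z η) := fun z =>
    (measurableSet_box _ _).inter (measurableSet_box _ _)
  have hEt : ∀ z : Euc n, wm w (box 0 R ∩ box z η) ≠ ∞ := fun z =>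
    ne_top_of_le_ne_top (h.fin_left 0 R) (measure_mono inter_subset_left)
  set e : Euc n → Lp ℂ p (wm w) := fun z => indicatorConstLp p (hEm z) (hEt z) 1
  refine ⟨∑ z ∈ J, (ℓ z).smulRight (e z), ?_, fun f => ?_⟩
  · have : ∀ z, (ℓ z).smulRight (e z) ∈ compactOperator (RingHom.id ℂ) (Lp ℂ p (wm w))
        (Lp ℂ p (wm w)) := fun z => by
      have h1 : IsCompactOperator (ContinuousLinearMap.toSpanSingleton ℂ (e z)) :=
        isCompactOperator_of_locallyCompactSpace_rng _
      exact h1.comp_clm (ℓ z)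
    exact Submodule.sum_mem (compactOperator (RingHom.id ℂ) _ _) fun z _ => this z
  · have h1 : ∀ᵐ x ∂(wm w), ∀ z ∈ J, e z x = (box 0 R ∩ box z η).indicator (fun _ => 1) x :=
      (ae_ball_iff J.countable_toSet).2 fun z _ => indicatorConstLp_coeFn
    have h2 : (⇑(∑ z ∈ J, ℓ z (toLpMap p (wm_absolutelyContinuous w) f) • e z) : Euc n → ℂ)
        =ᵐ[wm w] fun x => ∑ z ∈ J, ℓ z (toLpMap p (wm_absolutelyContinuous w) f) * e z x := by
      have h3 : ∀ᵐ x ∂(wm w), ∀ z ∈ J,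
          (ℓ z (toLpMap p (wm_absolutelyContinuous w) f) • e z : Lp ℂ p (wm w)) x =
          ℓ z (toLpMap p (wm_absolutelyContinuous w) f) * e z x :=
        (ae_ball_iff J.countable_toSet).2 fun z _ => Lp.coeFn_smul _ _
      filter_upwards [Lp.coeFn_finsetSum J fun z =>
        ℓ z (toLpMap p (wm_absolutelyContinuous w) f) • e z, h3] with x hx hx'
      rw [hx, Finset.sum_apply]
      exact Finset.sum_congr rfl hx'
    rw [sum_apply]
    simp only [ContinuousLinearMap.smulRight_apply]
    filter_upwards [h1, h2] with x hx hx'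
    rw [hx']
    by_cases hxR : x ∈ box 0 R
    · have hzJ : gridCtr 0 η x ∈ J := by
        simp only [J, Finite.mem_toFinset]
        exact mem_image_of_mem _ hxR
      rw [Finset.sum_eq_single_of_mem _ hzJ, hx _ hzJ, indicator_of_mem hxR,
        indicator_of_mem (mem_inter hxR (mem_box_gridCtr 0 hη x)), mul_one, hℓ]
      intro z hz hne
      obtain ⟨x', hx', rfl⟩ := (Finite.mem_toFinset _).1 hz
      rw [hx _ hz, indicator_of_notMem, mul_zero]
      rintro ⟨-, hm⟩
      exact hne (gridCtr_eq_of_mem hη hm).symm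
    · rw [indicator_of_notMem hxR]
      refine Finset.sum_eq_zero fun z hz => ?_
      rw [hx z hz, indicator_of_notMem (fun h => hxR h.1), mul_zero]

end rank

end CZCommutator

namespace CZCommutator

open Set Filter Topology
open scoped NNReal

set_option linter.unusedSectionVars false

variable {n : ℕ} {p q : ℝ≥0∞} [Fact (1 ≤ p)] [Fact (1 ≤ q)]

/-! ### Compactness -/

theorem isCompactOperator_of_forall_norm_sub_le {E : Type*} [NormedAddCommGroup E]
    [NormedSpace ℂ E] [CompleteSpace E] {S : E →L[ℂ] E}
    (h : ∀ τ : ℝ, 0 < τ → ∃ F : E →L[ℂ] E, IsCompactOperator F ∧ ‖S - F‖ ≤ τ) :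
    IsCompactOperator S := by
  have hcl : S ∈ closure {F : E →L[ℂ] E | IsCompactOperator F} := by
    refine Metric.mem_closure_iff.2 fun ε hε => ?_
    obtain ⟨F, hF, hle⟩ := h (ε / 2) (half_pos hε)
    exact ⟨F, hF, by rw [dist_eq_norm]; linarith⟩
  rwa [isClosed_setOfPred_isCompactOperator.closure_eq] at hcl

theorem exists_mul_ofReal_rpow_le {c κ : ℝ≥0∞} (hc : c ≠ ∞) (hκ : κ ≠ 0) {p : ℝ} (hp : 0 < p) :
    ∃ ε : ℝ, 0 < ε ∧ c * ENNReal.ofReal ε ^ p ≤ κ := by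
  set κ' := min κ 1
  have hκ't : κ' ≠ ∞ := ne_top_of_le_ne_top ENNReal.one_ne_top (min_le_right _ _)
  have hκ' : 0 < κ'.toReal := ENNReal.toReal_pos (lt_min (pos_iff_ne_zero.2 hκ) one_pos).ne' hκ't
  have hc0 : 0 ≤ c.toReal := ENNReal.toReal_nonneg
  refine ⟨(κ'.toReal / (c.toReal + 1)) ^ (1 / p), by positivity, ?_⟩
  rw [ENNReal.ofReal_rpow_of_nonneg (by positivity) hp.le, ← Real.rpow_mul (by positivity),
    one_div_mul_cancel hp.ne', Real.rpow_one]
  calc c * ENNReal.ofReal (κ'.toReal / (c.toReal + 1))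
      = ENNReal.ofReal (c.toReal * (κ'.toReal / (c.toReal + 1))) := by
        rw [ENNReal.ofReal_mul hc0, ENNReal.ofReal_toReal hc]
    _ ≤ ENNReal.ofReal κ'.toReal := by
        refine ENNReal.ofReal_le_ofReal ?_
        rw [mul_div_assoc', div_le_iff₀ (by positivity)]
        nlinarith
    _ = κ' := ENNReal.ofReal_toReal hκ't
    _ ≤ κ := min_le_left _ _

/-- The measure with density `decay ^ p` relative to `w` is finite, so continuity from above applies
to the complements of growing boxes. -/
theorem WeightPair.exists_tail_le [NeZero n] {p p' : ℝ} {w v : Euc n → ℝ≥0} {A : ℝ≥0∞}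
    (h : WeightPair p p' w v A) {c κ : ℝ≥0∞} (hc : c ≠ ∞) (hκ : κ ≠ 0) (R₀ : ℝ) :
    ∃ R, R₀ ≤ R ∧ c * ∫⁻ x in (box 0 R)ᶜ, decay x ^ p ∂(wm w) ≤ κ := by
  set ν := (wm w).withDensity fun x => decay x ^ p
  have hν : ν univ ≠ ∞ := by
    rw [withDensity_apply _ MeasurableSet.univ, setLIntegral_univ]
    exact h.lintegral_decay_rpow_ne_top
  have hanti : Antitone fun N : ℕ => (box (0 : Euc n) N)ᶜ := fun N N' hN =>
    compl_subset_compl.2 (box_mono _ (by exact_mod_cast hN))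
  have hempty : ⋂ N : ℕ, (box (0 : Euc n) N)ᶜ = ∅ := by
    refine eq_empty_of_forall_notMem fun x hx => ?_
    obtain ⟨N, hN⟩ := exists_nat_gt ‖x‖
    exact mem_iInter.1 hx N (mem_box_of_norm_lt (by rwa [sub_zero]))
  have hlim := tendsto_measure_iInter_atTop (μ := ν)
    (fun N : ℕ => (measurableSet_box (0 : Euc n) N).compl.nullMeasurableSet) hanti
    ⟨0, ne_top_of_le_ne_top hν (measure_mono (subset_univ _))⟩
  rw [hempty, measure_empty] at hlim
  have hlim' := ENNReal.Tendsto.const_mul hlim (Or.inr hc)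
  rw [mul_zero] at hlim'
  obtain ⟨N₀, hN₀⟩ := exists_nat_ge R₀
  obtain ⟨N, hN, hN'⟩ := ((hlim'.eventually_le_const (pos_iff_ne_zero.2 hκ)).and
    (eventually_ge_atTop N₀)).exists
  refine ⟨N, hN₀.trans (by exact_mod_cast hN'), ?_⟩
  rwa [← withDensity_apply _ (measurableSet_box _ _).compl]

section compactness

variable [NeZero n] {T : LqOp n q} {K : Euc n → Euc n → ℂ} {C : ℝ} {φ : Euc n → ℂ}
  {p' : ℝ} {w v : Euc n → ℝ≥0} {A : ℝ≥0∞}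

/-- Pointwise comparison of the cut off kernel and its discretization. -/
theorem IsCZPair.enorm_integral_farKer_sub_le (hT : IsCZPair T K C) (hφ : Continuous φ) {M : ℝ}
    (hM : ∀ x, ‖φ x‖ ≤ M) {l ε η r R : ℝ} (hl : 0 < l) (hε : 0 < ε) (hr : 0 < r)
    (hφr : ∀ x, x ∉ box 0 r → φ x = 0) (hR : 2 * (n * r) + 1 ≤ R)
    (hη : ∀ x ∈ box 0 R, ∀ y, ‖farKer K φ l x y - farKer K φ l (gridCtr 0 η x) y‖ ≤
      ε * (1 / (1 + ‖y‖) ^ n)) {f : Euc n → ℂ} (hf : f ∈ boundedCompact n) (x : Euc n) :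
    ‖(∫ y, farKer K φ l x y * f y) -
      (box 0 R).indicator (fun x => ∫ y, farKer K φ l (gridCtr 0 η x) y * f y) x‖ₑ ≤
      (box 0 R).indicator (fun _ => ENNReal.ofReal ε * ∫⁻ y, decay y * ‖f y‖ₑ) x +
      (box 0 R)ᶜ.indicator (fun x => ENNReal.ofReal (M * C * 4 ^ n) *
        (∫⁻ y in box 0 r, ‖f y‖ₑ) * decay x) x := by
  by_cases hx : x ∈ box 0 R
  · rw [indicator_of_mem hx, indicator_of_mem hx, indicator_of_notMem (notMem_compl_iff.2 hx),
      add_zero, ← integral_sub (hT.integrable_farKer_mul hφ hM hl x hf)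
        (hT.integrable_farKer_mul hφ hM hl _ hf),
      ← lintegral_const_mul' _ _ ENNReal.ofReal_ne_top]
    refine (enorm_integral_le_lintegral_enorm _).trans (lintegral_mono fun y => ?_)
    rw [← sub_mul, enorm_mul, ← mul_assoc]
    exact mul_le_mul_left (enorm_le_decay hε.le (hη x hx y)) _
  · rw [indicator_of_notMem hx, indicator_of_notMem hx, indicator_of_mem (mem_compl hx), sub_zero,
      zero_add]
    have hd : decay x ≠ ∞ := ne_top_of_le_ne_top ENNReal.one_ne_top (decay_le_one x)
    calc ‖∫ y, farKer K φ l x y * f y‖ₑ ≤ ∫⁻ y, ‖farKer K φ l x y * f y‖ₑ :=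
          enorm_integral_le_lintegral_enorm _
      _ ≤ ∫⁻ y, ENNReal.ofReal (M * C * 4 ^ n) * decay x *
          (box 0 r).indicator (fun y => ‖f y‖ₑ) y := by
          refine lintegral_mono fun y => ?_
          rw [enorm_mul]
          refine (mul_le_mul_left (hT.enorm_farKer_le_of_notMem hM hr hφr hR l hx y) _).trans
            (le_of_eq ?_)
          by_cases hy : y ∈ box 0 r <;> simp [hy]
      _ = _ := by
          rw [lintegral_const_mul' _ _ (ENNReal.mul_ne_top ENNReal.ofReal_ne_top hd),
            lintegral_indicator (measurableSet_box _ _)]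
          ring

/-- The error has three parts, each given a third of `κ`: near the diagonal, far out in `x`, and
discretization. The parameters are chosen in the order `l`, `R`, `ε`, `η`: the discretization error
is paid for with the weight of `box 0 R`, so `ε` must come after `R`. -/
theorem IsCZPair.exists_isCompactOperator_approx (hT : IsCZPair T K C) (hqtop : q ≠ ∞)
    (hp : p ≠ ∞) (h : WeightPair p.toReal p' w v A) [IsLocallyFiniteMeasure (wm w)]
    (hφ : Continuous φ) (hφc : HasCompactSupport φ) {κ : ℝ≥0∞} (hκ : κ ≠ 0) :
    ∃ F : Lp ℂ p (wm w) →L[ℂ] Lp ℂ p (wm w), IsCompactOperator F ∧ ∀ f : boundedCompact n,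
      ∫⁻ x, ‖comm T φ f x - F (toLpMap p (wm_absolutelyContinuous w) f) x‖ₑ ^ p.toReal ∂(wm w) ≤
        κ * ∫⁻ x, ‖(f : Euc n → ℂ) x‖ₑ ^ p.toReal ∂(wm w) := by
  set s := p.toReal
  have hs := h.conj.pos
  have hs1 := h.conj.lt.le
  have hs' := h.conj.symm.pos
  have hn : (1 : ℝ) ≤ n := by exact_mod_cast NeZero.one_le
  obtain ⟨M, hM⟩ := hφc.exists_bound_of_continuous hφ
  have hμ := wm_absolutelyContinuous w
  -- The convexity constant in `(a + b) ^ s ≤ Γ * (a ^ s + b ^ s)`.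
  set Γ : ℝ≥0∞ := 2 ^ (s - 1)
  have hΓt : Γ ≠ ∞ := ENNReal.rpow_ne_top_of_nonneg (by linarith) (by norm_num)
  have hκ3 : κ / 3 ≠ 0 := ENNReal.div_ne_zero.2 ⟨hκ, by norm_num⟩
  obtain ⟨L, hL, hnear⟩ := hT.exists_lintegral_comm_sub_integral_le hqtop h
  obtain ⟨ε₀, hε₀, hε₀'⟩ := exists_mul_ofReal_rpow_le (c := Γ * L) (by finiteness) hκ3 hs
  obtain ⟨δ, hδ, hunif⟩ := Metric.uniformContinuous_iff.1
    (hφc.uniformContinuous_of_continuous hφ) ε₀ hε₀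
  -- Points of the dilate are within `n * (5 * n * l) = δ / 2` of the centre.
  set l : ℝ := δ / (10 * n * n)
  have hl : 0 < l := by positivity
  have hosc : ∀ z, ∀ y ∈ box z (5 * n * l), ‖φ y - φ z‖ₑ ≤ ENNReal.ofReal ε₀ := by
    intro z y hy
    rw [← ofReal_norm, ← dist_eq_norm]
    refine ENNReal.ofReal_le_ofReal (hunif ?_).le
    rw [dist_eq_norm]
    refine (norm_sub_center_le (by positivity) hy).trans_lt ?_
    have : n * (5 * n * l) = δ / 2 := by simp only [l]; field_simp; norm_num
    linarith
  obtain ⟨r, hr, hφr⟩ := hφc.isCompact.isBounded.exists_subset_box 0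
  have hφ0 : ∀ x, x ∉ box 0 r → φ x = 0 := fun x hx =>
    image_eq_zero_of_notMem_tsupport fun h => hx (hφr r le_rfl h)
  set c₂ : ℝ≥0∞ := Γ * (ENNReal.ofReal (M * C * 4 ^ n) * wm v (box 0 r) ^ (1 / p')) ^ s
  have hc₂ : c₂ ≠ ∞ := ENNReal.mul_ne_top hΓt (ENNReal.rpow_ne_top_of_nonneg hs.le
    (ENNReal.mul_ne_top ENNReal.ofReal_ne_top
      (ENNReal.rpow_ne_top_of_nonneg (by positivity) (h.fin_right _ _))))
  obtain ⟨R, hR, htail⟩ := h.exists_tail_le hc₂ hκ3 (2 * (n * r) + 1)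
  have hR0 : 0 ≤ R := le_trans (by positivity) hR
  set Dv := (∫⁻ y, decay y ^ p' ∂(wm v)) ^ (1 / p')
  have hDv : Dv ≠ ∞ :=
    ENNReal.rpow_ne_top_of_nonneg (by positivity) h.symm.lintegral_decay_rpow_ne_top
  have hc₁ : Γ * (Dv ^ s * wm w (box 0 R)) ≠ ∞ := ENNReal.mul_ne_top hΓt
    (ENNReal.mul_ne_top (ENNReal.rpow_ne_top_of_nonneg hs.le hDv) (h.fin_left _ _))
  obtain ⟨ε, hε, hε'⟩ := exists_mul_ofReal_rpow_le hc₁ hκ3 hs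
  obtain ⟨η, hη, hηk⟩ := hT.exists_farKer_sub_le hφ hφc hl hR0 hε
  obtain ⟨F, hF, hFf⟩ := hT.exists_finite_rank hp h hφ hφc hl hη R
  refine ⟨F, hF, fun f => ?_⟩
  set X := ∫⁻ x, ‖(f : Euc n → ℂ) x‖ₑ ^ s ∂(wm w)
  set g : Euc n → ℝ≥0∞ := fun x =>
    (box 0 R).indicator (fun _ => ENNReal.ofReal ε * (Dv * X ^ (1 / s))) x +
      (box 0 R)ᶜ.indicator (fun x => ENNReal.ofReal (M * C * 4 ^ n) *
        (wm v (box 0 r) ^ (1 / p') * X ^ (1 / s)) * decay x) x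
  have hgm : Measurable g := by
    have := measurable_decay (n := n)
    exact (measurable_const.indicator (measurableSet_box _ _)).add
      ((this.const_mul _).indicator (measurableSet_box _ _).compl)
  have hX : (X ^ (1 / s)) ^ s = X := by
    rw [← ENNReal.rpow_mul, one_div_mul_cancel hs.ne', ENNReal.rpow_one]
  have hgX : ∫⁻ x, g x ^ s ∂(wm w) = (ENNReal.ofReal ε ^ s * (Dv ^ s * wm w (box 0 R)) +
      (ENNReal.ofReal (M * C * 4 ^ n) * wm v (box 0 r) ^ (1 / p')) ^ s *
        ∫⁻ x in (box 0 R)ᶜ, decay x ^ s ∂(wm w)) * X := by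
    rw [← lintegral_add_compl _ (measurableSet_box (0 : Euc n) R), add_mul]
    congr 1
    · rw [setLIntegral_congr_fun (measurableSet_box _ _) (g := fun _ =>
        (ENNReal.ofReal ε * (Dv * X ^ (1 / s))) ^ s) fun x hx => by
          simp only [g, indicator_of_mem hx, indicator_of_notMem (notMem_compl_iff.2 hx), add_zero],
        lintegral_const, Measure.restrict_apply_univ, ENNReal.mul_rpow_of_nonneg _ _ hs.le,
        ENNReal.mul_rpow_of_nonneg _ _ hs.le, hX]
      ring
    · have hdm : Measurable fun x : Euc n => decay x ^ s := measurable_decay.pow_const s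
      rw [setLIntegral_congr_fun (measurableSet_box _ _).compl (g := fun x =>
        (ENNReal.ofReal (M * C * 4 ^ n) * wm v (box 0 r) ^ (1 / p')) ^ s * X * decay x ^ s)
          fun x hx => by
          simp only [g, indicator_of_mem hx, indicator_of_notMem (show x ∉ box 0 R from hx),
            zero_add]
          rw [← mul_assoc, ENNReal.mul_rpow_of_nonneg _ (decay x) hs.le,
            ENNReal.mul_rpow_of_nonneg _ (X ^ (1 / s)) hs.le, hX],
        lintegral_const_mul _ hdm]
      ring
  have hpt : ∀ᵐ x ∂(wm w), ‖comm T φ f x - F (toLpMap p hμ f) x‖ₑ ^ s ≤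
      Γ * ‖comm T φ f x - ∫ y, farKer K φ l x y * (f : Euc n → ℂ) y‖ₑ ^ s + Γ * g x ^ s := by
    filter_upwards [hFf f] with x hx
    rw [← mul_add]
    refine le_trans (ENNReal.rpow_le_rpow ?_ hs.le) (ENNReal.rpow_add_le_mul_rpow_add_rpow _ _ hs1)
    rw [hx, ← sub_add_sub_cancel _ (∫ y, farKer K φ l x y * (f : Euc n → ℂ) y)]
    refine (enorm_add_le _ _).trans (add_le_add le_rfl ?_)
    refine (hT.enorm_integral_farKer_sub_le hφ hM hl hε hr hφ0 hR hηk f.2 x).trans ?_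
    refine add_le_add (indicator_le_indicator ?_) (indicator_le_indicator ?_)
    · exact mul_le_mul_right (h.lintegral_decay_mul_le f.2) _
    · exact mul_le_mul_left (mul_le_mul_right (h.lintegral_box_le f.2 r) _) _
  calc _ ≤ ∫⁻ x, (Γ * ‖comm T φ f x - ∫ y, farKer K φ l x y * (f : Euc n → ℂ) y‖ₑ ^ s +
        Γ * g x ^ s) ∂(wm w) := lintegral_mono_ae hpt
    _ = Γ * (∫⁻ x, ‖comm T φ f x - ∫ y, farKer K φ l x y * (f : Euc n → ℂ) y‖ₑ ^ s ∂(wm w)) +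
        Γ * ∫⁻ x, g x ^ s ∂(wm w) := by
        rw [lintegral_add_right _ ((hgm.pow_const s).const_mul _), lintegral_const_mul' _ _ hΓt,
          lintegral_const_mul' _ _ hΓt]
    _ ≤ Γ * (L * ENNReal.ofReal ε₀ ^ s * X) +
        Γ * ((ENNReal.ofReal ε ^ s * (Dv ^ s * wm w (box 0 R)) +
      (ENNReal.ofReal (M * C * 4 ^ n) * wm v (box 0 r) ^ (1 / p')) ^ s *
        ∫⁻ x in (box 0 R)ᶜ, decay x ^ s ∂(wm w)) * X) := by
        rw [hgX]
        exact add_le_add (mul_le_mul_right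
          (hnear φ hφ l hl _ ENNReal.ofReal_ne_top hosc f f.2) _) le_rfl
    _ = (Γ * L * ENNReal.ofReal ε₀ ^ s + Γ * (Dv ^ s * wm w (box 0 R)) * ENNReal.ofReal ε ^ s +
        c₂ * ∫⁻ x in (box 0 R)ᶜ, decay x ^ s ∂(wm w)) * X := by
        simp only [c₂]
        ring
    _ ≤ (κ / 3 + κ / 3 + κ / 3) * X :=
        mul_le_mul_left (add_le_add (add_le_add hε₀' hε') htail) _
    _ = κ * X := by rw [ENNReal.add_thirds]

theorem IsCommOn.isCompactOperator_of_continuous (hT : IsCZPair T K C) (hqtop : q ≠ ∞)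
    (hp : p ≠ ∞) (h : WeightPair p.toReal p' w v A) (hφ : Continuous φ)
    (hφc : HasCompactSupport φ) {S : Lp ℂ p (wm w) →L[ℂ] Lp ℂ p (wm w)}
    (hS : IsCommOn (wm w) φ T S) : IsCompactOperator S := by
  have := h.isLocallyFiniteMeasure
  have hμ := wm_absolutelyContinuous w
  have hp0 : p ≠ 0 := (zero_lt_one.trans_le Fact.out).ne'
  have hs := h.conj.pos
  refine isCompactOperator_of_forall_norm_sub_le fun τ hτ => ?_
  have hκ : ENNReal.ofReal τ ^ p.toReal ≠ 0 :=
    (ENNReal.rpow_pos (ENNReal.ofReal_pos.2 hτ) ENNReal.ofReal_ne_top).ne'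
  obtain ⟨F, hF, hFf⟩ := hT.exists_isCompactOperator_approx hqtop hp h hφ hφc hκ
  refine ⟨F, hF, opNorm_le_of_toLpMap hp hμ _ hτ.le fun f => ?_⟩
  have hfp := memLp_of_mem_boundedCompact f.2 hμ p
  have h1 := ENNReal.rpow_le_rpow (hFf f) (z := 1 / p.toReal) (by positivity)
  rw [ENNReal.mul_rpow_of_nonneg _ _ (by positivity), ← ENNReal.rpow_mul,
    mul_one_div_cancel hs.ne', ENNReal.rpow_one, ← eLpNorm_eq_lintegral_rpow_enorm_toReal hp0 hp,
    ← eLpNorm_eq_lintegral_rpow_enorm_toReal hp0 hp] at h1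
  have h2 : eLpNorm (⇑((S - F) (toLpMap p hμ f))) p (wm w) =
      eLpNorm (fun x => comm T φ f x - F (toLpMap p hμ f) x) p (wm w) := by
    refine eLpNorm_congr_ae ?_
    rw [sub_apply]
    filter_upwards [Lp.coeFn_sub (S (toLpMap p hμ f)) (F (toLpMap p hμ f)),
      hμ.ae_le (hS.ae_eq hμ f)] with x hx hx'
    rw [hx, Pi.sub_apply, hx']
  rw [Lp.norm_def, h2]
  change _ ≤ τ * ‖hfp.toLp _‖
  rw [Lp.norm_toLp, ← ENNReal.toReal_ofReal hτ.le, ← ENNReal.toReal_mul]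
  exact ENNReal.toReal_mono (ENNReal.mul_ne_top ENNReal.ofReal_ne_top hfp.2.ne) h1

theorem IsVMO.bmoSeminorm_ne_top {b : Euc n → ℂ} (hb : IsVMO b) : bmoSeminorm b ≠ ∞ := by
  obtain ⟨φ, hφ, hφc, hbφ⟩ := hb.approx 1 one_pos
  have hφL : LocallyIntegrable φ volume := hφ.continuous.locallyIntegrable
  have h1 := bmoSeminorm_add_le (hb.locallyIntegrable.sub hφL) hφL
  simp only [Pi.sub_apply, sub_add_cancel] at h1
  exact ne_top_of_le_ne_top (ENNReal.add_ne_top.2 ⟨(hbφ.trans ENNReal.one_lt_top).ne,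
    bmoSeminorm_ne_top_of_continuous hφ.continuous hφc⟩) h1

/-- `[b, T] - [φ, T] = [b - φ, T]`, whose norm is at most `L` times the seminorm of `b - φ`, and
`[φ, T]` is compact by the previous case. -/
theorem IsCommOn.isCompactOperator (hT : IsCZPair T K C) (hqtop : q ≠ ∞)
    (hp : p ≠ ∞) (h : WeightPair p.toReal p' w v A) {b : Euc n → ℂ} (hb : IsVMO b)
    {S : Lp ℂ p (wm w) →L[ℂ] Lp ℂ p (wm w)} (hS : IsCommOn (wm w) b T S) :
    IsCompactOperator S := by
  have := h.isLocallyFiniteMeasure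
  have hμ := wm_absolutelyContinuous w
  obtain ⟨L, hL, hle⟩ := hT.exists_eLpNorm_comm_le hqtop hp h
  refine isCompactOperator_of_forall_norm_sub_le fun τ hτ => ?_
  -- `L + 1` in place of `L`, which may vanish.
  have hε : 0 < ENNReal.ofReal τ / (L + 1) :=
    ENNReal.div_pos (ENNReal.ofReal_pos.2 hτ).ne' (by finiteness)
  obtain ⟨φ, hφ, hφc, hbφ⟩ := hb.approx _ hε
  have hφL : LocallyIntegrable φ volume := hφ.continuous.locallyIntegrable
  have hφβ := bmoSeminorm_ne_top_of_continuous hφ.continuous hφc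
  obtain ⟨F, hF⟩ := hT.exists_isCommOn hqtop hp h hφL hφβ
  refine ⟨F, hF.isCompactOperator_of_continuous hT hqtop hp h hφ.continuous hφc,
    opNorm_le_of_toLpMap hp hμ _ hτ.le fun f => ?_⟩
  have hfp := memLp_of_mem_boundedCompact f.2 hμ p
  have hfq := memLp_of_mem_boundedCompact f.2 Measure.AbsolutelyContinuous.rfl q
  have hbf := memLp_mul_of_bmo hqtop hb.locallyIntegrable hb.bmoSeminorm_ne_top f.2
  have hφf := memLp_mul_of_bmo hqtop hφL hφβ f.2
  have e : (fun x => (b x - φ x) * (f : Euc n → ℂ) x) =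
      fun x => b x * (f : Euc n → ℂ) x - φ x * (f : Euc n → ℂ) x := by ext x; ring
  have hbφf : MemLp (fun x => (b x - φ x) * (f : Euc n → ℂ) x) q volume := by
    rw [e]
    exact hbf.sub hφf
  have hcomm : ⇑((S - F) (toLpMap p hμ f)) =ᵐ[wm w] comm T (fun x => b x - φ x) f := by
    rw [sub_apply]
    filter_upwards [Lp.coeFn_sub (S (toLpMap p hμ f)) (F (toLpMap p hμ f)),
      hμ.ae_le (hS.ae_eq hμ f), hμ.ae_le (hF.ae_eq hμ f), hμ.ae_le (app_sub T hbf hφf)]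
      with x hx hx1 hx2 hx3
    rw [hx, Pi.sub_apply, hx1, hx2, comm, comm, comm, e, hx3]
    ring
  have h1 := hle (fun x => b x - φ x) f (hb.locallyIntegrable.sub hφL)
    (ne_top_of_lt hbφ) hfq hbφf (isBounded_support_of_mem_boundedCompact f.2)
  have h2 : L * bmoSeminorm (fun x => b x - φ x) ≤ ENNReal.ofReal τ := by
    calc L * bmoSeminorm (fun x => b x - φ x) ≤ (L + 1) * (ENNReal.ofReal τ / (L + 1)) :=
          mul_le_mul' le_self_add hbφ.le
      _ = ENNReal.ofReal τ := ENNReal.mul_div_cancel (by simp) (by finiteness)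
  rw [Lp.norm_def, eLpNorm_congr_ae hcomm]
  change _ ≤ τ * ‖hfp.toLp _‖
  rw [Lp.norm_toLp, ← ENNReal.toReal_ofReal hτ.le, ← ENNReal.toReal_mul]
  exact ENNReal.toReal_mono (ENNReal.mul_ne_top ENNReal.ofReal_ne_top hfp.2.ne)
    (h1.trans (mul_le_mul_left h2 _))

end compactness

end CZCommutator
-- The theorem.
theorem mainTheorem2 (n : ℕ) (hn : 1 ≤ n) (p q : ℝ≥0∞) [Fact (1 ≤ p)] [Fact (1 ≤ q)]
    (hp : 1 < p) (hp_top : p < ∞) (hq : 1 < q) (hq_top : q < ∞)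
    (T : Lp ℂ q (volume : Measure (EuclideanSpace ℝ (Fin n))) →L[ℂ]
      Lp ℂ q (volume : Measure (EuclideanSpace ℝ (Fin n))))
    (hT : CZCommutator.IsCZOperator T)
    (ω : EuclideanSpace ℝ (Fin n) → ℝ) (hω : CZCommutator.IsMuckenhoupt p.toReal ω)
    (b : EuclideanSpace ℝ (Fin n) → ℂ) (hb : CZCommutator.IsVMO b) :
    (∃! S : Lp ℂ p (CZCommutator.weightMeasure ω) →L[ℂ] Lp ℂ p (CZCommutator.weightMeasure ω),
      CZCommutator.IsCommutator ω b T S) ∧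
    ∀ S : Lp ℂ p (CZCommutator.weightMeasure ω) →L[ℂ] Lp ℂ p (CZCommutator.weightMeasure ω),
      CZCommutator.IsCommutator ω b T S → IsCompactOperator S := by
  have : NeZero n := ⟨by omega⟩
  obtain ⟨K, C, hK⟩ := hT.exists_isCZPair
  have hpr : 1 < p.toReal := by
    rw [← ENNReal.toReal_one]
    exact (ENNReal.toReal_lt_toReal ENNReal.one_ne_top hp_top.ne).2 hp
  obtain ⟨w, v, A, h, hμ⟩ := hω.exists_weightPair hpr
  -- `IsCommOn` has the measure as a variable, so the space itself can be rewritten along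
  -- `weightMeasure ω = wm w`.
  change (∃! S : Lp ℂ p (CZCommutator.weightMeasure ω) →L[ℂ] Lp ℂ p (CZCommutator.weightMeasure ω),
      CZCommutator.IsCommOn (CZCommutator.weightMeasure ω) b T S) ∧
    ∀ S : Lp ℂ p (CZCommutator.weightMeasure ω) →L[ℂ] Lp ℂ p (CZCommutator.weightMeasure ω),
      CZCommutator.IsCommOn (CZCommutator.weightMeasure ω) b T S → IsCompactOperator S
  rw [hμ]
  have := h.isLocallyFiniteMeasure
  obtain ⟨S, hS⟩ := hK.exists_isCommOn hq_top.ne hp_top.ne h hb.locallyIntegrable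
    hb.bmoSeminorm_ne_top
  exact ⟨⟨S, hS, fun S' hS' => hS'.unique hp_top.ne
    (CZCommutator.wm_absolutelyContinuous w) hS⟩,
    fun S' hS' => hS'.isCompactOperator hK hq_top.ne hp_top.ne h hb⟩
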